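/- Let $k$ be a field and let $B$ be a concealed $k$-algebra, i.e. $B\cong \mathrm{End}_A(T)$ for a preinjective tilting module $T$ over a finite-dimensional hereditary $k$-algebra $A$. Write $\operatorname{mod} B$ for the category of finite-dimensional right $B$-modules and $\tau_B$ for its Auslander–Reiten translation. Let $Q$ be a finite quiver with set of vertices $Q_0$, and let $H=\bigoplus_{v\in Q_0}H_v$ be a postprojective slice of $\operatorname{mod} B$ (the $H_v$ are indecomposable, lie in postprojective components of the Auslander–Reiten quiver, and form a slice in the sense of Ringel) such that $\mathrm{End}_B(H)$ is the path algebra $kQ$, the projection of $H$ onto $H_v$ corresponding to the trivial path at $v$. Put $$\mathcal{M}=\{X\in\operatorname{mod} B \mid \mathrm{Ext}^1_B(X,H)=0\}.$$ Then $\mathcal{M}$ has finitely many indecomposable objects up to isomorphism, and they can be listed without repetition as $X_1,\dots,X_N$ in such a way that $\mathrm{Hom}_B(X_i,X_j)\neq 0$ implies $i\le j$. Let $X_1,\dots,X_N$ be any such list. For each $i$ there are a unique integer $q\ge 0$ and a unique vertex $\varphi(i)\in Q_0$ with $\tau_B^{-q}X_i\cong H_{\varphi(i)}$. Let $W$ be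 the Coxeter group of $Q$, with generators the vertices of $Q$ and relations $v^2=1$ for all $v$; $vv'=v'v$ if $v\ne v'$ and there is no arrow between $v$ and $v'$; and $vv'v=v'vv'$ if there is exactly one arrow between $v$ and $v'$. Then the word $w=\varphi(1)\varphi(2)\cdots\varphi(N)$ is reduced in $W$. -/

import Mathlib

open CategoryTheory CategoryTheory.Limits

universe u v w

noncomputable section

/-! ### The path algebra of a finite quiver -/

/-- The set of all paths of a quiver (including the trivial ones), each with its source and its
target. -/
abbrev AllPaths (V : Type v) [Quiver.{w} V] : Type (max v w) := Σ a b : V, Quiver.Path a b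

/-- The underlying vector space of the path algebra: the paths form a basis. -/
def PathAlgebra (k : Type u) [Field k] (V : Type v) [Quiver.{w} V] : Type (max u v w) :=
  AllPaths V →₀ k

namespace PathAlgebra

variable {k : Type u} [Field k] {V : Type v} [Quiver.{w} V]

instance : AddCommGroup (PathAlgebra k V) := inferInstanceAs (AddCommGroup (AllPaths V →₀ k))

instance : Module k (PathAlgebra k V) := inferInstanceAs (Module k (AllPaths V →₀ k))

/-- The basis element attached to a path. -/
def ofPath (k : Type u) [Field k] {V : Type v} [Quiver.{w} V] {a b : V} (p : Quiver.Path a b) :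
    PathAlgebra k V :=
  Finsupp.single (⟨a, b, p⟩ : AllPaths V) (1 : k)

open Classical in
/-- The product of two paths: `q * p` is "first `p`, then `q`" if `p` ends where `q` starts, and
zero otherwise (the convention of the composition of maps). -/
def mulPath (k : Type u) [Field k] {V : Type v} [Quiver.{w} V] (q p : AllPaths V) :
    PathAlgebra k V :=
  if h : p.2.1 = q.1 then ofPath k ((p.2.2.cast rfl h).comp q.2.2) else 0

/-- The bilinear extension of the product of paths. -/
def mulHom (k : Type u) [Field k] (V : Type v) [Quiver.{w} V] :
    PathAlgebra k V →ₗ[k] PathAlgebra k V →ₗ[k] PathAlgebra k V :=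
  Finsupp.linearCombination k
    (fun q : AllPaths V => (Finsupp.linearCombination k (fun p : AllPaths V => mulPath k q p) :
      PathAlgebra k V →ₗ[k] PathAlgebra k V))

instance : Mul (PathAlgebra k V) := ⟨fun x y => mulHom k V x y⟩

instance [Fintype V] : One (PathAlgebra k V) :=
  ⟨∑ a : V, ofPath k (Quiver.Path.nil : Quiver.Path a a)⟩

theorem mul_def (x y : PathAlgebra k V) : x * y = mulHom k V x y := rfl

theorem one_def [Fintype V] :
    (1 : PathAlgebra k V) = ∑ a : V, ofPath k (Quiver.Path.nil : Quiver.Path a a) := rfl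

theorem induction {P : PathAlgebra k V → Prop} (x : PathAlgebra k V) (h0 : P 0)
    (ha : ∀ x y, P x → P y → P (x + y))
    (hs : ∀ (c : k) {a b : V} (p : Quiver.Path a b), P (c • ofPath k p)) : P x := by
  refine Finsupp.induction_linear (motive := P) x h0 (fun f g => ha f g) ?_
  rintro ⟨a, b, p⟩ c
  have : (Finsupp.single (⟨a, b, p⟩ : AllPaths V) c : AllPaths V →₀ k) =
      (c • Finsupp.single (⟨a, b, p⟩ : AllPaths V) (1 : k) : AllPaths V →₀ k) := by simp
  rw [this]
  exact hs c p

theorem ofPath_mul_ofPath {a b c d : V} (q : Quiver.Path c d) (p : Quiver.Path a b) :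
    ofPath k q * ofPath k p = mulPath k ⟨c, d, q⟩ ⟨a, b, p⟩ := by
  have h₁ : mulHom k V (ofPath k q) = (Finsupp.linearCombination k
      (fun p : AllPaths V => mulPath k ⟨c, d, q⟩ p) : PathAlgebra k V →ₗ[k] PathAlgebra k V) :=
    (Finsupp.linearCombination_single k (1 : k) (⟨c, d, q⟩ : AllPaths V)).trans (one_smul k _)
  rw [mul_def, h₁]
  exact (Finsupp.linearCombination_single k (1 : k) (⟨a, b, p⟩ : AllPaths V)).trans (one_smul k _)

theorem ofPath_mul_ofPath_same {a b c : V} (q : Quiver.Path b c) (p : Quiver.Path a b) :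
    ofPath k q * ofPath k p = ofPath k (p.comp q) := by
  rw [ofPath_mul_ofPath]
  simp [mulPath]

theorem ofPath_mul_ofPath_ne {a b c d : V} (q : Quiver.Path c d) (p : Quiver.Path a b)
    (h : b ≠ c) : ofPath k q * ofPath k p = 0 := by
  rw [ofPath_mul_ofPath]
  simp [mulPath, h]

theorem add_mul' (x y z : PathAlgebra k V) : (x + y) * z = x * z + y * z := by
  simp [mul_def]

theorem mul_add' (x y z : PathAlgebra k V) : x * (y + z) = x * y + x * z := by
  simp [mul_def]

theorem smul_mul' (c : k) (x y : PathAlgebra k V) : (c • x) * y = c • (x * y) := by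
  simp [mul_def]

theorem mul_smul' (c : k) (x y : PathAlgebra k V) : x * (c • y) = c • (x * y) := by
  simp [mul_def]

theorem zero_mul' (x : PathAlgebra k V) : 0 * x = 0 := by simp [mul_def]

theorem mul_zero' (x : PathAlgebra k V) : x * 0 = 0 := by simp [mul_def]

theorem mul_assoc' (x y z : PathAlgebra k V) : x * y * z = x * (y * z) := by
  induction x using induction with
  | h0 => simp only [zero_mul']
  | ha x x' h h' => simp only [add_mul', h, h']
  | hs r p =>
  induction y using induction with
  | h0 => simp only [zero_mul', mul_zero']
  | ha y y' h h' => simp only [add_mul', mul_add', h, h']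
  | hs s q =>
  induction z using induction with
  | h0 => simp only [mul_zero']
  | ha z z' h h' => simp only [mul_add', h, h']
  | hs t l =>
  simp only [smul_mul', mul_smul']
  congr 3
  rename_i a b c d e f
  by_cases h : d = a
  · subst h
    by_cases h' : f = c
    · subst h'
      simp only [ofPath_mul_ofPath_same, Quiver.Path.comp_assoc]
    · rw [ofPath_mul_ofPath_same, ofPath_mul_ofPath_ne _ _ h', ofPath_mul_ofPath_ne _ _ h',
        mul_zero']
  · rw [ofPath_mul_ofPath_ne _ _ h, zero_mul']
    by_cases h' : f = c
    · subst h'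
      rw [ofPath_mul_ofPath_same, ofPath_mul_ofPath_ne _ _ h]
    · rw [ofPath_mul_ofPath_ne _ _ h', mul_zero']

theorem one_mul' [Fintype V] (x : PathAlgebra k V) : 1 * x = x := by
  induction x using induction with
  | h0 => simp only [mul_zero']
  | ha x x' h h' => simp only [mul_add', h, h']
  | hs r p =>
  rename_i a b
  rw [mul_smul', one_def, mul_def, map_sum, LinearMap.sum_apply,
    Finset.sum_eq_single b (fun c _ hc => by rw [← mul_def, ofPath_mul_ofPath_ne _ _ hc.symm])
      (by simp), ← mul_def, ofPath_mul_ofPath_same, Quiver.Path.comp_nil]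

theorem mul_one' [Fintype V] (x : PathAlgebra k V) : x * 1 = x := by
  induction x using induction with
  | h0 => simp only [zero_mul']
  | ha x x' h h' => simp only [add_mul', h, h']
  | hs r p =>
  rename_i a b
  rw [smul_mul', one_def, mul_def, map_sum,
    Finset.sum_eq_single a (fun c _ hc => by rw [← mul_def, ofPath_mul_ofPath_ne _ _ hc])
      (by simp), ← mul_def, ofPath_mul_ofPath_same, Quiver.Path.nil_comp]

instance [Fintype V] : Ring (PathAlgebra k V) :=
  { (inferInstance : AddCommGroup (PathAlgebra k V)),
    (inferInstance : Mul (PathAlgebra k V)),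
    (inferInstance : One (PathAlgebra k V)) with
    left_distrib := mul_add'
    right_distrib := add_mul'
    zero_mul := zero_mul'
    mul_zero := mul_zero'
    mul_assoc := mul_assoc'
    one_mul := one_mul'
    mul_one := mul_one' }

instance [Fintype V] : Algebra k (PathAlgebra k V) :=
  Algebra.ofModule smul_mul' mul_smul'

end PathAlgebra

/-! ### The Coxeter group of a finite quiver -/

open Classical in
/-- The Coxeter matrix of a finite quiver: for `a ≠ b` the entry is `2` if there is no arrow
between `a` and `b`, `3` if there is exactly one, and `∞` (encoded as `0`) otherwise. -/
def quiverCoxeterMatrix (V : Type v) [Quiver.{w} V] [∀ a b : V, Fintype (a ⟶ b)] :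
    CoxeterMatrix V where
  M := Matrix.of fun a b =>
    if a = b then 1
    else if Fintype.card (a ⟶ b) + Fintype.card (b ⟶ a) = 0 then 2
    else if Fintype.card (a ⟶ b) + Fintype.card (b ⟶ a) = 1 then 3
    else 0
  isSymm := by
    ext a b
    simp only [Matrix.transpose_apply, Matrix.of_apply, eq_comm (a := b) (b := a),
      add_comm (Fintype.card (b ⟶ a))]
  diagonal a := by simp
  off_diagonal a b h := by
    simp only [Matrix.of_apply, h, if_false]
    split_ifs <;> simp

/-! ### Auslander-Reiten theory

`R` is a ring; the modules considered are the finitely generated left `R`-modules. For a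
finite-dimensional algebra `B`, the right `B`-modules are the left modules over `Bᵐᵒᵖ`, and finitely
generated means finite-dimensional. -/

section AR

variable {R : Type u} [Ring R]

/-- A finitely generated indecomposable module. -/
def IsInd (X : ModuleCat.{u} R) : Prop := Module.Finite R X ∧ Indecomposable X

/-- `0 ⟶ X ⟶ E ⟶ Y ⟶ 0` (with maps `f` and `g`) is an almost split sequence (Auslander-Reiten
sequence) in the category of finitely generated modules. -/
structure IsAlmostSplit {X E Y : ModuleCat.{u} R} (f : X ⟶ E) (g : E ⟶ Y) : Prop where
  ind_left : IsInd X
  ind_right : IsInd Y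
  finite : Module.Finite R E
  zero : f ≫ g = 0
  shortExact : (ShortComplex.mk f g zero).ShortExact
  not_splitMono : ¬ IsSplitMono f
  not_splitEpi : ¬ IsSplitEpi g
  left_factor : ∀ (Z : ModuleCat.{u} R) (h : X ⟶ Z), Module.Finite R Z → ¬ IsSplitMono h →
    ∃ h' : E ⟶ Z, f ≫ h' = h
  right_factor : ∀ (Z : ModuleCat.{u} R) (h : Z ⟶ Y), Module.Finite R Z → ¬ IsSplitEpi h →
    ∃ h' : Z ⟶ E, h' ≫ g = h

/-- `X` is isomorphic to the Auslander-Reiten translate `τ Y` of the indecomposable non-projective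
module `Y`; equivalently `Y` is isomorphic to `τ⁻¹ X` and `X` is indecomposable non-injective. -/
def IsTau (X Y : ModuleCat.{u} R) : Prop :=
  ∃ (E : ModuleCat.{u} R) (f : X ⟶ E) (g : E ⟶ Y), IsAlmostSplit f g

/-- `IsTauInvPow q X Y`: the module `τ^{-q} X` is isomorphic to `Y` (used for indecomposable `X` and
`Y`, so that no `τ^{-j} X` with `j ≤ q` vanishes; equivalently `X` is isomorphic to `τ^q Y`). -/
def IsTauInvPow : ℕ → ModuleCat.{u} R → ModuleCat.{u} R → Prop
  | 0, X, Y => Nonempty (X ≅ Y)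
  | q + 1, X, Y => ∃ Z : ModuleCat.{u} R, IsTau X Z ∧ IsTauInvPow q Z Y

/-- An irreducible morphism in the category of finitely generated modules. -/
def IsIrreducibleMap {X Y : ModuleCat.{u} R} (f : X ⟶ Y) : Prop :=
  ¬ IsSplitMono f ∧ ¬ IsSplitEpi f ∧
    ∀ (Z : ModuleCat.{u} R) (g : X ⟶ Z) (h : Z ⟶ Y), Module.Finite R Z → g ≫ h = f →
      IsSplitMono g ∨ IsSplitEpi h

/-- There is an arrow from (the isomorphism class of) `X` to that of `Y` in the Auslander-Reiten
quiver. -/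
def ARArrow (X Y : ModuleCat.{u} R) : Prop :=
  IsInd X ∧ IsInd Y ∧ ∃ f : X ⟶ Y, IsIrreducibleMap f

/-- `X` and `Y` are indecomposable and their isomorphism classes lie in the same connected component
of the Auslander-Reiten quiver. -/
def SameARComponent (X Y : ModuleCat.{u} R) : Prop :=
  IsInd X ∧ IsInd Y ∧ Relation.EqvGen (fun U W => Nonempty (U ≅ W) ∨ ARArrow U W) X Y

/-- `X` is an indecomposable module in a postprojective component: a component of the
Auslander-Reiten quiver without oriented cycles, every module in which is of the form `τ^{-q} P`
with `P` indecomposable projective. -/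
def IsPostprojective (X : ModuleCat.{u} R) : Prop :=
  IsInd X ∧ ∀ Y : ModuleCat.{u} R, SameARComponent X Y →
    ¬ Relation.TransGen ARArrow Y Y ∧
    ∃ (q : ℕ) (P : ModuleCat.{u} R), IsInd P ∧ Projective P ∧ IsTauInvPow q P Y

/-- `X` is an indecomposable module in a preinjective component: a component of the
Auslander-Reiten quiver without oriented cycles, every module in which is of the form `τ^q I`
with `I` indecomposable injective. -/
def IsPreinjective (X : ModuleCat.{u} R) : Prop :=
  IsInd X ∧ ∀ Y : ModuleCat.{u} R, SameARComponent X Y →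
    ¬ Relation.TransGen ARArrow Y Y ∧
    ∃ (q : ℕ) (I : ModuleCat.{u} R), IsInd I ∧ Injective I ∧ IsTauInvPow q Y I

/-- There is a chain of non-zero morphisms between indecomposable modules from `X` to `Y`. -/
def Precedes : ModuleCat.{u} R → ModuleCat.{u} R → Prop :=
  Relation.ReflTransGen fun X Y => IsInd X ∧ IsInd Y ∧ ∃ f : X ⟶ Y, f ≠ 0

/-- The (isomorphism classes of the) modules `H a` form a slice of the module category, in the sense
of Ringel. -/
structure IsSlice {V : Type v} (H : V → ModuleCat.{u} R) : Prop where
  ind : ∀ a, IsInd (H a)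
  sincere : ∀ P : ModuleCat.{u} R, IsInd P → Projective P → ∃ (a : V) (f : P ⟶ H a), f ≠ 0
  pathClosed : ∀ (a b : V) (X : ModuleCat.{u} R), IsInd X → Precedes (H a) X → Precedes X (H b) →
    ∃ c, Nonempty (X ≅ H c)
  tau : ∀ a b, ¬ IsTau (H a) (H b)
  predecessor : ∀ (a : V) (X : ModuleCat.{u} R), ARArrow X (H a) →
    ∃ b, Nonempty (X ≅ H b) ∨ IsTau X (H b)

/-- A postprojective slice: a slice all of whose members lie in postprojective components. -/
def IsPostprojectiveSlice {V : Type v} (H : V → ModuleCat.{u} R) : Prop :=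
  IsSlice H ∧ ∀ a, IsPostprojective (H a)

/-! ### Tilting modules and concealed algebras -/

/-- `X` is in `add T`: it is a direct summand of a finite direct sum of copies of `T`. -/
def InAdd (T X : ModuleCat.{u} R) : Prop :=
  ∃ n : ℕ, Nonempty (Retract X (⨁ fun _ : Fin n => T))

/-- A (classical) tilting module. -/
structure IsTilting (T : ModuleCat.{u} R) : Prop where
  finite : Module.Finite R T
  projDim : HasProjectiveDimensionLE T 1
  rigid : Subsingleton (Abelian.Ext.{u} T T 1)
  coresolution : ∃ S : ShortComplex (ModuleCat.{u} R), S.ShortExact ∧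
    Nonempty (S.X₁ ≅ ModuleCat.of R R) ∧ InAdd T S.X₂ ∧ InAdd T S.X₃

end AR

/-- `B` is a concealed `k`-algebra: it is isomorphic to the endomorphism algebra of a preinjective
tilting (right) module `T` over a finite-dimensional hereditary `k`-algebra `A`. -/
def IsConcealed (k B : Type u) [Field k] [Ring B] [Algebra k B] : Prop :=
  ∃ (A : Type u) (_ : Ring A) (_ : Algebra k A) (T : ModuleCat.{u} Aᵐᵒᵖ),
    Module.Finite k A ∧
    (∀ I : Ideal Aᵐᵒᵖ, Module.Projective Aᵐᵒᵖ I) ∧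
    IsTilting T ∧
    (∀ X : ModuleCat.{u} Aᵐᵒᵖ, IsInd X → Nonempty (Retract X T) → IsPreinjective X) ∧
    Nonempty (B ≃ₐ[k] End T)

/-! ### The word of a postprojective slice -/

section Word

variable (k : Type u) {R : Type u} [Field k] [Ring R] [Algebra k R]
variable {V : Type v} [Fintype V]

/-- The endomorphism algebra of `H = ⨁ H a` is the path algebra of the quiver with set of
vertices `V`, the projection of `H` onto its summand `H a` being the trivial path at `a`. -/
def IsQuiverOfEnd [Quiver.{w} V] (H : V → ModuleCat.{u} R) : Prop :=
  ∃ e : End (⨁ H) ≃ₐ[k] PathAlgebra k V, ∀ a : V,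
    e (End.of (biproduct.π H a ≫ biproduct.ι H a)) =
      PathAlgebra.ofPath k (Quiver.Path.nil : Quiver.Path a a)

/-- The finitely generated modules `X` with `Ext¹(X, H) = 0`, where `H = ⨁ H a`. -/
def InM (H : V → ModuleCat.{u} R) (X : ModuleCat.{u} R) : Prop :=
  Module.Finite R X ∧ Subsingleton (Abelian.Ext.{u} X (⨁ H) 1)

/-- `X 0, …, X (N - 1)` is a complete list without repetition of the indecomposables (up to
isomorphism) with `Ext¹(X, H) = 0`, ordered such that `Hom (X i, X j) ≠ 0` only if `i ≤ j`. -/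
structure IsOrdering (H : V → ModuleCat.{u} R) {N : ℕ} (X : Fin N → ModuleCat.{u} R) : Prop where
  ind : ∀ i, Indecomposable (X i)
  mem : ∀ i, InM H (X i)
  injective : ∀ i j, Nonempty (X i ≅ X j) → i = j
  complete : ∀ Y : ModuleCat.{u} R, Indecomposable Y → InM H Y → ∃ i, Nonempty (Y ≅ X i)
  ordered : ∀ i j, (∃ f : X i ⟶ X j, f ≠ 0) → i ≤ j

end Word

end

noncomputable section

/-! ### Indecomposable modules over an artinian ring -/

section Ind

variable {R : Type u} [Ring R]

/-! The indecomposables of `M` are exactly the predecessors of the slice. A non-split extension of a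
predecessor `X` by `H a` would factor through the almost split sequence ending in `X` and yield a
non-zero map `H a ⟶ τ X`, which the slice axioms forbid (`IsPred.isSplitEpi`, `IsPred.inM`).
Conversely, if `X` in `M` is not a predecessor, then `Hom(X, H) = 0 = Ext¹(X, H)`, so for a
presentation `0 → K → P → X → 0` every map `K ⟶ H a` extends uniquely to `P`. This property spreads
from the slice to all predecessors along almost split sequences; `K` and `P` are sums of
predecessors, so `K ≅ P` and `X = 0` (`isPred_of_inM`). Predecessors are finite in number because
paths ending in a postprojective module cannot be prolonged backwards forever
(`IsPostprojective.acc`), and the absence of cycles allows them to be ordered. A predecessor outside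
the slice has an inverse translate which is again a predecessor (`IsPred.exists_isTau`); this rests
on the existence of almost split sequences (`exists_isTau_of_not_injective`).

For reducedness, let `s_v` be the simple reflections on `ℤ^V` and let `β_i` be the image of the
basis vector of `φ(i)` under `s_{φ(N)} ⋯ s_{φ(i+1)}`. The word is reduced once the `β_i` are
distinct and non-negative (`CoxeterSystem.isReduced_of_nodup_wordRoots`). In fact `β_i` is the
vector with entries `dim Hom(X_i, H_v)` (`SliceMesh.root_eq`): between `X_i` and its inverse
translate, the letters joined to `φ(i)` are counted by the multiplicities in the middle term, so the
reflection formula becomes the mesh relation; for a member of the slice it becomes the recursion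
counting paths in `Q`. These vectors are non-negative, and they are distinct because mesh relations
recover `dim Hom(X_i, X_l)` from them (`SliceMesh.dimVec_injective`). The multiplicities themselves
are determined by the invertibility of the matrix of dimensions of Hom spaces
(`SliceMesh.m_translate`). -/

theorem IsInd.of_iso {X Y : ModuleCat.{u} R} (hX : IsInd X) (e : X ≅ Y) : IsInd Y := by
  obtain ⟨h₁, h₂, h₃⟩ := hX
  exact ⟨Module.Finite.equiv e.toLinearEquiv, fun h => h₂ (h.of_iso e),
    fun Y' Z a => h₃ Y' Z (e.trans a)⟩

theorem IsInd.not_isZero {X : ModuleCat.{u} R} (hX : IsInd X) : ¬ IsZero X := hX.2.1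

theorem IsInd.id_ne_zero {X : ModuleCat.{u} R} (hX : IsInd X) : 𝟙 X ≠ 0 := fun h =>
  hX.not_isZero ((IsZero.iff_id_eq_zero X).2 h)

theorem IsInd.ne_zero_of_isIso {X : ModuleCat.{u} R} (hX : IsInd X) {Y : ModuleCat.{u} R}
    (f : X ⟶ Y) [IsIso f] : f ≠ 0 := by
  rintro rfl
  exact hX.id_ne_zero (by rw [← IsIso.hom_inv_id (0 : X ⟶ Y), zero_comp])

theorem ModuleCat.isZero_of_eq_bot {X : ModuleCat.{u} R} {p : Submodule R X}
    (h : IsZero (ModuleCat.of R p)) : p = ⊥ := by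
  have := ModuleCat.subsingleton_of_isZero h
  exact Submodule.eq_bot_of_subsingleton

theorem IsInd.eq_bot_or_eq_bot {X : ModuleCat.{u} R} (hX : IsInd X) {p q : Submodule R X}
    (h : IsCompl p q) : p = ⊥ ∨ q = ⊥ := by
  have e : X ≅ ModuleCat.of R p ⊞ ModuleCat.of R q :=
    (Submodule.prodEquivOfIsCompl p q h).symm.toModuleIso ≪≫
      (ModuleCat.biprodIsoProd (ModuleCat.of R p) (ModuleCat.of R q)).symm
  exact (hX.2.2 _ _ e).imp ModuleCat.isZero_of_eq_bot ModuleCat.isZero_of_eq_bot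

theorem hom_pow_eq {X : ModuleCat.{u} R} (f : End X) (n : ℕ) :
    (f ^ n : End X).hom = (f.hom : Module.End R X) ^ n :=
  map_pow X.endRingEquiv f n

variable [IsArtinianRing R]

/-- Fitting's lemma: for large `n`, `X` is the direct sum of the kernel and the range of `f ^ n`,
and one of them vanishes. -/
theorem IsInd.isIso_or_nilpotent {X : ModuleCat.{u} R} (hX : IsInd X) (f : End X) :
    IsIso (f : X ⟶ X) ∨ IsNilpotent f := by
  have := hX.1
  obtain ⟨n, hn⟩ := (LinearMap.eventually_isCompl_ker_pow_range_pow
    (f.hom : Module.End R X)).exists_forall_of_atTop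
  -- A positive exponent is needed so that a factor `f` can be split off on either side.
  have hn := hn (n + 1) (by lia)
  rcases hX.eq_bot_or_eq_bot hn with h | h
  · left
    have h' := hn.sup_eq_top
    rw [h, bot_sup_eq] at h'
    refine (ConcreteCategory.isIso_iff_bijective (f : X ⟶ X)).2 ⟨?_, ?_⟩
    · rw [LinearMap.ker_eq_bot, pow_succ] at h
      exact Function.Injective.of_comp (f := ⇑((f.hom : Module.End R X) ^ n)) h
    · rw [LinearMap.range_eq_top, pow_succ'] at h'
      exact Function.Surjective.of_comp (g := ⇑((f.hom : Module.End R X) ^ n)) h'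
  · right
    refine ⟨n + 1, ModuleCat.hom_ext ?_⟩
    rw [hom_pow_eq]
    exact LinearMap.range_eq_bot.1 h

/-- Endomorphism rings of indecomposables are local: after composition with the inverse of `f + g`
the summands add up to `1`, and `1` minus a nilpotent is a unit. -/
theorem IsInd.isIso_or_isIso_of_add {X Y : ModuleCat.{u} R} (hX : IsInd X) (f g : X ⟶ Y)
    [IsIso (f + g)] : IsIso f ∨ IsIso g := by
  have h : f ≫ inv (f + g) + g ≫ inv (f + g) = 𝟙 X := by
    rw [← Preadditive.add_comp, IsIso.hom_inv_id]
  rcases hX.isIso_or_nilpotent (End.of (f ≫ inv (f + g))) with h' | h'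
  · have : IsIso (f ≫ inv (f + g)) := h'
    exact Or.inl (IsIso.of_isIso_comp_right f (inv (f + g)))
  · right
    have h₂ : IsUnit (End.of (g ≫ inv (f + g))) := by
      have : End.of (g ≫ inv (f + g)) = 1 - End.of (f ≫ inv (f + g)) := eq_sub_of_add_eq' h
      rw [this]
      exact h'.isUnit_one_sub
    rw [isUnit_iff_isIso] at h₂
    have : IsIso (g ≫ inv (f + g)) := h₂
    exact IsIso.of_isIso_comp_right g (inv (f + g))

theorem IsInd.exists_isIso_of_sum {X Y : ModuleCat.{u} R} (hX : IsInd X) {ι : Type*}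
    (s : Finset ι) (f : ι → (X ⟶ Y)) (h : IsIso (∑ i ∈ s, f i)) : ∃ i ∈ s, IsIso (f i) := by
  classical
  induction s using Finset.induction_on with
  | empty =>
    rw [Finset.sum_empty] at h
    exact absurd rfl (hX.ne_zero_of_isIso (0 : X ⟶ Y))
  | insert a s ha ih =>
    rw [Finset.sum_insert ha] at h
    rcases hX.isIso_or_isIso_of_add (f a) (∑ i ∈ s, f i) with h' | h'
    · exact ⟨a, Finset.mem_insert_self _ _, h'⟩
    · obtain ⟨i, hi, h''⟩ := ih h'
      exact ⟨i, Finset.mem_insert_of_mem hi, h''⟩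

/-- By Fitting on `Y`, `r ≫ s` is invertible or nilpotent. Invertibility makes `s` split on both
sides; nilpotency would pass to the automorphism `s ≫ r`. -/
theorem IsInd.isIso_of_comp {X Y : ModuleCat.{u} R} (hX : IsInd X) (hY : IsInd Y) (s : X ⟶ Y)
    (r : Y ⟶ X) [IsIso (s ≫ r)] : IsIso s := by
  rcases hY.isIso_or_nilpotent (End.of (r ≫ s)) with h | ⟨n, hn⟩
  · have : IsIso (r ≫ s) := h
    have : IsSplitEpi s := IsSplitEpi.mk'
      ⟨inv (r ≫ s) ≫ r, by rw [Category.assoc, IsIso.inv_hom_id]⟩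
    have : IsSplitMono s := IsSplitMono.mk'
      ⟨r ≫ inv (s ≫ r), by rw [← Category.assoc, IsIso.hom_inv_id]⟩
    exact isIso_of_mono_of_isSplitEpi s
  · exfalso
    have key : ∀ m : ℕ, (End.of (s ≫ r)) ^ (m + 1) =
        End.of (s ≫ (((End.of (r ≫ s)) ^ m : End Y) : Y ⟶ Y) ≫ r) := by
      intro m
      induction m with
      | zero =>
        change _ = End.of (s ≫ 𝟙 Y ≫ r)
        rw [Category.id_comp, zero_add, pow_one]
      | succ m ih =>
        rw [pow_succ, ih, pow_succ, End.mul_def, End.mul_def]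
        change (s ≫ r) ≫ s ≫ (((End.of (r ≫ s)) ^ m : End Y) : Y ⟶ Y) ≫ r =
          s ≫ ((r ≫ s) ≫ (((End.of (r ≫ s)) ^ m : End Y) : Y ⟶ Y)) ≫ r
        simp only [Category.assoc]
    have h1 : IsUnit (End.of (s ≫ r)) := by rwa [isUnit_iff_isIso]
    have h2 := h1.pow (n + 1)
    rw [key, hn] at h2
    have h3 : IsUnit (0 : End X) := by
      convert h2
      change (0 : X ⟶ X) = s ≫ (0 : Y ⟶ Y) ≫ r
      rw [zero_comp, comp_zero]
    rw [isUnit_iff_isIso] at h3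
    exact hX.ne_zero_of_isIso (0 : X ⟶ X) rfl

theorem IsInd.isIso_of_isSplitMono {X Y : ModuleCat.{u} R} (hX : IsInd X) (hY : IsInd Y)
    (s : X ⟶ Y) [IsSplitMono s] : IsIso s := by
  have : IsIso (s ≫ retraction s) := by rw [IsSplitMono.id]; infer_instance
  exact hX.isIso_of_comp hY s (retraction s)

theorem IsInd.isIso_of_isSplitEpi {X Y : ModuleCat.{u} R} (hX : IsInd X) (hY : IsInd Y)
    (s : X ⟶ Y) [IsSplitEpi s] : IsIso s := by
  have : IsIso (section_ s ≫ s) := by rw [IsSplitEpi.id]; infer_instance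
  have := hY.isIso_of_comp hX (section_ s) s
  exact IsIso.of_isIso_comp_left (section_ s) s

end Ind

/-- A decomposition of a module into finitely many indecomposable direct summands. -/
structure IndDecomp {R : Type u} [Ring R] (M : ModuleCat.{u} R) where
  /-- The index set of the summands. -/
  ι : Type
  [fintype : Fintype ι]
  /-- The summands. -/
  Y : ι → ModuleCat.{u} R
  /-- The inclusions. -/
  s : ∀ i, Y i ⟶ M
  /-- The projections. -/
  r : ∀ i, M ⟶ Y i
  ind : ∀ i, IsInd (Y i)
  s_r : ∀ i, s i ≫ r i = 𝟙 (Y i)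
  s_r_ne : ∀ i j, i ≠ j → s i ≫ r j = 0
  sum : ∑ i, r i ≫ s i = 𝟙 M

namespace IndDecomp

attribute [instance] IndDecomp.fintype

variable {R : Type u} [Ring R] {M : ModuleCat.{u} R}

/-- The empty decomposition of a zero module. -/
def ofIsZero (h : IsZero M) : IndDecomp M where
  ι := Empty
  Y := Empty.elim
  s i := i.elim
  r i := i.elim
  ind i := i.elim
  s_r i := i.elim
  s_r_ne i := i.elim
  sum := h.eq_of_src _ _

/-- The decomposition of an indecomposable module. -/
def ofInd (h : IsInd M) : IndDecomp M where
  ι := Unit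
  Y _ := M
  s _ := 𝟙 M
  r _ := 𝟙 M
  ind _ := h
  s_r _ := by simp
  s_r_ne i j hij := (hij rfl).elim
  sum := by simp

/-- The decomposition of a direct sum of two modules. -/
def ofBiprod {M₁ M₂ : ModuleCat.{u} R} (d₁ : IndDecomp M₁) (d₂ : IndDecomp M₂)
    (e : M ≅ M₁ ⊞ M₂) : IndDecomp M where
  ι := d₁.ι ⊕ d₂.ι
  Y := Sum.elim d₁.Y d₂.Y
  s := Sum.rec (fun i => d₁.s i ≫ biprod.inl ≫ e.inv) (fun i => d₂.s i ≫ biprod.inr ≫ e.inv)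
  r := Sum.rec (fun i => e.hom ≫ biprod.fst ≫ d₁.r i) (fun i => e.hom ≫ biprod.snd ≫ d₂.r i)
  ind := by
    rintro (i | i)
    exacts [d₁.ind i, d₂.ind i]
  s_r := by
    rintro (i | i)
    · change (d₁.s i ≫ biprod.inl ≫ e.inv) ≫ (e.hom ≫ biprod.fst ≫ d₁.r i) = 𝟙 (d₁.Y i)
      simp [d₁.s_r]
    · change (d₂.s i ≫ biprod.inr ≫ e.inv) ≫ (e.hom ≫ biprod.snd ≫ d₂.r i) = 𝟙 (d₂.Y i)
      simp [d₂.s_r]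
  s_r_ne := by
    rintro (i | i) (j | j) h
    · change (d₁.s i ≫ biprod.inl ≫ e.inv) ≫ (e.hom ≫ biprod.fst ≫ d₁.r j) = 0
      simp [d₁.s_r_ne i j (by simpa using h)]
    · change (d₁.s i ≫ biprod.inl ≫ e.inv) ≫ (e.hom ≫ biprod.snd ≫ d₂.r j) = 0
      simp
    · change (d₂.s i ≫ biprod.inr ≫ e.inv) ≫ (e.hom ≫ biprod.fst ≫ d₁.r j) = 0
      simp
    · change (d₂.s i ≫ biprod.inr ≫ e.inv) ≫ (e.hom ≫ biprod.snd ≫ d₂.r j) = 0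
      simp [d₂.s_r_ne i j (by simpa using h)]
  sum := by
    have h₁ : ∑ i, e.hom ≫ biprod.fst ≫ d₁.r i ≫ d₁.s i ≫ biprod.inl ≫ e.inv =
        e.hom ≫ biprod.fst ≫ biprod.inl ≫ e.inv := by
      have := congr(e.hom ≫ biprod.fst ≫ $(d₁.sum) ≫ biprod.inl ≫ e.inv)
      simpa [Preadditive.comp_sum, Preadditive.sum_comp] using this
    have h₂ : ∑ i, e.hom ≫ biprod.snd ≫ d₂.r i ≫ d₂.s i ≫ biprod.inr ≫ e.inv =
        e.hom ≫ biprod.snd ≫ biprod.inr ≫ e.inv := by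
      have := congr(e.hom ≫ biprod.snd ≫ $(d₂.sum) ≫ biprod.inr ≫ e.inv)
      simpa [Preadditive.comp_sum, Preadditive.sum_comp] using this
    have h₃ := congr(e.hom ≫ $(biprod.total (X := M₁) (Y := M₂)) ≫ e.inv)
    rw [Fintype.sum_sum_type]
    change ∑ i, (e.hom ≫ biprod.fst ≫ d₁.r i) ≫ (d₁.s i ≫ biprod.inl ≫ e.inv) +
      ∑ i, (e.hom ≫ biprod.snd ≫ d₂.r i) ≫ (d₂.s i ≫ biprod.inr ≫ e.inv) = 𝟙 M
    simp only [Category.assoc, Preadditive.add_comp, Preadditive.comp_add, Category.id_comp,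
      Iso.hom_inv_id] at h₁ h₂ h₃ ⊢
    rw [h₁, h₂, h₃]

theorem ext_to (d : IndDecomp M) {Z : ModuleCat.{u} R} {f g : Z ⟶ M}
    (h : ∀ i, f ≫ d.r i = g ≫ d.r i) : f = g := by
  rw [← Category.comp_id f, ← Category.comp_id g, ← d.sum, Preadditive.comp_sum,
    Preadditive.comp_sum]
  exact Finset.sum_congr rfl fun i _ => by rw [← Category.assoc, h, Category.assoc]

theorem ext_from (d : IndDecomp M) {Z : ModuleCat.{u} R} {f g : M ⟶ Z}
    (h : ∀ i, d.s i ≫ f = d.s i ≫ g) : f = g := by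
  rw [← Category.id_comp f, ← Category.id_comp g, ← d.sum, Preadditive.sum_comp,
    Preadditive.sum_comp]
  exact Finset.sum_congr rfl fun i _ => by rw [Category.assoc, h, Category.assoc]

theorem exists_ne_zero_to (d : IndDecomp M) {Z : ModuleCat.{u} R} {f : Z ⟶ M} (h : f ≠ 0) :
    ∃ i, f ≫ d.r i ≠ 0 := by
  by_contra! h'
  exact h (d.ext_to fun i => by rw [h', zero_comp])

theorem exists_ne_zero_from (d : IndDecomp M) {Z : ModuleCat.{u} R} {f : M ⟶ Z} (h : f ≠ 0) :
    ∃ i, d.s i ≫ f ≠ 0 := by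
  by_contra! h'
  exact h (d.ext_from fun i => by rw [h', comp_zero])

theorem sum_comp_section (d : IndDecomp M) {Z : ModuleCat.{u} R} (f : ∀ i, Z ⟶ d.Y i) (j : d.ι) :
    (∑ i, f i ≫ d.s i) ≫ d.r j = f j := by
  rw [Preadditive.sum_comp, Finset.sum_eq_single j, Category.assoc, d.s_r, Category.comp_id]
  · intro i _ hij
    rw [Category.assoc, d.s_r_ne i j hij, comp_zero]
  · simp

theorem section_comp_sum (d : IndDecomp M) {Z : ModuleCat.{u} R} (f : ∀ i, d.Y i ⟶ Z) (j : d.ι) :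
    d.s j ≫ (∑ i, d.r i ≫ f i) = f j := by
  rw [Preadditive.comp_sum, Finset.sum_eq_single j, ← Category.assoc, d.s_r, Category.id_comp]
  · intro i _ hij
    rw [← Category.assoc, d.s_r_ne j i hij.symm, zero_comp]
  · simp

theorem finite (d : IndDecomp M) (i : d.ι) : Module.Finite R (d.Y i) := (d.ind i).1

end IndDecomp

/-- Induction on the length: both terms of a proper splitting have non-zero, hence strictly smaller,
length. -/
theorem nonempty_indDecomp {R : Type u} [Ring R] [IsArtinianRing R] (M : ModuleCat.{u} R)
    (hM : Module.Finite R M) : Nonempty (IndDecomp M) := by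
  have hl : Module.length R M ≠ ⊤ := Module.length_ne_top
  obtain ⟨n, hn⟩ := ENat.ne_top_iff_exists.1 hl
  clear hl
  induction n using Nat.strong_induction_on generalizing M with
  | _ n ih =>
  by_cases h0 : IsZero M
  · exact ⟨IndDecomp.ofIsZero h0⟩
  by_cases hi : Indecomposable M
  · exact ⟨IndDecomp.ofInd ⟨hM, hi⟩⟩
  simp only [Indecomposable, not_and, not_forall, not_or] at hi
  obtain ⟨Y, Z, e, hY, hZ⟩ := hi h0
  let e' : M ≃ₗ[R] (Y × Z) := (e ≪≫ ModuleCat.biprodIsoProd Y Z).toLinearEquiv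
  have fin : Module.Finite R (Y × Z) := Module.Finite.equiv e'
  have fY : Module.Finite R Y := Module.Finite.of_surjective (LinearMap.fst R Y Z)
    LinearMap.fst_surjective
  have fZ : Module.Finite R Z := Module.Finite.of_surjective (LinearMap.snd R Y Z)
    LinearMap.snd_surjective
  have hlen : Module.length R M = Module.length R Y + Module.length R Z := by
    rw [e'.length_eq, Module.length_prod]
  have nY : Module.length R Y ≠ 0 := by
    rw [Ne, Module.length_eq_zero_iff]
    exact fun h => hY (ModuleCat.isZero_of_subsingleton Y)
  have nZ : Module.length R Z ≠ 0 := by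
    rw [Ne, Module.length_eq_zero_iff]
    exact fun h => hZ (ModuleCat.isZero_of_subsingleton Z)
  obtain ⟨a, ha⟩ := ENat.ne_top_iff_exists.1 (Module.length_ne_top (R := R) (M := Y))
  obtain ⟨b, hb⟩ := ENat.ne_top_iff_exists.1 (Module.length_ne_top (R := R) (M := Z))
  rw [← hn, ← ha, ← hb] at hlen
  rw [← ha] at nY
  rw [← hb] at nZ
  norm_cast at hlen nY nZ
  obtain ⟨dY⟩ := ih a (by lia) Y fY ha
  obtain ⟨dZ⟩ := ih b (by lia) Z fZ hb
  exact ⟨dY.ofBiprod dZ e⟩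

/-! ### Almost split sequences and irreducible maps -/

section ShortExact

variable {R : Type u} [Ring R] {X E Y : ModuleCat.{u} R} {f : X ⟶ E} {g : E ⟶ Y} {w : f ≫ g = 0}

theorem exists_lift_of_shortExact (h : (ShortComplex.mk f g w).ShortExact) {A : ModuleCat.{u} R}
    (t : A ⟶ E) (ht : t ≫ g = 0) : ∃ l : A ⟶ X, l ≫ f = t := by
  have := h.mono_f
  exact ⟨h.exact.lift t ht, h.exact.lift_f t ht⟩

theorem exists_desc_of_shortExact (h : (ShortComplex.mk f g w).ShortExact) {A : ModuleCat.{u} R}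
    (t : E ⟶ A) (ht : f ≫ t = 0) : ∃ l : Y ⟶ A, g ≫ l = t := by
  have := h.epi_g
  exact ⟨h.exact.desc t ht, h.exact.g_desc t ht⟩

variable [IsArtinianRing R]

/-- If `x` were nilpotent, some `t ^ n` would vanish on `X` and factor through `g`. As `t ^ n` still
lies over `Y`, the factor would be a section of `g`. This is the form of minimality used for almost
split sequences. -/
theorem isIso_left_of_not_isSplitEpi (h : (ShortComplex.mk f g w).ShortExact) (hX : IsInd X)
    (hg : ¬ IsSplitEpi g) {t : E ⟶ E} (ht : t ≫ g = g) {x : X ⟶ X} (hx : f ≫ t = x ≫ f) :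
    IsIso x := by
  rcases hX.isIso_or_nilpotent (End.of x) with h' | ⟨n, hn⟩
  · exact h'
  exfalso
  have hf : ∀ m : ℕ, f ≫ (((End.of t) ^ m : End E) : E ⟶ E) =
      (((End.of x) ^ m : End X) : X ⟶ X) ≫ f := by
    intro m
    induction m with
    | zero => exact (Category.comp_id f).trans (Category.id_comp f).symm
    | succ m ih =>
      rw [pow_succ, pow_succ, End.mul_def, End.mul_def]
      change f ≫ t ≫ _ = (x ≫ _) ≫ f
      rw [← Category.assoc, hx, Category.assoc, ih, Category.assoc]
  have hg' : ∀ m : ℕ, (((End.of t) ^ m : End E) : E ⟶ E) ≫ g = g := by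
    intro m
    induction m with
    | zero => exact Category.id_comp g
    | succ m ih =>
      rw [pow_succ, End.mul_def]
      change (t ≫ _) ≫ g = g
      rw [Category.assoc, ih, ht]
  obtain ⟨l, hl⟩ := exists_desc_of_shortExact h (((End.of t) ^ n : End E) : E ⟶ E) (by
    rw [hf, hn]
    exact zero_comp)
  have := h.epi_g
  refine hg (IsSplitEpi.mk' ⟨l, ?_⟩)
  have h₁ : g ≫ l ≫ g = g ≫ 𝟙 Y := by rw [← Category.assoc, hl, hg', Category.comp_id]
  exact (cancel_epi g).1 h₁

theorem isIso_right_of_not_isSplitMono (h : (ShortComplex.mk f g w).ShortExact) (hY : IsInd Y)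
    (hf : ¬ IsSplitMono f) {t : E ⟶ E} (ht : f ≫ t = f) {y : Y ⟶ Y} (hy : t ≫ g = g ≫ y) :
    IsIso y := by
  rcases hY.isIso_or_nilpotent (End.of y) with h' | ⟨n, hn⟩
  · exact h'
  exfalso
  have hg : ∀ m : ℕ, (((End.of t) ^ m : End E) : E ⟶ E) ≫ g =
      g ≫ (((End.of y) ^ m : End Y) : Y ⟶ Y) := by
    intro m
    induction m with
    | zero => exact (Category.id_comp g).trans (Category.comp_id g).symm
    | succ m ih =>
      rw [pow_succ', pow_succ', End.mul_def, End.mul_def]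
      change (_ ≫ t) ≫ g = g ≫ _ ≫ y
      rw [Category.assoc, hy, ← Category.assoc, ih, Category.assoc]
  have hf' : ∀ m : ℕ, f ≫ (((End.of t) ^ m : End E) : E ⟶ E) = f := by
    intro m
    induction m with
    | zero => exact Category.comp_id f
    | succ m ih =>
      rw [pow_succ, End.mul_def]
      change f ≫ t ≫ _ = f
      rw [← Category.assoc, ht, ih]
  obtain ⟨l, hl⟩ := exists_lift_of_shortExact h (((End.of t) ^ n : End E) : E ⟶ E) (by
    rw [hg, hn]
    exact comp_zero)
  have := h.mono_f
  refine hf (IsSplitMono.mk' ⟨l, ?_⟩)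
  have h₁ : (f ≫ l) ≫ f = 𝟙 X ≫ f := by rw [Category.assoc, hl, hf', Category.id_comp]
  exact (cancel_mono f).1 h₁

end ShortExact

section AlmostSplit

variable {R : Type u} [Ring R]

theorem isSplitEpi_of_comp_eq_id {X Y : ModuleCat.{u} R} {s : Y ⟶ X} {r : X ⟶ Y} (h : s ≫ r = 𝟙 Y) :
    IsSplitEpi r := IsSplitEpi.mk' ⟨s, h⟩

theorem isSplitEpi_of_isIso_comp {X Y Z : ModuleCat.{u} R} (s : Y ⟶ X) (r : X ⟶ Z) [IsIso (s ≫ r)] :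
    IsSplitEpi r := IsSplitEpi.mk' ⟨inv (s ≫ r) ≫ s, by rw [Category.assoc, IsIso.inv_hom_id]⟩

theorem isSplitMono_of_isIso_comp {X Y Z : ModuleCat.{u} R} (s : Y ⟶ X) (r : X ⟶ Z)
    [IsIso (s ≫ r)] : IsSplitMono s :=
  IsSplitMono.mk' ⟨r ≫ inv (s ≫ r), by rw [← Category.assoc, IsIso.hom_inv_id]⟩

theorem isSplitEpi_of_comp {X Y Z : ModuleCat.{u} R} (s : Y ⟶ X) (r : X ⟶ Z) [IsSplitEpi (s ≫ r)] :
    IsSplitEpi r := IsSplitEpi.mk' ⟨section_ (s ≫ r) ≫ s, by rw [Category.assoc, IsSplitEpi.id]⟩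

theorem isSplitMono_of_comp {X Y Z : ModuleCat.{u} R} (s : Y ⟶ X) (r : X ⟶ Z)
    [IsSplitMono (s ≫ r)] : IsSplitMono s :=
  IsSplitMono.mk' ⟨r ≫ retraction (s ≫ r), by rw [← Category.assoc, IsSplitMono.id]⟩

theorem isSplitEpi_of_comp_isIso {X Y Z : ModuleCat.{u} R} (s : Y ⟶ X) (r : X ⟶ Z) [IsIso r]
    [h : IsSplitEpi (s ≫ r)] : IsSplitEpi s :=
  IsSplitEpi.mk' ⟨r ≫ section_ (s ≫ r), by
    rw [← cancel_mono r, Category.assoc, Category.assoc, IsSplitEpi.id, Category.comp_id,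
      Category.id_comp]⟩

theorem isSplitMono_of_isIso_comp_left {X Y Z : ModuleCat.{u} R} (s : Y ⟶ X) (r : X ⟶ Z) [IsIso s]
    [h : IsSplitMono (s ≫ r)] : IsSplitMono r :=
  IsSplitMono.mk' ⟨retraction (s ≫ r) ≫ s, by
    rw [← cancel_epi s, ← Category.assoc, ← Category.assoc, IsSplitMono.id, Category.comp_id,
      Category.id_comp]⟩

theorem IsIrreducibleMap.comp_iso {X Y Y' : ModuleCat.{u} R} {f : X ⟶ Y} (h : IsIrreducibleMap f)
    (e : Y ≅ Y') : IsIrreducibleMap (f ≫ e.hom) := by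
  obtain ⟨h₁, h₂, h₃⟩ := h
  refine ⟨fun h => h₁ (isSplitMono_of_comp f e.hom), fun h => h₂ (isSplitEpi_of_comp_isIso f e.hom),
    fun Z a b hZ hab => ?_⟩
  rcases h₃ Z a (b ≫ e.inv) hZ (by
    rw [← Category.assoc, hab, Category.assoc, e.hom_inv_id, Category.comp_id]) with h | h
  · exact Or.inl h
  · exact Or.inr (isSplitEpi_of_comp_isIso b e.inv)

theorem IsIrreducibleMap.iso_comp {X X' Y : ModuleCat.{u} R} {f : X ⟶ Y} (h : IsIrreducibleMap f)
    (e : X' ≅ X) : IsIrreducibleMap (e.hom ≫ f) := by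
  obtain ⟨h₁, h₂, h₃⟩ := h
  refine ⟨fun h => h₁ (isSplitMono_of_isIso_comp_left e.hom f),
    fun h => h₂ (isSplitEpi_of_comp e.hom f), fun Z a b hZ hab => ?_⟩
  rcases h₃ Z (e.inv ≫ a) b hZ (by
    rw [Category.assoc, hab, ← Category.assoc, e.inv_hom_id, Category.id_comp]) with h | h
  · exact Or.inl (isSplitMono_of_isIso_comp_left e.inv a)
  · exact Or.inr h

theorem ARArrow.of_iso {X X' Y Y' : ModuleCat.{u} R} (h : ARArrow X Y) (e : X ≅ X') (e' : Y ≅ Y') :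
    ARArrow X' Y' := by
  obtain ⟨hX, hY, f, hf⟩ := h
  exact ⟨hX.of_iso e, hY.of_iso e', _, (hf.iso_comp e.symm).comp_iso e'⟩

theorem IsIrreducibleMap.ne_zero {X Y : ModuleCat.{u} R} (hX : IsInd X) {f : X ⟶ Y}
    (h : IsIrreducibleMap f) : f ≠ 0 := by
  rintro rfl
  rcases h.2.2 (ModuleCat.of R PUnit) 0 0 (by infer_instance) (by simp) with h' | h'
  · have : 𝟙 X = 0 := by rw [← IsSplitMono.id (0 : X ⟶ ModuleCat.of R PUnit), zero_comp]
    exact hX.id_ne_zero this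
  · have : 𝟙 Y = 0 := by rw [← IsSplitEpi.id (0 : ModuleCat.of R PUnit ⟶ Y), comp_zero]
    exact h.2.1 (IsSplitEpi.mk' ⟨0, by rw [this, zero_comp]⟩)

theorem ARArrow.precedes {X Y : ModuleCat.{u} R} (h : ARArrow X Y) : Precedes X Y := by
  obtain ⟨hX, hY, f, hf⟩ := h
  exact Relation.ReflTransGen.single ⟨hX, hY, f, hf.ne_zero hX⟩

theorem precedes_of_iso {X Y : ModuleCat.{u} R} (hX : IsInd X) (e : X ≅ Y) : Precedes X Y :=
  Relation.ReflTransGen.single ⟨hX, hX.of_iso e, e.hom, hX.ne_zero_of_isIso e.hom⟩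

theorem IsAlmostSplit.comp_iso {X E Y Y' : ModuleCat.{u} R} {f : X ⟶ E} {g : E ⟶ Y}
    (h : IsAlmostSplit f g) (e : Y ≅ Y') : IsAlmostSplit f (g ≫ e.hom) where
  ind_left := h.ind_left
  ind_right := h.ind_right.of_iso e
  finite := h.finite
  zero := by rw [← Category.assoc, h.zero, zero_comp]
  shortExact := ShortComplex.shortExact_of_iso
    (ShortComplex.isoMk (S₁ := ShortComplex.mk f g h.zero) (Iso.refl _) (Iso.refl _) e (by simp)
      (by simp)) h.shortExact
  not_splitMono := h.not_splitMono
  not_splitEpi h' := h.not_splitEpi (isSplitEpi_of_comp_isIso g e.hom)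
  left_factor := h.left_factor
  right_factor Z t hZ ht := by
    obtain ⟨t', ht'⟩ := h.right_factor Z (t ≫ e.inv) hZ fun h' =>
      ht (isSplitEpi_of_comp_isIso t e.inv)
    exact ⟨t', by rw [← Category.assoc, ht', Category.assoc, e.inv_hom_id, Category.comp_id]⟩

theorem IsAlmostSplit.iso_comp {X X' E Y : ModuleCat.{u} R} {f : X ⟶ E} {g : E ⟶ Y}
    (h : IsAlmostSplit f g) (e : X' ≅ X) : IsAlmostSplit (e.hom ≫ f) g where
  ind_left := h.ind_left.of_iso e.symm
  ind_right := h.ind_right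
  finite := h.finite
  zero := by rw [Category.assoc, h.zero, comp_zero]
  shortExact := ShortComplex.shortExact_of_iso
    (ShortComplex.isoMk (S₁ := ShortComplex.mk f g h.zero) e.symm (Iso.refl _) (Iso.refl _)
      (by simp) (by simp)) h.shortExact
  not_splitMono h' := h.not_splitMono (isSplitMono_of_isIso_comp_left e.hom f)
  not_splitEpi := h.not_splitEpi
  left_factor Z t hZ ht := by
    obtain ⟨t', ht'⟩ := h.left_factor Z (e.inv ≫ t) hZ fun h' =>
      ht (isSplitMono_of_isIso_comp_left e.inv t)
    exact ⟨t', by rw [Category.assoc, ht', ← Category.assoc, e.hom_inv_id, Category.id_comp]⟩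
  right_factor := h.right_factor

theorem IsTau.of_iso {X X' Y Y' : ModuleCat.{u} R} (h : IsTau X Y) (e : X ≅ X') (e' : Y ≅ Y') :
    IsTau X' Y' := by
  obtain ⟨E, f, g, h⟩ := h
  exact ⟨E, _, _, (h.iso_comp e.symm).comp_iso e'⟩

theorem IsTau.ind_left {X Y : ModuleCat.{u} R} (h : IsTau X Y) : IsInd X := by
  obtain ⟨E, f, g, h⟩ := h
  exact h.ind_left

theorem IsTau.ind_right {X Y : ModuleCat.{u} R} (h : IsTau X Y) : IsInd Y := by
  obtain ⟨E, f, g, h⟩ := h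
  exact h.ind_right

theorem IsTauInvPow.of_iso_left {q : ℕ} {X X' Y : ModuleCat.{u} R} (h : IsTauInvPow q X Y)
    (e : X ≅ X') : IsTauInvPow q X' Y := by
  cases q with
  | zero => exact ⟨e.symm ≪≫ h.some⟩
  | succ q =>
    obtain ⟨Z, hZ, h⟩ := h
    exact ⟨Z, hZ.of_iso e (Iso.refl _), h⟩

theorem IsTauInvPow.succ_right {q : ℕ} {X Y : ModuleCat.{u} R} (h : IsTauInvPow (q + 1) X Y) :
    ∃ Z, IsTauInvPow q X Z ∧ IsTau Z Y := by
  induction q generalizing X with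
  | zero =>
    obtain ⟨Z, hZ, ⟨e⟩⟩ := h
    exact ⟨X, ⟨Iso.refl _⟩, hZ.of_iso (Iso.refl _) e⟩
  | succ q ih =>
    obtain ⟨W, hW, h⟩ := h
    obtain ⟨Z, hZ, h₁⟩ := ih h
    exact ⟨Z, ⟨W, hW, hZ⟩, h₁⟩

/-- A right almost split map `g : F ⟶ Y` which is minimal, in the form that no direct summand of `F`
can be split off by a map into the kernel of `g`. -/
structure IsSink {F Y : ModuleCat.{u} R} (g : F ⟶ Y) : Prop where
  ind : IsInd Y
  finite : Module.Finite R F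
  not_splitEpi : ¬ IsSplitEpi g
  factor : ∀ (Z : ModuleCat.{u} R) (h : Z ⟶ Y), Module.Finite R Z → ¬ IsSplitEpi h →
    ∃ h' : Z ⟶ F, h' ≫ g = h
  minimal : ∀ (W : ModuleCat.{u} R) (r : F ⟶ W) (t : W ⟶ F), IsInd W → t ≫ g = 0 →
    ¬ IsIso (t ≫ r)

/-- The middle term of an almost split sequence is not zero. -/
theorem IsAlmostSplit.nonempty {X E Y : ModuleCat.{u} R} {f : X ⟶ E} {g : E ⟶ Y}
    (h : IsAlmostSplit f g) (d : IndDecomp E) : Nonempty d.ι := by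
  by_contra hd
  rw [not_nonempty_iff] at hd
  have := h.shortExact.mono_f
  exact h.ind_left.id_ne_zero ((cancel_mono f).1 (d.ext_to fun i => hd.elim i))

variable [IsArtinianRing R]

/-- A map into the kernel of `g` factors through the indecomposable `X`; if it split off a summand,
that summand would be `X` and `f` would split. -/
theorem IsAlmostSplit.isSink {X E Y : ModuleCat.{u} R} {f : X ⟶ E} {g : E ⟶ Y}
    (h : IsAlmostSplit f g) : IsSink g where
  ind := h.ind_right
  finite := h.finite
  not_splitEpi := h.not_splitEpi
  factor := h.right_factor
  minimal W r t hW ht hi := by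
    obtain ⟨l, rfl⟩ := exists_lift_of_shortExact h.shortExact t ht
    rw [Category.assoc] at hi
    have := hW.isIso_of_comp h.ind_left l (f ≫ r)
    have : IsIso (f ≫ r) := IsIso.of_isIso_comp_left l (f ≫ r)
    exact h.not_splitMono (isSplitMono_of_isIso_comp f r)

/-- If `s ≫ g = a ≫ b` with `b` not split epi, then `b = c ≫ g`, and `s` differs from `a ≫ c` by a
map into the kernel of `g`. By minimality and locality of `End W`, `a ≫ c ≫ r` is invertible, so `a`
splits. -/
theorem IsSink.arrow {F Y W : ModuleCat.{u} R} {g : F ⟶ Y} (h : IsSink g) (hW : IsInd W)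
    {s : W ⟶ F} {r : F ⟶ W} (hs : s ≫ r = 𝟙 W) : IsIrreducibleMap (s ≫ g) := by
  have key : ¬ IsIso (s ≫ g) := fun hi => h.not_splitEpi (isSplitEpi_of_isIso_comp s g)
  refine ⟨fun hi => key (hW.isIso_of_isSplitMono h.ind _),
    fun hi => key (hW.isIso_of_isSplitEpi h.ind _), fun Z a b hZ hab => ?_⟩
  by_cases hb : IsSplitEpi b
  · exact Or.inr hb
  left
  obtain ⟨c, hc⟩ := h.factor Z b hZ hb
  have h₀ : (s - a ≫ c) ≫ g = 0 := by
    rw [Preadditive.sub_comp, Category.assoc, hc, hab, sub_self]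
  have h₁ := h.minimal W r (s - a ≫ c) hW h₀
  have h₂ : (s - a ≫ c) ≫ r + (a ≫ c) ≫ r = 𝟙 W := by
    rw [← Preadditive.add_comp, sub_add_cancel, hs]
  have : IsIso ((s - a ≫ c) ≫ r + (a ≫ c) ≫ r) := by rw [h₂]; infer_instance
  rcases hW.isIso_or_isIso_of_add ((s - a ≫ c) ≫ r) ((a ≫ c) ≫ r) with h' | h'
  · exact absurd h' h₁
  · rw [Category.assoc] at h'
    exact isSplitMono_of_isIso_comp a (c ≫ r)

theorem IsSink.arArrow {F Y : ModuleCat.{u} R} {g : F ⟶ Y} (h : IsSink g) (d : IndDecomp F)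
    (i : d.ι) : ARArrow (d.Y i) Y :=
  ⟨d.ind i, h.ind, _, h.arrow (d.ind i) (d.s_r i)⟩

theorem IsAlmostSplit.arrow_left {X E Y W : ModuleCat.{u} R} {f : X ⟶ E} {g : E ⟶ Y}
    (h : IsAlmostSplit f g) (hW : IsInd W) {s : W ⟶ E} {r : E ⟶ W} (hs : s ≫ r = 𝟙 W) :
    IsIrreducibleMap (f ≫ r) := by
  have key : ¬ IsIso (f ≫ r) := fun hi => h.not_splitMono (isSplitMono_of_isIso_comp f r)
  refine ⟨fun hi => key (h.ind_left.isIso_of_isSplitMono hW _),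
    fun hi => key (h.ind_left.isIso_of_isSplitEpi hW _), fun Z a b hZ hab => ?_⟩
  by_cases ha : IsSplitMono a
  · exact Or.inl ha
  right
  obtain ⟨c, hc⟩ := h.left_factor Z a hZ ha
  obtain ⟨e, he⟩ := exists_desc_of_shortExact h.shortExact (r - c ≫ b) (by
    rw [Preadditive.comp_sub, ← Category.assoc f, hc, hab, sub_self])
  have h₂ : s ≫ g ≫ e + s ≫ c ≫ b = 𝟙 W := by
    rw [← Preadditive.comp_add, he, sub_add_cancel, hs]
  have : IsIso (s ≫ g ≫ e + s ≫ c ≫ b) := by rw [h₂]; infer_instance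
  rcases hW.isIso_or_isIso_of_add (s ≫ g ≫ e) (s ≫ c ≫ b) with h' | h'
  · exfalso
    rw [← Category.assoc] at h'
    have := hW.isIso_of_comp h.ind_right (s ≫ g) e
    exact h.not_splitEpi (isSplitEpi_of_isIso_comp s g)
  · rw [← Category.assoc] at h'
    exact isSplitEpi_of_isIso_comp (s ≫ c) b

theorem IsAlmostSplit.arArrow_left {X E Y : ModuleCat.{u} R} {f : X ⟶ E} {g : E ⟶ Y}
    (h : IsAlmostSplit f g) (d : IndDecomp E) (i : d.ι) : ARArrow X (d.Y i) :=
  ⟨h.ind_left, d.ind i, _, h.arrow_left (d.ind i) (d.s_r i)⟩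

theorem IsTau.exists_arArrow {X Y : ModuleCat.{u} R} (h : IsTau X Y) :
    ∃ W, ARArrow X W ∧ ARArrow W Y := by
  obtain ⟨E, f, g, h⟩ := h
  obtain ⟨d⟩ := nonempty_indDecomp E h.finite
  obtain ⟨i⟩ := h.nonempty d
  exact ⟨d.Y i, h.arArrow_left d i, h.isSink.arArrow d i⟩

theorem IsTau.transGen {X Y : ModuleCat.{u} R} (h : IsTau X Y) : Relation.TransGen ARArrow X Y := by
  obtain ⟨W, h₁, h₂⟩ := h.exists_arArrow
  exact (Relation.TransGen.single h₁).tail h₂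

/-- An irreducible map out of `X` factors through the left almost split map, and irreducibility
makes `W` a summand of the middle term. -/
theorem ARArrow.arrow_of_isTau {X W Y : ModuleCat.{u} R} (h : ARArrow X W) (h' : IsTau X Y) :
    ARArrow W Y := by
  obtain ⟨hX, hW, t, ht⟩ := h
  obtain ⟨E, f, g, h'⟩ := h'
  obtain ⟨r, hr⟩ := h'.left_factor W t hW.1 ht.1
  rcases ht.2.2 E f r h'.finite hr with h'' | h''
  · exact absurd h'' h'.not_splitMono
  · exact ⟨hW, h'.ind_right, _, h'.isSink.arrow hW (IsSplitEpi.id r)⟩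

/-- The two sequences map to each other over `Y`; the composite endomorphism of the left term is
invertible by `isIso_left_of_not_isSplitEpi`. -/
theorem IsTau.left_unique {X X' Y : ModuleCat.{u} R} (h : IsTau X Y) (h' : IsTau X' Y) :
    Nonempty (X ≅ X') := by
  obtain ⟨E, f, g, h⟩ := h
  obtain ⟨E', f', g', h'⟩ := h'
  obtain ⟨a, ha⟩ := h'.right_factor E g h.finite h.not_splitEpi
  obtain ⟨b, hb⟩ := h.right_factor E' g' h'.finite h'.not_splitEpi
  obtain ⟨x, hx⟩ := exists_lift_of_shortExact h'.shortExact (f ≫ a) (by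
    rw [Category.assoc, ha, h.zero])
  obtain ⟨y, hy⟩ := exists_lift_of_shortExact h.shortExact (f' ≫ b) (by
    rw [Category.assoc, hb, h'.zero])
  have : IsIso (x ≫ y) := isIso_left_of_not_isSplitEpi h.shortExact h.ind_left h.not_splitEpi
    (t := a ≫ b) (by rw [Category.assoc, hb, ha]) (by
      rw [Category.assoc, hy, ← Category.assoc x, hx, Category.assoc])
  have := h.ind_left.isIso_of_comp h'.ind_left x y
  exact ⟨asIso x⟩

theorem IsTau.right_unique {X Y Y' : ModuleCat.{u} R} (h : IsTau X Y) (h' : IsTau X Y') :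
    Nonempty (Y ≅ Y') := by
  obtain ⟨E, f, g, h⟩ := h
  obtain ⟨E', f', g', h'⟩ := h'
  obtain ⟨a, ha⟩ := h.left_factor E' f' h'.finite h'.not_splitMono
  obtain ⟨b, hb⟩ := h'.left_factor E f h.finite h.not_splitMono
  obtain ⟨x, hx⟩ := exists_desc_of_shortExact h.shortExact (a ≫ g') (by
    rw [← Category.assoc, ha, h'.zero])
  obtain ⟨y, hy⟩ := exists_desc_of_shortExact h'.shortExact (b ≫ g) (by
    rw [← Category.assoc, hb, h.zero])
  have : IsIso (x ≫ y) := isIso_right_of_not_isSplitMono h.shortExact h.ind_right h.not_splitMono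
    (t := a ≫ b) (by rw [← Category.assoc, ha, hb]) (by
      rw [Category.assoc, ← hy, ← Category.assoc, ← hx, Category.assoc])
  have := h.ind_right.isIso_of_comp h'.ind_right x y
  exact ⟨asIso x⟩

theorem IsTauInvPow.cancel {q r : ℕ} {X Y Y' : ModuleCat.{u} R} (h : IsTauInvPow q X Y)
    (h' : IsTauInvPow (q + r) X Y') : IsTauInvPow r Y Y' := by
  induction q generalizing X with
  | zero => rw [zero_add] at h'; exact h'.of_iso_left h.some
  | succ q ih =>
    rw [Nat.succ_add_eq_add_succ] at h'
    obtain ⟨Z, hZ, h⟩ := h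
    obtain ⟨Z', hZ', h'⟩ := h'
    exact ih h (h'.of_iso_left (hZ'.right_unique hZ).some)

theorem IsTauInvPow.transGen {q : ℕ} {X Y : ModuleCat.{u} R} (h : IsTauInvPow (q + 1) X Y) :
    Relation.TransGen ARArrow X Y := by
  induction q generalizing X with
  | zero =>
    obtain ⟨Z, hZ, ⟨e⟩⟩ := h
    exact (hZ.of_iso (Iso.refl _) e).transGen
  | succ q ih =>
    obtain ⟨Z, hZ, h⟩ := h
    exact hZ.transGen.trans (ih h)

/-- The maximal submodule of an indecomposable projective module contains every proper submodule. -/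
theorem IsInd.le_of_isCoatom {P : ModuleCat.{u} R} (hP : IsInd P) (hp : Projective P)
    {N N' : Submodule R P} (hN : IsCoatom N) (hN' : N' ≠ ⊤) : N' ≤ N := by
  by_contra hle
  have hsup : N' ⊔ N = ⊤ := hN.2 _ (right_lt_sup.2 hle)
  let a : ModuleCat.of R N' ⟶ P := ModuleCat.ofHom N'.subtype
  let b : ModuleCat.of R N ⟶ P := ModuleCat.ofHom N.subtype
  let c : ModuleCat.of R (N' × N) ⟶ P := ModuleCat.ofHom (N'.subtype.coprod N.subtype)
  have hc : Epi c := by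
    rw [ModuleCat.epi_iff_range_eq_top]
    change LinearMap.range (N'.subtype.coprod N.subtype) = ⊤
    rw [LinearMap.range_coprod, Submodule.range_subtype, Submodule.range_subtype, hsup]
  let s : P ⟶ ModuleCat.of R (N' × N) := Projective.factorThru (𝟙 P) c
  have hs : s ≫ c = 𝟙 P := Projective.factorThru_comp _ _
  let p₁ : ModuleCat.of R (N' × N) ⟶ ModuleCat.of R N' := ModuleCat.ofHom (LinearMap.fst R N' N)
  let p₂ : ModuleCat.of R (N' × N) ⟶ ModuleCat.of R N := ModuleCat.ofHom (LinearMap.snd R N' N)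
  have hc' : c = p₁ ≫ a + p₂ ≫ b := ModuleCat.hom_ext (LinearMap.ext fun x => rfl)
  -- The identity of `P` is a sum of an endomorphism through `N'` and one through `N`. Locality
  -- makes one of them invertible, and then that submodule is all of `P`.
  have : IsIso ((s ≫ p₁) ≫ a + (s ≫ p₂) ≫ b) := by
    rw [Category.assoc, Category.assoc, ← Preadditive.comp_add, ← hc', hs]
    infer_instance
  rcases hP.isIso_or_isIso_of_add ((s ≫ p₁) ≫ a) ((s ≫ p₂) ≫ b) with h | h
  · have := isSplitEpi_of_isIso_comp (s ≫ p₁) a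
    have h' := (ModuleCat.epi_iff_range_eq_top a).1 inferInstance
    exact hN' ((Submodule.range_subtype N').symm.trans h')
  · have := isSplitEpi_of_isIso_comp (s ≫ p₂) b
    have h₁ := (ModuleCat.epi_iff_range_eq_top b).1 inferInstance
    exact hN.1 ((Submodule.range_subtype N).symm.trans h₁)

/-- The inclusion of the radical of an indecomposable projective module is a sink map. -/
theorem exists_isSink_of_projective {P : ModuleCat.{u} R} (hP : IsInd P) (hp : Projective P) :
    ∃ (F : ModuleCat.{u} R) (g : F ⟶ P), IsSink g ∧ Mono g := by
  have := hP.1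
  have hnt : Nontrivial P := by
    by_contra h
    rw [not_nontrivial_iff_subsingleton] at h
    exact hP.not_isZero (ModuleCat.isZero_of_subsingleton P)
  obtain ⟨N, hN⟩ : ∃ N : Submodule R P, IsCoatom N := IsCoatomic.exists_coatom _
  let g : ModuleCat.of R N ⟶ P := ModuleCat.ofHom N.subtype
  have hg : Mono g := (ModuleCat.mono_iff_injective g).2 N.injective_subtype
  refine ⟨ModuleCat.of R N, g, ?_, hg⟩
  refine ⟨hP, inferInstanceAs (Module.Finite R N), ?_, ?_, ?_⟩
  · intro h
    have h' := (ModuleCat.epi_iff_range_eq_top g).1 inferInstance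
    exact hN.1 ((Submodule.range_subtype N).symm.trans h')
  · intro Z t hZ ht
    have hr : LinearMap.range t.hom ≤ N := by
      refine hP.le_of_isCoatom hp hN fun h => ht ?_
      have := (ModuleCat.epi_iff_range_eq_top t).2 h
      exact IsSplitEpi.mk' ⟨Projective.factorThru (𝟙 P) t, by simp⟩
    exact ⟨ModuleCat.ofHom (t.hom.codRestrict N fun x => hr ⟨x, rfl⟩), by ext x; rfl⟩
  · intro W r t hW ht hi
    have : t = 0 := by rw [← cancel_mono g, ht, zero_comp]
    rw [this, zero_comp] at hi
    exact hW.ne_zero_of_isIso (0 : W ⟶ W) rfl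

end AlmostSplit

/-! ### Existence of almost split sequences -/

section TraceDuality

variable {k A B : Type*} [Field k] [AddCommGroup A] [Module k A] [AddCommGroup B] [Module k B]
  [Module.Finite k A] [Module.Finite k B]

/-- Every linear form on `Hom(A, B)` is of the form `c ↦ tr (h ∘ c)`. -/
theorem exists_eq_trace_comp (l : Module.Dual k (A →ₗ[k] B)) :
    ∃ h : B →ₗ[k] A, ∀ c, l c = LinearMap.trace k A (h ∘ₗ c) := by
  let T : (B →ₗ[k] A) →ₗ[k] Module.Dual k (A →ₗ[k] B) :=
    LinearMap.mk₂ k (fun h c => LinearMap.trace k A (h ∘ₗ c))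
      (fun _ _ _ => by rw [LinearMap.add_comp, map_add])
      (fun _ _ _ => by rw [LinearMap.smul_comp, map_smul])
      (fun _ _ _ => by rw [LinearMap.comp_add, map_add])
      (fun _ _ _ => by rw [LinearMap.comp_smul, map_smul])
  have hT : Function.Injective T := by
    rw [← LinearMap.ker_eq_bot, LinearMap.ker_eq_bot']
    intro h hh
    ext b
    rw [LinearMap.zero_apply, ← Module.forall_dual_apply_eq_zero_iff k]
    intro ζ
    -- Maps of rank one already show that the trace pairing is non-degenerate on this side; equality
    -- of dimensions does the rest.
    have h₁ : LinearMap.trace k A (h ∘ₗ ζ.smulRight b) = 0 := congr($hh (ζ.smulRight b))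
    have h₂ : h ∘ₗ ζ.smulRight b = ζ.smulRight (h b) := by
      ext a
      simp
    rwa [h₂, LinearMap.trace_smulRight] at h₁
  have hs : Function.Surjective T := by
    rw [← LinearMap.injective_iff_surjective_of_finrank_eq_finrank]
    · exact hT
    · rw [Subspace.dual_finrank_eq, Module.finrank_linearMap, Module.finrank_linearMap, mul_comm]
  obtain ⟨h, rfl⟩ := hs l
  exact ⟨h, fun c => rfl⟩

end TraceDuality

/-- The coinduced `R`-module `Hom_k(R, X)`. -/
def CoInd (k R X : Type u) [Field k] [Ring R] [Algebra k R] [AddCommGroup X] [Module k X] :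
    Type u := R →ₗ[k] X

namespace CoInd

variable {k R X Y : Type u} [Field k] [Ring R] [Algebra k R] [AddCommGroup X] [Module k X]
  [AddCommGroup Y] [Module k Y] [Module R Y] [IsScalarTower k R Y]

instance : AddCommGroup (CoInd k R X) := inferInstanceAs (AddCommGroup (R →ₗ[k] X))

instance : Module k (CoInd k R X) := inferInstanceAs (Module k (R →ₗ[k] X))

instance [Module.Finite k R] [Module.Finite k X] : Module.Finite k (CoInd k R X) :=
  inferInstanceAs (Module.Finite k (R →ₗ[k] X))

/-- The value of an element of the coinduced module. -/
def app (f : CoInd k R X) : R →ₗ[k] X := f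

theorem ext {f g : CoInd k R X} (h : ∀ r, f.app r = g.app r) : f = g := LinearMap.ext h

instance : Module R (CoInd k R X) where
  smul r f := LinearMap.comp f.app (LinearMap.mulRight k r)
  one_smul f := ext fun s => congr(f.app $(mul_one s))
  mul_smul r r' f := ext fun s => congr(f.app $(mul_assoc s r r')).symm
  smul_zero _ := rfl
  smul_add _ _ _ := rfl
  add_smul r r' f := ext fun s =>
    (congr(f.app $(mul_add s r r'))).trans (map_add f.app _ _)
  zero_smul f := ext fun s => (congr(f.app $(mul_zero s))).trans (map_zero f.app)

@[simp] theorem smul_app (r : R) (f : CoInd k R X) (s : R) : (r • f).app s = f.app (s * r) := rfl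

@[simp] theorem add_app (f g : CoInd k R X) (s : R) : (f + g).app s = f.app s + g.app s := rfl

instance : IsScalarTower k R (CoInd k R X) where
  smul_assoc c r f := ext fun s => by
    rw [smul_app, mul_smul_comm, map_smul]
    rfl

/-- The `R`-linear map into the coinduced module attached to a `k`-linear map. -/
def lift (φ : Y →ₗ[k] X) : Y →ₗ[R] CoInd k R X where
  toFun y := φ ∘ₗ (LinearMap.toSpanSingleton R Y y).restrictScalars k
  map_add' y y' := ext fun s => by
    change φ (s • (y + y')) = φ (s • y) + φ (s • y')
    rw [smul_add, map_add]
  map_smul' r y := ext fun s => by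
    change φ (s • r • y) = φ ((s * r) • y)
    rw [mul_smul]

theorem lift_app (φ : Y →ₗ[k] X) (y : Y) (r : R) : (lift (R := R) φ y).app r = φ (r • y) := rfl

/-- Coinduction is right adjoint to restriction of scalars; the `k`-linear map is recovered by
evaluation at `1`. -/
theorem exists_eq_lift (F : Y →ₗ[R] CoInd k R X) : ∃ φ : Y →ₗ[k] X, F = lift φ := by
  refine ⟨⟨⟨fun y => (F y).app 1, fun y y' => by rw [map_add, add_app]⟩, fun c y => ?_⟩, ?_⟩
  · change (F (c • y)).app 1 = c • (F y).app 1
    rw [← algebraMap_smul R c y, map_smul, smul_app, one_mul, Algebra.algebraMap_eq_smul_one,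
      map_smul]
  · ext y
    refine ext fun r => ?_
    change (F y).app r = (F (r • y)).app 1
    rw [map_smul, smul_app, one_mul]

theorem lift_comp {Y' : Type u} [AddCommGroup Y'] [Module k Y'] [Module R Y']
    [IsScalarTower k R Y'] (φ : Y →ₗ[k] X) (g : Y' →ₗ[R] Y) :
    (lift (R := R) φ) ∘ₗ g = lift (φ ∘ₗ g.restrictScalars k) := by
  ext y
  refine ext fun r => ?_
  rw [LinearMap.comp_apply, lift_app, lift_app, ← map_smul]
  rfl

end CoInd

/-! ### A representable functor dual to extensions by `X` -/

section Universal

/-- The module is a quotient of a free module of rank `dim C`. The bound does not depend on `Y`,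
which lets `exists_universal` choose a module of maximal dimension. -/
theorem finrank_le_of_span_range_eq_top {k R C Y : Type*} [Field k] [Ring R] [Algebra k R]
    [Module.Finite k R] [AddCommGroup C] [Module k C] [Module.Finite k C] [AddCommGroup Y]
    [Module k Y] [Module R Y] [IsScalarTower k R Y] (c : C →ₗ[k] Y)
    (hc : Submodule.span R (Set.range c) = ⊤) :
    Module.finrank k Y ≤ Module.finrank k (Fin (Module.finrank k C) → R) := by
  let b := Module.finBasis k C
  let T : (Fin (Module.finrank k C) → R) →ₗ[R] Y := Fintype.linearCombination R fun i => c (b i)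
  have hT : Function.Surjective T := by
    rw [← LinearMap.range_eq_top, eq_top_iff, ← hc, Submodule.span_le]
    rintro _ ⟨x, rfl⟩
    rw [Fintype.range_linearCombination, ← b.sum_repr x, map_sum]
    refine Submodule.sum_mem _ fun i _ => ?_
    rw [map_smul, ← algebraMap_smul R]
    exact Submodule.smul_mem _ _ (Submodule.subset_span ⟨i, rfl⟩)
  exact LinearMap.finrank_le_finrank_of_surjective (f := T.restrictScalars k) hT

variable {k R X C : Type u} [Field k] [Ring R] [Algebra k R] [AddCommGroup X] [Module k X]
  [AddCommGroup C] [Module k C] [Module R C] [IsScalarTower k R C] (p : CoInd k R X →ₗ[R] C)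

/-- The composition of the coinduced map of `φ : Y → X` and `p`. -/
def coindMap {Y : Type u} [AddCommGroup Y] [Module k Y] [Module R Y] [IsScalarTower k R Y] :
    (Y →ₗ[k] X) →ₗ[k] (Y →ₗ[k] C) where
  toFun φ := (p ∘ₗ CoInd.lift φ).restrictScalars k
  map_add' φ φ' := by
    ext y
    exact map_add p (CoInd.lift φ y) (CoInd.lift φ' y)
  map_smul' c φ := by
    ext y
    have : CoInd.lift (R := R) (c • φ) y = c • CoInd.lift (R := R) φ y := rfl
    change p (CoInd.lift (c • φ) y) = c • p (CoInd.lift φ y)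
    rw [this, ← algebraMap_smul R c (CoInd.lift φ y), map_smul, algebraMap_smul]

/-- The annihilator of the image of `coindMap` with respect to the trace form. -/
def coindAnn (Y : Type u) [AddCommGroup Y] [Module k Y] [Module R Y] [IsScalarTower k R Y] :
    Submodule k (C →ₗ[k] Y) where
  carrier := {c | ∀ φ : Y →ₗ[k] X, LinearMap.trace k C (coindMap p φ ∘ₗ c) = 0}
  zero_mem' φ := by rw [LinearMap.comp_zero, map_zero]
  add_mem' h h' φ := by rw [LinearMap.comp_add, map_add, h, h', add_zero]
  smul_mem' a c h φ := by rw [LinearMap.comp_smul, map_smul, h, smul_zero]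

variable {Y Y' : Type u} [AddCommGroup Y] [Module k Y] [Module R Y] [IsScalarTower k R Y]
  [AddCommGroup Y'] [Module k Y'] [Module R Y'] [IsScalarTower k R Y']

theorem coindMap_comp (φ : Y →ₗ[k] X) (g : Y' →ₗ[R] Y) :
    coindMap p φ ∘ₗ g.restrictScalars k = coindMap p (φ ∘ₗ g.restrictScalars k) := by
  ext y
  exact congr(p ($(CoInd.lift_comp φ g) y))

theorem comp_mem_coindAnn (g : Y →ₗ[R] Y') {c : C →ₗ[k] Y} (hc : c ∈ coindAnn p Y) :
    g.restrictScalars k ∘ₗ c ∈ coindAnn p Y' := by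
  intro φ
  rw [← LinearMap.comp_assoc, coindMap_comp]
  exact hc _

/-- The map `g` has a `k`-linear retraction, so every test map `φ` on `Y` extends to `Y'`. An
element of the annihilator may thus be corestricted to the submodule it generates. -/
theorem mem_coindAnn_of_injective (g : Y →ₗ[R] Y') (hg : Function.Injective g) {c : C →ₗ[k] Y}
    (hc : g.restrictScalars k ∘ₗ c ∈ coindAnn p Y') : c ∈ coindAnn p Y := by
  intro φ
  obtain ⟨l, hl⟩ := (g.restrictScalars k).exists_leftInverse_of_injective
    (LinearMap.ker_eq_bot.2 hg)
  have h := hc (φ ∘ₗ l)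
  rwa [← LinearMap.comp_assoc, coindMap_comp, LinearMap.comp_assoc, hl, LinearMap.comp_id] at h

/-- Double annihilator: the trace pairing between `Hom_k(Y, C)` and `Hom_k(C, Y)` is perfect, so a
map orthogonal to the annihilator of a subspace lies in that subspace. -/
theorem exists_eq_coindMap [Module.Finite k C] [Module.Finite k Y] (x : Y →ₗ[k] C)
    (hx : ∀ c ∈ coindAnn p Y, LinearMap.trace k C (x ∘ₗ c) = 0) : ∃ φ, x = coindMap p φ := by
  by_contra! hne
  have hx' : x ∉ LinearMap.range (coindMap p (Y := Y)) := by
    rintro ⟨φ, hφ⟩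
    exact hne φ hφ.symm
  obtain ⟨l, hl, hl'⟩ := Submodule.exists_le_ker_of_notMem hx'
  obtain ⟨c, hc⟩ := exists_eq_trace_comp l
  refine hl ?_
  rw [hc, LinearMap.trace_comp_comm']
  refine hx c fun φ => ?_
  rw [LinearMap.trace_comp_comm', ← hc]
  exact hl' ⟨φ, rfl⟩

/-- The functor `coindAnn` is represented by a finitely generated module. -/
theorem exists_universal [Module.Finite k R] [Module.Finite k C] :
    ∃ (Z : Type u) (_ : AddCommGroup Z) (_ : Module k Z) (_ : Module R Z) (_ : IsScalarTower k R Z)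
      (c₀ : C →ₗ[k] Z), Module.Finite R Z ∧ c₀ ∈ coindAnn p Z ∧
      Submodule.span R (Set.range c₀) = ⊤ ∧
      ∀ (Y : Type u) [AddCommGroup Y] [Module k Y] [Module R Y] [IsScalarTower k R Y]
        [Module.Finite R Y], ∀ c ∈ coindAnn p Y,
        ∃ ψ : Z →ₗ[R] Y, ψ.restrictScalars k ∘ₗ c₀ = c := by
  let P : ℕ → Prop := fun n => ∃ (Z : Type u) (_ : AddCommGroup Z) (_ : Module k Z)
    (_ : Module R Z) (_ : IsScalarTower k R Z) (c₀ : C →ₗ[k] Z), Module.Finite R Z ∧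
      c₀ ∈ coindAnn p Z ∧ Submodule.span R (Set.range c₀) = ⊤ ∧ Module.finrank k Z = n
  have hP0 : P 0 := ⟨PUnit, inferInstance, inferInstance, inferInstance, inferInstance, 0,
    inferInstance, Submodule.zero_mem _, Subsingleton.elim _ _, Module.finrank_zero_of_subsingleton⟩
  have hPb : ∀ n, P n → n ≤ Module.finrank k (Fin (Module.finrank k C) → R) := by
    rintro n ⟨Z, _, _, _, _, c₀, _, _, h, rfl⟩
    exact finrank_le_of_span_range_eq_top c₀ h
  classical
  obtain ⟨Z, _, _, _, _, c₀, hf, h₁, h₂, h₃⟩ :=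
    Nat.findGreatest_spec (P := P) (Nat.zero_le (Module.finrank k (Fin (Module.finrank k C) → R)))
      hP0
  refine ⟨Z, _, _, _, _, c₀, hf, h₁, h₂, ?_⟩
  intro Y _ _ _ _ _ c hc
  have hfk : Module.Finite k Z := Module.Finite.trans R Z
  have hfk' : Module.Finite k Y := Module.Finite.trans R Y
  have hRn : IsNoetherianRing R := isNoetherian_of_tower k inferInstance
  -- The submodule `W` generated by the image of `(c₀, c)` is again admissible and projects onto
  -- `Z`. By maximality of `dim Z` this projection is bijective, and `W` is the graph of the
  -- required map `Z → Y`.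
  let c' : C →ₗ[k] Z × Y := c₀.prod c
  have hc' : c' ∈ coindAnn p (Z × Y) := by
    have h := (coindAnn p (Z × Y)).add_mem (comp_mem_coindAnn p (LinearMap.inl R Z Y) h₁)
      (comp_mem_coindAnn p (LinearMap.inr R Z Y) hc)
    convert h using 1
    ext x <;> simp [c']
  let W : Submodule R (Z × Y) := Submodule.span R (Set.range c')
  let cW : C →ₗ[k] W := LinearMap.codRestrict (W.restrictScalars k) c'
    fun x => Submodule.subset_span ⟨x, rfl⟩
  have hcW : cW ∈ coindAnn p W := mem_coindAnn_of_injective p W.subtype W.injective_subtype hc'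
  have hspan : Submodule.span R (Set.range cW) = ⊤ := by
    apply Submodule.map_injective_of_injective W.injective_subtype
    rw [Submodule.map_span, Submodule.map_top, Submodule.range_subtype, ← Set.range_comp]
    rfl
  have hWfin : Module.Finite R W := inferInstance
  have hWk : Module.Finite k W := Module.Finite.trans R W
  have hle : Module.finrank k W ≤ Module.finrank k Z := by
    rw [h₃]
    have hPW : P (Module.finrank k W) := ⟨W, _, _, _, _, cW, hWfin, hcW, hspan, rfl⟩
    exact Nat.le_findGreatest (hPb _ hPW) hPW
  let q : W →ₗ[R] Z := LinearMap.fst R Z Y ∘ₗ W.subtype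
  have hq : Function.Surjective q := by
    rw [← LinearMap.range_eq_top, eq_top_iff, ← h₂, Submodule.span_le]
    rintro _ ⟨x, rfl⟩
    exact ⟨cW x, rfl⟩
  have hq' : Function.Injective q := by
    have hge := LinearMap.finrank_le_finrank_of_surjective (f := q.restrictScalars k) hq
    exact (LinearMap.injective_iff_surjective_of_finrank_eq_finrank (f := q.restrictScalars k)
      (le_antisymm hle hge)).2 hq
  let e : W ≃ₗ[R] Z := LinearEquiv.ofBijective q ⟨hq', hq⟩
  refine ⟨LinearMap.snd R Z Y ∘ₗ W.subtype ∘ₗ e.symm.toLinearMap, ?_⟩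
  ext x
  have : e.symm (c₀ x) = cW x := by
    rw [LinearEquiv.symm_apply_eq]
    rfl
  change (LinearMap.snd R Z Y) (W.subtype (e.symm (c₀ x))) = c x
  rw [this]
  rfl

end Universal

/-! ### Construction of almost split sequences -/

section Existence

variable {R : Type u} [Ring R]

theorem shortExact_of_apply {X E Y : ModuleCat.{u} R} {f : X ⟶ E} {g : E ⟶ Y} (w : f ≫ g = 0)
    (hf : Function.Injective f) (hg : Function.Surjective g) (h : ∀ x, g x = 0 → ∃ y, f y = x) :
    (ShortComplex.mk f g w).ShortExact where
  exact := (ShortComplex.moduleCat_exact_iff _).2 h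
  mono_f := (ModuleCat.mono_iff_injective f).2 hf
  epi_g := (ModuleCat.epi_iff_surjective g).2 hg

theorem isSplitEpi_of_isSplitMono {X E Y : ModuleCat.{u} R} {f : X ⟶ E} {g : E ⟶ Y} {w : f ≫ g = 0}
    (h : (ShortComplex.mk f g w).ShortExact) [IsSplitMono f] : IsSplitEpi g := by
  obtain ⟨l, hl⟩ := exists_desc_of_shortExact h (𝟙 E - retraction f ≫ f) (by
    rw [Preadditive.comp_sub, ← Category.assoc, IsSplitMono.id, Category.comp_id,
      Category.id_comp, sub_self])
  have := h.epi_g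
  refine IsSplitEpi.mk' ⟨l, (cancel_epi g).1 ?_⟩
  rw [← Category.assoc, hl, Preadditive.sub_comp, Category.assoc, w, comp_zero, sub_zero,
    Category.id_comp, Category.comp_id]

theorem exists_retraction_of_isSplitEpi {X E Y : ModuleCat.{u} R} {f : X ⟶ E} {g : E ⟶ Y}
    {w : f ≫ g = 0} (h : (ShortComplex.mk f g w).ShortExact) [IsSplitEpi g] :
    ∃ r : E ⟶ X, f ≫ r = 𝟙 X := by
  obtain ⟨l, hl⟩ := exists_lift_of_shortExact h (𝟙 E - g ≫ section_ g) (by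
    rw [Preadditive.sub_comp, Category.assoc, IsSplitEpi.id, Category.comp_id,
      Category.id_comp, sub_self])
  have := h.mono_f
  refine ⟨l, (cancel_mono f).1 ?_⟩
  rw [Category.assoc, hl, Preadditive.comp_sub, ← Category.assoc, w, zero_comp, sub_zero,
    Category.id_comp, Category.comp_id]

/-- The pushout of a short exact sequence along a map out of its left term. -/
theorem exists_pushout {X E Y W : ModuleCat.{u} R} {f : X ⟶ E} {g : E ⟶ Y} {w : f ≫ g = 0}
    (h : (ShortComplex.mk f g w).ShortExact) (t : X ⟶ W) (hE : Module.Finite R E)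
    (hW : Module.Finite R W) :
    ∃ (Q : ModuleCat.{u} R) (a : E ⟶ Q) (b : W ⟶ Q) (q : Q ⟶ Y) (w' : b ≫ q = 0),
      Module.Finite R Q ∧ (ShortComplex.mk b q w').ShortExact ∧ f ≫ a = t ≫ b ∧ a ≫ q = g := by
  let N : Submodule R (E × W) := LinearMap.range (f.hom.prod (-t.hom))
  have hN : N ≤ LinearMap.ker (g.hom ∘ₗ LinearMap.fst R E W) := by
    rintro _ ⟨x, rfl⟩
    change g (f x) = 0
    exact congr($w x)
  let q₀ : ((E × W) ⧸ N) →ₗ[R] Y := N.liftQ _ hN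
  refine ⟨ModuleCat.of R ((E × W) ⧸ N), ModuleCat.ofHom (N.mkQ ∘ₗ LinearMap.inl R E W),
    ModuleCat.ofHom (N.mkQ ∘ₗ LinearMap.inr R E W), ModuleCat.ofHom q₀, ?_, ?_, ?_, ?_, ?_⟩
  · ext x
    change g 0 = 0
    exact map_zero g.hom
  · exact inferInstanceAs (Module.Finite R ((E × W) ⧸ N))
  · have hf := (ModuleCat.mono_iff_injective f).1 h.mono_f
    have hg := (ModuleCat.epi_iff_surjective g).1 h.epi_g
    refine shortExact_of_apply _ ?_ ?_ ?_
    · refine (injective_iff_map_eq_zero (N.mkQ ∘ₗ LinearMap.inr R E W)).2 fun x hx => ?_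
      have hx' : ((0 : E), x) ∈ N := (Submodule.Quotient.mk_eq_zero N).1 hx
      obtain ⟨y, hy⟩ := hx'
      have h₁ : f y = 0 := congr(Prod.fst $hy)
      have h₂ : -(t y) = x := congr(Prod.snd $hy)
      have h₃ : y = 0 := hf (h₁.trans (map_zero f.hom).symm)
      rw [← h₂, h₃]
      exact (neg_eq_zero.2 (map_zero t.hom))
    · intro y
      obtain ⟨e, he⟩ := hg y
      exact ⟨N.mkQ (e, 0), he⟩
    · intro x hx
      obtain ⟨⟨e, x'⟩, rfl⟩ := N.mkQ_surjective x
      obtain ⟨y, hy⟩ := (ShortComplex.moduleCat_exact_iff _).1 h.exact e hx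
      refine ⟨x' + t y, ?_⟩
      change N.mkQ (0, x' + t y) = N.mkQ (e, x')
      rw [← sub_eq_zero, ← map_sub]
      refine (Submodule.Quotient.mk_eq_zero N).2 ⟨-y, ?_⟩
      refine Prod.ext ?_ ?_
      · change f (-y) = 0 - e
        rw [zero_sub, ← hy]
        exact map_neg f.hom y
      · change -(t (-y)) = x' + t y - x'
        rw [add_sub_cancel_left, neg_eq_iff_eq_neg]
        exact map_neg t.hom y
  · ext x
    change N.mkQ (f x, 0) = N.mkQ (0, t x)
    rw [← sub_eq_zero, ← map_sub]
    refine (Submodule.Quotient.mk_eq_zero N).2 ⟨x, ?_⟩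
    refine Prod.ext ?_ ?_
    · exact (sub_zero _).symm
    · exact (zero_sub _).symm
  · ext x
    rfl

/-- Push the sequence out along `t`. If the result splits, `t` extends to `E`. Otherwise it maps
back to the given sequence over `Y`, and the induced endomorphism of `X` is invertible and factors
through `t`, so `t` splits. -/
theorem isAlmostSplit_of_right [IsArtinianRing R] {X E Y : ModuleCat.{u} R} {f : X ⟶ E} {g : E ⟶ Y}
    (hX : IsInd X) (hY : IsInd Y) (hE : Module.Finite R E) (w : f ≫ g = 0)
    (h : (ShortComplex.mk f g w).ShortExact) (hg : ¬ IsSplitEpi g)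
    (hr : ∀ (Z : ModuleCat.{u} R) (h : Z ⟶ Y), Module.Finite R Z → ¬ IsSplitEpi h →
      ∃ h' : Z ⟶ E, h' ≫ g = h) : IsAlmostSplit f g where
  ind_left := hX
  ind_right := hY
  finite := hE
  zero := w
  shortExact := h
  not_splitMono h' := hg (isSplitEpi_of_isSplitMono h)
  not_splitEpi := hg
  left_factor W t hW ht := by
    obtain ⟨Q, a, b, q, w', hQ, h', hab, haq⟩ := exists_pushout h t hE hW
    by_cases hq : IsSplitEpi q
    · obtain ⟨r, hr⟩ := exists_retraction_of_isSplitEpi h'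
      exact ⟨a ≫ r, by rw [← Category.assoc, hab, Category.assoc, hr, Category.comp_id]⟩
    · exfalso
      obtain ⟨c, hc⟩ := hr Q q hQ hq
      obtain ⟨l, hl⟩ := exists_lift_of_shortExact h (b ≫ c) (by rw [Category.assoc, hc, w'])
      have : IsIso (t ≫ l) := isIso_left_of_not_isSplitEpi h hX hg (t := a ≫ c)
        (by rw [Category.assoc, hc, haq])
        (by rw [Category.assoc, hl, ← Category.assoc, hab, Category.assoc])
      exact ht (isSplitMono_of_isIso_comp t l)
  right_factor := hr

open scoped ModuleCat in
theorem moduleFinite_of_moduleFinite (k : Type u) [Field k] [Algebra k R] [Module.Finite k R]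
    (M : ModuleCat.{u} R) [Module.Finite R M] : Module.Finite k M :=
  Module.Finite.trans R M

theorem isArtinianRing_of_finite (k : Type*) [Field k] [Algebra k R] [Module.Finite k R] :
    IsArtinianRing R := isArtinian_of_tower k inferInstance

theorem projective_of_indDecomp {M : ModuleCat.{u} R} (d : IndDecomp M)
    (h : ∀ i, Projective (d.Y i)) : Projective M where
  factors {A B} f e _ := ⟨∑ i, d.r i ≫ Projective.factorThru (d.s i ≫ f) e, d.ext_from fun i => by
    rw [← Category.assoc, d.section_comp_sum, Projective.factorThru_comp]⟩

open scoped ModuleCat in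
/-- Every indecomposable non-injective module over a finite-dimensional algebra is the left term of
an almost split sequence. -/
theorem exists_isTau_of_not_injective (k : Type u) [Field k] [Algebra k R] [Module.Finite k R]
    {X : ModuleCat.{u} R} (hX : IsInd X) (hinj : ¬ Injective X) : ∃ Z, IsTau X Z := by
  have := hX.1
  have hart : IsArtinianRing R := isArtinianRing_of_finite k
  have hXk : Module.Finite k X := moduleFinite_of_moduleFinite k X
  -- The coinduced module `I` is injective and contains `X` through `j`. With `C = I / X`, an
  -- extension of `Y` by `X` is given by a map `Y ⟶ C`, and it splits when this map lifts to `I`.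
  let I : ModuleCat.{u} R := ModuleCat.of R (CoInd k R X)
  have hIf : Module.Finite R I := by
    have : Module.Finite R (CoInd k R X) := Module.Finite.of_restrictScalars_finite k R _
    exact this
  have hI : Injective I :=
    { factors := fun {A B} f m hm => by
        obtain ⟨φ, hφ⟩ := CoInd.exists_eq_lift (k := k) (X := X) f.hom
        obtain ⟨l, hl⟩ := (m.hom.restrictScalars k).exists_leftInverse_of_injective
          (LinearMap.ker_eq_bot.2 ((ModuleCat.mono_iff_injective m).1 hm))
        refine ⟨ModuleCat.ofHom (CoInd.lift (φ ∘ₗ l)), ModuleCat.hom_ext ?_⟩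
        rw [ModuleCat.hom_comp, ModuleCat.hom_ofHom, CoInd.lift_comp, LinearMap.comp_assoc, hl,
          LinearMap.comp_id, hφ] }
  let j : X →ₗ[R] CoInd k R X := CoInd.lift LinearMap.id
  have hj : Function.Injective j := fun x y h => by
    have h' := congr(CoInd.app $h 1)
    rwa [CoInd.lift_app, CoInd.lift_app, one_smul, one_smul] at h'
  obtain ⟨C, p, hp, hpj, hjp⟩ : ∃ (C : ModuleCat.{u} R) (p : CoInd k R X →ₗ[R] C),
      Function.Surjective p ∧ (∀ x, p x = 0 → ∃ y, j y = x) ∧ ∀ x, p (j x) = 0 :=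
    ⟨ModuleCat.of R (CoInd k R X ⧸ LinearMap.range j), (LinearMap.range j).mkQ,
      (LinearMap.range j).mkQ_surjective,
      fun _ hx => (Submodule.Quotient.mk_eq_zero (LinearMap.range j)).1 hx,
      fun x => (Submodule.Quotient.mk_eq_zero (LinearMap.range j)).2 ⟨x, rfl⟩⟩
  have hCf : Module.Finite R C := Module.Finite.of_surjective (M := I) p hp
  have hCk : Module.Finite k C := moduleFinite_of_moduleFinite k C
  obtain ⟨Z, _, _, _, _, c₀, hZf, hc₀, hspan, huniv⟩ := exists_universal (k := k) p
  have hinj_c₀ : ∀ {Y : ModuleCat.{u} R} (s t : ModuleCat.of R Z ⟶ Y),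
      (∀ x, s (c₀ x) = t (c₀ x)) → s = t := by
    intro Y s t h
    refine ModuleCat.hom_ext (LinearMap.ext_on_range hspan h)
  obtain ⟨d⟩ := nonempty_indDecomp (ModuleCat.of R Z) hZf
  -- If `Z` were projective, every map `Z ⟶ C` would lift to `I`. The identity of `C` would then be
  -- orthogonal to `coindAnn p C`, hence would lift to `I`, and `X` would be a summand of `I`.
  have hnp : ∃ i, ¬ Projective (d.Y i) := by
    by_contra! h
    have hZp : Projective (ModuleCat.of R Z) := projective_of_indDecomp d h
    obtain ⟨φ, hφ⟩ := exists_eq_coindMap p (Y := C) LinearMap.id (fun c hc => by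
      obtain ⟨ψ, rfl⟩ := huniv C c hc
      let ℓ : ModuleCat.of R Z ⟶ I :=
        have : Epi (ModuleCat.ofHom p : I ⟶ C) := (ModuleCat.epi_iff_surjective _).2 hp
        Projective.factorThru (ModuleCat.ofHom ψ : ModuleCat.of R Z ⟶ C) (ModuleCat.ofHom p : I ⟶ C)
      have hℓ : p ∘ₗ ℓ.hom = ψ := by
        have : Epi (ModuleCat.ofHom p : I ⟶ C) := (ModuleCat.epi_iff_surjective _).2 hp
        exact congr(ModuleCat.Hom.hom $(Projective.factorThru_comp
          (ModuleCat.ofHom ψ : ModuleCat.of R Z ⟶ C) (ModuleCat.ofHom p : I ⟶ C)))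
      obtain ⟨φ, hφ⟩ := CoInd.exists_eq_lift (k := k) (X := X) (Y := Z) ℓ.hom
      rw [LinearMap.id_comp, ← hℓ, hφ]
      exact hc₀ φ)
    let jj : X ⟶ I := ModuleCat.ofHom j
    let pp : I ⟶ C := ModuleCat.ofHom p
    have w : jj ≫ pp = 0 := by
      ext x
      exact hjp x
    have hse : (ShortComplex.mk jj pp w).ShortExact := shortExact_of_apply w hj hp hpj
    have : IsSplitEpi pp := IsSplitEpi.mk' ⟨ModuleCat.ofHom (CoInd.lift φ), by
      ext x
      exact congr($hφ x).symm⟩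
    obtain ⟨r, hr⟩ := exists_retraction_of_isSplitEpi hse
    exact hinj (Retract.injective ⟨jj, r, hr⟩)
  obtain ⟨i, hi⟩ := hnp
  have hYi := d.finite i
  have hYk : Module.Finite k (d.Y i) := moduleFinite_of_moduleFinite k _
  -- Non-split epimorphisms `Z ⟶ d.Y i` form a subspace because `End (d.Y i)` is local, and it
  -- misses the projection. A linear form separating the two is represented through the trace by a
  -- `k`-linear map `h : d.Y i → C`.
  let rad : Submodule k (C →ₗ[k] d.Y i) :=
    { carrier := {x | ∃ t : ModuleCat.of R Z ⟶ d.Y i, ¬ IsSplitEpi t ∧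
        x = t.hom.restrictScalars k ∘ₗ c₀}
      zero_mem' := ⟨0, fun h => (d.ind i).id_ne_zero (by
        rw [← IsSplitEpi.id (0 : ModuleCat.of R Z ⟶ d.Y i), comp_zero]), rfl⟩
      add_mem' := by
        rintro _ _ ⟨t, ht, rfl⟩ ⟨t', ht', rfl⟩
        refine ⟨t + t', fun h => ?_, rfl⟩
        have : IsIso (section_ (t + t') ≫ t + section_ (t + t') ≫ t') := by
          rw [← Preadditive.comp_add, IsSplitEpi.id]
          infer_instance
        rcases (d.ind i).isIso_or_isIso_of_add (section_ (t + t') ≫ t) (section_ (t + t') ≫ t')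
          with h' | h'
        · exact ht (isSplitEpi_of_isIso_comp (section_ (t + t')) t)
        · exact ht' (isSplitEpi_of_isIso_comp (section_ (t + t')) t')
      smul_mem' := by
        rintro a _ ⟨t, ht, rfl⟩
        refine ⟨a • t, fun h => ht ?_, rfl⟩
        refine IsSplitEpi.mk' ⟨ModuleCat.ofHom (a • LinearMap.id) ≫ section_ (a • t), ?_⟩
        ext z
        exact ((t.hom ∘ₗ (section_ (a • t)).hom).restrictScalars k).map_smul a z |>.trans
          congr($(IsSplitEpi.id (a • t)) z) }
  have hrad : (d.r i).hom.restrictScalars k ∘ₗ c₀ ∉ rad := by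
    rintro ⟨t, ht, h⟩
    have : d.r i = t := hinj_c₀ _ _ fun x => congr($h x)
    exact ht (this ▸ isSplitEpi_of_comp_eq_id (d.s_r i))
  obtain ⟨l, hl, hl'⟩ := Submodule.exists_le_ker_of_notMem hrad
  obtain ⟨h, hh⟩ := exists_eq_trace_comp l
  have hlift : ∀ (Y : ModuleCat.{u} R) (g : Y ⟶ d.Y i), Module.Finite R Y → ¬ IsSplitEpi g →
      ∃ φ, h ∘ₗ g.hom.restrictScalars k = coindMap p φ := by
    intro Y g hY hg
    have hYk : Module.Finite k Y := moduleFinite_of_moduleFinite k _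
    refine exists_eq_coindMap p _ fun c hc => ?_
    obtain ⟨ψ, rfl⟩ := huniv Y c hc
    rw [LinearMap.comp_assoc, ← hh]
    refine hl' ⟨ModuleCat.ofHom ψ ≫ g, fun hs => hg (isSplitEpi_of_comp (ModuleCat.ofHom ψ) g), rfl⟩
  -- No map from a projective module to the non-projective `d.Y i` is a split epi. Hence `h`
  -- composed with any map from the free module `R` lies in the image of `coindMap`, and is
  -- therefore `R`-linear.
  have hlin : ∀ (r : R) (z : d.Y i), h (r • z) = r • h z := by
    have key : ∀ (M : ModuleCat.{u} R) (g : M ⟶ d.Y i), Module.Finite R M → Projective M →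
        ∀ (r : R) (m : M), h (g (r • m)) = r • h (g m) := by
      intro M g hM hMp r m
      have hg : ¬ IsSplitEpi g := fun hs =>
        hi (Retract.projective ⟨section_ g, g, IsSplitEpi.id g⟩)
      obtain ⟨φ, hφ⟩ := hlift M g hM hg
      have h₁ : ∀ m : M, h (g m) = p (CoInd.lift φ m) := fun m => congr($hφ m)
      rw [h₁, h₁, ← map_smul, ← map_smul]
    intro r z
    have h₁ := key (ModuleCat.of R R) (ModuleCat.ofHom (LinearMap.toSpanSingleton R _ z))
      (inferInstanceAs (Module.Finite R R)) inferInstance r (1 : R)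
    change h ((r * 1) • z) = r • h ((1 : R) • z) at h₁
    rwa [mul_one, one_smul] at h₁
  let hR : d.Y i →ₗ[R] C := { toFun := h, map_add' := map_add h, map_smul' := hlin }
  -- The almost split sequence is the pullback of `0 → X → I → C → 0` along `h`.
  let E : Submodule R (CoInd k R X × d.Y i) :=
    LinearMap.eqLocus (p ∘ₗ LinearMap.fst R _ _) (hR ∘ₗ LinearMap.snd R _ _)
  have hmem : ∀ x, x ∈ E ↔ p x.1 = h x.2 := fun x => Iff.rfl
  have hEf : Module.Finite R E := by
    have : Module.Finite R (CoInd k R X × d.Y i) := inferInstanceAs (Module.Finite R (I × d.Y i))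
    infer_instance
  let f : X ⟶ ModuleCat.of R E := ModuleCat.ofHom
    ((LinearMap.inl R _ _ ∘ₗ j).codRestrict E fun x => (hmem _).2 ((hjp x).trans (map_zero h).symm))
  let g : ModuleCat.of R E ⟶ d.Y i := ModuleCat.ofHom (LinearMap.snd R _ _ ∘ₗ E.subtype)
  have w : f ≫ g = 0 := by
    ext x
    rfl
  refine ⟨d.Y i, ModuleCat.of R E, f, g, isAlmostSplit_of_right hX (d.ind i) hEf w ?_ ?_ ?_⟩
  · refine shortExact_of_apply w ?_ ?_ ?_
    · intro x y hxy
      exact hj congr(Prod.fst (Subtype.val $hxy))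
    · intro z
      obtain ⟨a, ha⟩ := hp (h z)
      exact ⟨⟨(a, z), (hmem _).2 ha⟩, rfl⟩
    · rintro ⟨⟨a, z⟩, hx⟩ hz
      have hz' : z = 0 := hz
      have hx' : p a = 0 := ((hmem _).1 hx).trans ((congrArg h hz').trans (map_zero h))
      obtain ⟨y, hy⟩ := hpj a hx'
      exact ⟨y, Subtype.ext (Prod.ext hy hz'.symm)⟩
  -- A section would lift `h` to `I`; the chosen form would then vanish on the projection `d.r i`,
  -- contrary to its choice.
  · intro hs
    obtain ⟨φ, hφ⟩ := CoInd.exists_eq_lift (k := k) (X := X) (Y := d.Y i)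
      (LinearMap.fst R _ _ ∘ₗ E.subtype ∘ₗ (section_ g).hom)
    have h₁ : h = coindMap p φ := by
      ext z
      have h₂ : p (section_ g z).1.1 = h (section_ g z).1.2 := (hmem _).1 (section_ g z).2
      have h₃ : (section_ g z).1.2 = z := congr($(IsSplitEpi.id g) z)
      rw [h₃] at h₂
      rw [← h₂]
      exact congr(p ($hφ z))
    refine hl ?_
    rw [hh, h₁]
    exact comp_mem_coindAnn p (d.r i).hom hc₀ φ
  · intro Y t hY ht
    obtain ⟨φ, hφ⟩ := hlift Y t hY ht
    refine ⟨ModuleCat.ofHom (((CoInd.lift φ).prod t.hom).codRestrict E fun y => ?_), ?_⟩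
    · exact (hmem _).2 congr($hφ y).symm
    · ext y
      rfl

end Existence

/-! ### Postprojective components -/

section Component

variable {R : Type u} [Ring R]

theorem transGen_of_iso_left {X X' Y : ModuleCat.{u} R} (h : Relation.TransGen ARArrow X Y)
    (e : X ≅ X') : Relation.TransGen ARArrow X' Y := by
  rcases Relation.TransGen.head'_iff.1 h with ⟨W, h₁, h₂⟩
  exact Relation.TransGen.head' (h₁.of_iso e (Iso.refl _)) h₂

theorem transGen_of_iso_right {X Y Y' : ModuleCat.{u} R} (h : Relation.TransGen ARArrow X Y)
    (e : Y ≅ Y') : Relation.TransGen ARArrow X Y' := by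
  rcases Relation.TransGen.tail'_iff.1 h with ⟨W, h₁, h₂⟩
  exact Relation.TransGen.tail' h₁ (h₂.of_iso (Iso.refl _) e)

theorem precedes_of_transGen {X Y : ModuleCat.{u} R} (h : Relation.TransGen ARArrow X Y) :
    Precedes X Y := by
  induction h with
  | single h => exact h.precedes
  | tail _ h ih => exact ih.trans h.precedes

theorem IsPostprojective.of_sameARComponent {X Y : ModuleCat.{u} R} (hX : IsPostprojective X)
    (h : SameARComponent X Y) : IsPostprojective Y :=
  ⟨h.2.1, fun Z hZ => hX.2 Z ⟨h.1, hZ.2.1, h.2.2.trans _ _ _ hZ.2.2⟩⟩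

theorem IsPostprojective.of_iso {X Y : ModuleCat.{u} R} (hX : IsPostprojective X) (e : X ≅ Y) :
    IsPostprojective Y :=
  hX.of_sameARComponent ⟨hX.1, hX.1.of_iso e, Relation.EqvGen.rel _ _ (Or.inl ⟨e⟩)⟩

theorem IsPostprojective.of_arArrow {X Y : ModuleCat.{u} R} (hY : IsPostprojective Y)
    (h : ARArrow X Y) : IsPostprojective X :=
  hY.of_sameARComponent ⟨hY.1, h.1, Relation.EqvGen.symm _ _ (Relation.EqvGen.rel _ _ (Or.inr h))⟩

theorem IsPostprojective.of_transGen {X Y : ModuleCat.{u} R} (hY : IsPostprojective Y)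
    (h : Relation.TransGen ARArrow X Y) : IsPostprojective X := by
  induction h with
  | single h => exact hY.of_arArrow h
  | tail _ h ih => exact ih (hY.of_arArrow h)

theorem IsPostprojective.self {X : ModuleCat.{u} R} (hX : IsPostprojective X) :
    ¬ Relation.TransGen ARArrow X X ∧
    ∃ (q : ℕ) (P : ModuleCat.{u} R), IsInd P ∧ Projective P ∧ IsTauInvPow q P X :=
  hX.2 X ⟨hX.1, hX.1, Relation.EqvGen.refl _⟩

theorem IsPostprojective.exists_isTau {Y : ModuleCat.{u} R} (hY : IsPostprojective Y)
    (hp : ¬ Projective Y) : ∃ X, IsTau X Y := by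
  obtain ⟨-, q, P, hP, hP', h⟩ := hY.self
  cases q with
  | zero => exact absurd (Projective.of_iso h.some hP') hp
  | succ q =>
    obtain ⟨Z, -, hZ⟩ := h.succ_right
    exact ⟨Z, hZ⟩

variable [IsArtinianRing R]

theorem IsPostprojective.exists_isSink {Y : ModuleCat.{u} R} (hY : IsPostprojective Y) :
    ∃ (F : ModuleCat.{u} R) (g : F ⟶ Y), IsSink g := by
  by_cases hp : Projective Y
  · obtain ⟨F, g, hg, -⟩ := exists_isSink_of_projective hY.1 hp
    exact ⟨F, g, hg⟩
  · obtain ⟨X, E, f, g, h⟩ := hY.exists_isTau hp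
    exact ⟨E, g, h.isSink⟩

/-- The uniqueness part of Krull–Schmidt: the identity of `W` is the sum of its factorizations
through the summands, so one of these is invertible. -/
theorem IsInd.exists_iso_of_retract {W M : ModuleCat.{u} R} (hW : IsInd W) (d : IndDecomp M)
    {s : W ⟶ M} {r : M ⟶ W} (h : s ≫ r = 𝟙 W) : ∃ i, Nonempty (W ≅ d.Y i) := by
  have h' : ∑ i, (s ≫ d.r i) ≫ d.s i ≫ r = 𝟙 W := by
    have := congr(s ≫ $(d.sum) ≫ r)
    rw [Category.id_comp, h, Preadditive.sum_comp, Preadditive.comp_sum] at this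
    rw [← this]
    exact Finset.sum_congr rfl fun i _ => by simp only [Category.assoc]
  obtain ⟨i, -, hi⟩ := hW.exists_isIso_of_sum Finset.univ
    (fun i => (s ≫ d.r i) ≫ d.s i ≫ r) (by rw [h']; infer_instance)
  have := hW.isIso_of_comp (d.ind i) (s ≫ d.r i) (d.s i ≫ r)
  exact ⟨i, ⟨asIso (s ≫ d.r i)⟩⟩

theorem IsSink.exists_iso_of_arArrow {F Y W : ModuleCat.{u} R} {g : F ⟶ Y} (h : IsSink g)
    (d : IndDecomp F) (hW : ARArrow W Y) : ∃ i, Nonempty (W ≅ d.Y i) := by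
  obtain ⟨hW, -, t, ht⟩ := hW
  obtain ⟨t', rfl⟩ := h.factor W t hW.1 ht.2.1
  rcases ht.2.2 F t' g h.finite rfl with h' | h'
  · exact hW.exists_iso_of_retract d (IsSplitMono.id t')
  · exact absurd h' h.not_splitEpi

/-- There are only finitely many indecomposable projective modules. -/
theorem exists_finite_projectives (R : Type u) [Ring R] [IsArtinianRing R] :
    ∃ (d : IndDecomp (ModuleCat.of R R)), ∀ P : ModuleCat.{u} R, IsInd P → Projective P →
      ∃ i, Nonempty (P ≅ d.Y i) := by
  obtain ⟨d⟩ := nonempty_indDecomp (ModuleCat.of R R) (inferInstanceAs (Module.Finite R R))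
  refine ⟨d, fun P hP hp => ?_⟩
  have := hP.1
  obtain ⟨n, e₀, he₀⟩ := Module.Finite.exists_fin' R P
  let e : ModuleCat.of R (Fin n → R) ⟶ P := ModuleCat.ofHom e₀
  have he : Epi e := (ModuleCat.epi_iff_surjective e).2 he₀
  let s : P ⟶ ModuleCat.of R (Fin n → R) := Projective.factorThru (𝟙 P) e
  have hs : s ≫ e = 𝟙 P := Projective.factorThru_comp _ _
  let a : Fin n → (ModuleCat.of R (Fin n → R) ⟶ ModuleCat.of R R) :=
    fun i => ModuleCat.ofHom (LinearMap.proj i)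
  let b : Fin n → (ModuleCat.of R R ⟶ ModuleCat.of R (Fin n → R)) :=
    fun i => ModuleCat.ofHom (LinearMap.single R (fun _ => R) i)
  have hab : ∑ i, a i ≫ b i = 𝟙 _ := by
    refine ModuleCat.hom_ext (LinearMap.ext fun x => ?_)
    rw [ModuleCat.hom_sum, LinearMap.sum_apply]
    exact LinearMap.sum_single_apply (φ := fun _ => R) x
  have h' : ∑ i, s ≫ a i ≫ b i ≫ e = 𝟙 P := by
    have := congr(s ≫ $hab ≫ e)
    rw [Category.id_comp, hs, Preadditive.sum_comp, Preadditive.comp_sum] at this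
    rw [← this]
    exact Finset.sum_congr rfl fun i _ => by simp only [Category.assoc]
  obtain ⟨i, -, hi⟩ := hP.exists_isIso_of_sum Finset.univ
    (fun i => s ≫ a i ≫ b i ≫ e) (by rw [h']; infer_instance)
  refine hP.exists_iso_of_retract d (s := s ≫ a i) (r := b i ≫ e ≫ inv (s ≫ a i ≫ b i ≫ e)) ?_
  rw [Category.assoc, ← IsIso.hom_inv_id (s ≫ a i ≫ b i ≫ e)]
  simp only [Category.assoc]

/-- In a postprojective component there is no infinite path ending at a given module. -/
theorem IsPostprojective.acc {Y : ModuleCat.{u} R} (hY : IsPostprojective Y) : Acc ARArrow Y := by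
  by_contra hacc
  obtain ⟨f, hf₀, hf⟩ := not_acc_iff_exists_descending_chain.1 hacc
  have hlt : ∀ m n, m < n → Relation.TransGen ARArrow (f n) (f m) := by
    intro m n hmn
    induction n, hmn using Nat.le_induction with
    | base => exact Relation.TransGen.single (hf m)
    | succ n _ ih => exact Relation.TransGen.head (hf n) ih
  have hpost : ∀ n, IsPostprojective (f n) := by
    intro n
    induction n with
    | zero => rwa [hf₀]
    | succ n ih => exact ih.of_arArrow (hf n)
  obtain ⟨d, hd⟩ := exists_finite_projectives R
  have hq : ∀ n, ∃ c : d.ι × ℕ, IsTauInvPow c.2 (d.Y c.1) (f n) := by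
    intro n
    obtain ⟨-, q, P, hP, hP', h⟩ := (hpost n).self
    obtain ⟨i, ⟨e⟩⟩ := hd P hP hP'
    exact ⟨(i, q), h.of_iso_left e⟩
  choose c hc using hq
  -- Each term of the chain is `τ^{-q} P` for one of finitely many `P`. So two terms `f m`, `f n`
  -- with `m < n` share `P` and have non-decreasing exponents. Then `f n` is an inverse translate of
  -- `f m`, and the path this gives closes a cycle with the descending chain.
  have hwqo : WellQuasiOrdered (fun a b : d.ι × ℕ => a.1 = b.1 ∧ a.2 ≤ b.2) :=
    (Finite.wellQuasiOrdered (· = ·)).prod wellQuasiOrdered_le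
  obtain ⟨m, n, hmn, h₁, h₂⟩ := hwqo c
  obtain ⟨r, hr⟩ := Nat.exists_eq_add_of_le h₂
  have hcn := hc n
  rw [← h₁, hr] at hcn
  have h₃ := (hc m).cancel hcn
  refine (hpost n).self.1 ?_
  cases r with
  | zero => exact transGen_of_iso_right (hlt m n hmn) h₃.some
  | succ r => exact (hlt m n hmn).trans h₃.transGen

/-- A map that is not a split epi factors through the sink map, so it has a non-zero component into
a direct predecessor of `Y`; well-foundedness ends the descent. -/
theorem IsPostprojective.iso_or_transGen {X Y : ModuleCat.{u} R} (hY : IsPostprojective Y)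
    (hX : IsInd X) (f : X ⟶ Y) (hf : f ≠ 0) :
    Nonempty (X ≅ Y) ∨ Relation.TransGen ARArrow X Y := by
  have hacc := hY.acc
  induction hacc with
  | intro Y _ ih =>
  obtain ⟨F, g, hg⟩ := hY.exists_isSink
  obtain ⟨d⟩ := nonempty_indDecomp F hg.finite
  by_cases hs : IsSplitEpi f
  · have := hX.isIso_of_isSplitEpi hY.1 f
    exact Or.inl ⟨asIso f⟩
  obtain ⟨f', rfl⟩ := hg.factor X f hX.1 hs
  obtain ⟨i, hi⟩ := d.exists_ne_zero_to (f := f') (by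
    rintro rfl
    exact hf zero_comp)
  have ha := hg.arArrow d i
  right
  rcases ih _ ha (hY.of_arArrow ha) _ hi with ⟨⟨e⟩⟩ | h
  · exact Relation.TransGen.single (ha.of_iso e.symm (Iso.refl _))
  · exact h.tail ha

theorem IsPostprojective.iso_or_transGen_of_precedes {X Y : ModuleCat.{u} R}
    (hY : IsPostprojective Y) (h : Precedes X Y) :
    IsPostprojective X ∧ (Nonempty (X ≅ Y) ∨ Relation.TransGen ARArrow X Y) := by
  induction h using Relation.ReflTransGen.head_induction_on with
  | refl => exact ⟨hY, Or.inl ⟨Iso.refl _⟩⟩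
  | head h _ ih =>
    obtain ⟨hX, hW, f, hf⟩ := h
    obtain ⟨ih₁, ih₂⟩ := ih
    rcases ih₁.iso_or_transGen hX f hf with ⟨⟨e⟩⟩ | h'
    · exact ⟨ih₁.of_iso e.symm, ih₂.imp (fun ⟨e'⟩ => ⟨e ≪≫ e'⟩)
        fun h => transGen_of_iso_left h e.symm⟩
    · refine ⟨ih₁.of_transGen h', Or.inr ?_⟩
      rcases ih₂ with ⟨⟨e⟩⟩ | h''
      · exact transGen_of_iso_right h' e
      · exact h'.trans h''

theorem IsPostprojective.iso_of_precedes {X Y : ModuleCat.{u} R}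
    (hY : IsPostprojective Y) (h : Precedes X Y) (h' : Precedes Y X) : Nonempty (X ≅ Y) := by
  obtain ⟨hX, h₁⟩ := hY.iso_or_transGen_of_precedes h
  rcases h₁ with h₁ | h₁
  · exact h₁
  rcases (hX.iso_or_transGen_of_precedes h').2 with ⟨⟨e⟩⟩ | h₂
  · exact ⟨e.symm⟩
  · exact absurd (h₁.trans h₂) hX.self.1

/-- A postprojective module has only finitely many predecessors. -/
theorem IsPostprojective.exists_finite {Y : ModuleCat.{u} R} (hY : IsPostprojective Y) :
    ∃ s : Set (ModuleCat.{u} R), s.Finite ∧ ∀ X, Precedes X Y → ∃ Z ∈ s, Nonempty (X ≅ Z) := by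
  have hacc := hY.acc
  induction hacc with
  | intro Y _ ih =>
  obtain ⟨F, g, hg⟩ := hY.exists_isSink
  obtain ⟨d⟩ := nonempty_indDecomp F hg.finite
  have ha := hg.arArrow d
  choose s hs hs' using fun i => ih _ (ha i) (hY.of_arArrow (ha i))
  refine ⟨insert Y (⋃ i, s i), (Set.finite_iUnion hs).insert Y, fun X hX => ?_⟩
  rcases (hY.iso_or_transGen_of_precedes hX).2 with h | h
  · exact ⟨Y, Set.mem_insert _ _, h⟩
  · obtain ⟨W, h₁, h₂⟩ := Relation.TransGen.tail'_iff.1 h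
    obtain ⟨i, ⟨e⟩⟩ := hg.exists_iso_of_arArrow d h₂
    have h₃ : Precedes X W := by
      rcases Relation.reflTransGen_iff_eq_or_transGen.1 h₁ with rfl | h₁
      · exact Relation.ReflTransGen.refl
      · exact precedes_of_transGen h₁
    obtain ⟨Z, hZ, h₄⟩ := hs' i X (h₃.trans (precedes_of_iso h₂.1 e))
    exact ⟨Z, Set.mem_insert_of_mem _ (Set.mem_iUnion.2 ⟨i, hZ⟩), h₄⟩

end Component

/-! ### The predecessors of a postprojective slice -/

section Presentation

variable {R : Type u} [Ring R]

theorem exists_presentation [IsArtinianRing R] (X : ModuleCat.{u} R) (hX : Module.Finite R X) :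
    ∃ (K P : ModuleCat.{u} R) (i : K ⟶ P) (p : P ⟶ X) (w : i ≫ p = 0),
      (ShortComplex.mk i p w).ShortExact ∧ Projective P ∧ Module.Finite R P ∧
        Module.Finite R K := by
  obtain ⟨n, e, he⟩ := Module.Finite.exists_fin' R X
  have hfin : Module.Finite R (Fin n → R) := inferInstance
  let i : ModuleCat.of R (LinearMap.ker e) ⟶ ModuleCat.of R (Fin n → R) :=
    ModuleCat.ofHom (LinearMap.ker e).subtype
  let p : ModuleCat.of R (Fin n → R) ⟶ X := ModuleCat.ofHom e
  have w : i ≫ p = 0 := by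
    ext x
    exact x.2
  refine ⟨_, _, i, p, w, shortExact_of_apply w (LinearMap.ker e).injective_subtype he
    fun x hx => ⟨⟨x, hx⟩, rfl⟩, ?_, hfin, inferInstanceAs (Module.Finite R (LinearMap.ker e))⟩
  exact (IsProjective.iff_projective (Fin n → R)).1 inferInstance

/-- The long exact sequence with `Ext¹(P, Y) = 0`. It turns the vanishing of `Ext¹` into an
extension problem for maps. -/
theorem subsingleton_ext_iff {X K P Y : ModuleCat.{u} R} {i : K ⟶ P} {p : P ⟶ X} {w : i ≫ p = 0}
    (h : (ShortComplex.mk i p w).ShortExact) (hP : Projective P) :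
    Subsingleton (Abelian.Ext.{u} X Y 1) ↔ ∀ t : K ⟶ Y, ∃ t' : P ⟶ Y, i ≫ t' = t := by
  constructor
  · intro hs t
    obtain ⟨x, hx⟩ := Abelian.Ext.contravariant_sequence_exact₁ h Y
      (Abelian.Ext.mk₀ t : Abelian.Ext.{u} K Y 0) (add_zero 1) (Subsingleton.elim _ _)
    obtain ⟨t', rfl⟩ := (Abelian.Ext.mk₀_bijective P Y).2 x
    refine ⟨t', (Abelian.Ext.mk₀_bijective K Y).1 ?_⟩
    rw [← hx]
    exact (Abelian.Ext.mk₀_comp_mk₀ i t').symm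
  · intro ht
    refine ⟨fun a b => ?_⟩
    have key : ∀ x : Abelian.Ext.{u} X Y 1, x = 0 := by
      intro x
      obtain ⟨y, hy⟩ := Abelian.Ext.contravariant_sequence_exact₃ h Y x
        (@Abelian.Ext.eq_zero_of_projective _ _ _ _ P Y 0 hP _) (add_zero 1)
      obtain ⟨t, rfl⟩ := (Abelian.Ext.mk₀_bijective K Y).2 y
      obtain ⟨t', rfl⟩ := ht t
      rw [← hy]
      have h₁ : h.extClass.comp ((Abelian.Ext.mk₀ i).comp (Abelian.Ext.mk₀ t') (zero_add 0))
          (add_zero 1) = 0 := h.extClass_comp_assoc _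
      rwa [Abelian.Ext.mk₀_comp_mk₀] at h₁
    rw [key a, key b]

end Presentation

/-! ### Unique extension of maps along a fixed morphism -/

section Bijective

variable {R : Type u} [Ring R] {K P : ModuleCat.{u} R}

/-- Every map `K ⟶ Y` extends uniquely along `i : K ⟶ P`. -/
def ExtendsUniquely (i : K ⟶ P) (Y : ModuleCat.{u} R) : Prop :=
  Function.Bijective fun t : P ⟶ Y => i ≫ t

theorem ExtendsUniquely.of_iso {i : K ⟶ P} {Y Y' : ModuleCat.{u} R} (h : ExtendsUniquely i Y)
    (e : Y ≅ Y') : ExtendsUniquely i Y' := by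
  refine ⟨fun s t hst => ?_, fun t => ?_⟩
  · have h₁ : i ≫ s = i ≫ t := hst
    have : s ≫ e.inv = t ≫ e.inv := h.1 (by
      change i ≫ s ≫ e.inv = i ≫ t ≫ e.inv
      rw [← Category.assoc, h₁, Category.assoc])
    exact (cancel_mono e.inv).1 this
  · obtain ⟨t', ht'⟩ := h.2 (t ≫ e.inv)
    have h₁ : i ≫ t' = t ≫ e.inv := ht'
    refine ⟨t' ≫ e.hom, ?_⟩
    change i ≫ t' ≫ e.hom = t
    rw [← Category.assoc, h₁, Category.assoc, e.inv_hom_id, Category.comp_id]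

theorem ExtendsUniquely.of_indDecomp {i : K ⟶ P} {M : ModuleCat.{u} R} (d : IndDecomp M)
    (h : ∀ j, ExtendsUniquely i (d.Y j)) : ExtendsUniquely i M := by
  refine ⟨fun s t hst => d.ext_to fun j => (h j).1 ?_, fun t => ?_⟩
  · have h₁ : i ≫ s = i ≫ t := hst
    change i ≫ s ≫ d.r j = i ≫ t ≫ d.r j
    rw [← Category.assoc, h₁, Category.assoc]
  · choose t' ht' using fun j => (h j).2 (t ≫ d.r j)
    have h₁ : ∀ j, i ≫ t' j = t ≫ d.r j := ht'
    refine ⟨∑ j, t' j ≫ d.s j, d.ext_to fun j => ?_⟩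
    change (i ≫ _) ≫ d.r j = _
    rw [Category.assoc, d.sum_comp_section, h₁]

theorem ExtendsUniquely.of_shortExact {i : K ⟶ P} {X E Y : ModuleCat.{u} R} {f : X ⟶ E} {g : E ⟶ Y}
    {w : f ≫ g = 0} (h : (ShortComplex.mk f g w).ShortExact) (hE : ExtendsUniquely i E)
    (hY : ExtendsUniquely i Y) : ExtendsUniquely i X := by
  have := h.mono_f
  refine ⟨fun s t hst => (cancel_mono f).1 (hE.1 ?_), fun t => ?_⟩
  · have h₁ : i ≫ s = i ≫ t := hst
    change i ≫ s ≫ f = i ≫ t ≫ f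
    rw [← Category.assoc, h₁, Category.assoc]
  · obtain ⟨t', ht'⟩ := hE.2 (t ≫ f)
    have h₁ : i ≫ t' = t ≫ f := ht'
    have h₂ : t' ≫ g = 0 := hY.1 (by
      change i ≫ t' ≫ g = i ≫ 0
      rw [← Category.assoc, h₁, Category.assoc, w, comp_zero, comp_zero])
    obtain ⟨l, hl⟩ := exists_lift_of_shortExact h t' h₂
    refine ⟨l, (cancel_mono f).1 ?_⟩
    change (i ≫ l) ≫ f = t ≫ f
    rw [Category.assoc, hl, h₁]

/-- Extending the identity of `K` gives a retraction `r` of `i`; `r ≫ i` and `𝟙 P` agree after `i`,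
so uniqueness for `P` identifies them. -/
theorem ExtendsUniquely.isIso {i : K ⟶ P} (hK : ExtendsUniquely i K) (hP : ExtendsUniquely i P) :
    IsIso i := by
  obtain ⟨r, hr⟩ := hK.2 (𝟙 K)
  have h₁ : i ≫ r = 𝟙 K := hr
  refine ⟨r, h₁, hP.1 ?_⟩
  change i ≫ r ≫ i = i ≫ 𝟙 P
  rw [← Category.assoc, h₁, Category.id_comp, Category.comp_id]

end Bijective

/-! ### Predecessors of the slice and the category `M` -/

section Slice

variable {R : Type u} [Ring R] {V : Type v} {H : V → ModuleCat.{u} R}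

/-- `X` is an indecomposable predecessor of the modules `H a`. -/
def IsPred (H : V → ModuleCat.{u} R) (X : ModuleCat.{u} R) : Prop :=
  IsInd X ∧ ∃ a, Precedes X (H a)

theorem IsPred.of_hom {X Z : ModuleCat.{u} R} (hX : IsPred H X) (hZ : IsInd Z) (f : Z ⟶ X)
    (hf : f ≠ 0) : IsPred H Z := by
  obtain ⟨hX, a, ha⟩ := hX
  exact ⟨hZ, a, Relation.ReflTransGen.head ⟨hZ, hX, f, hf⟩ ha⟩

theorem IsPred.of_precedes {X Z : ModuleCat.{u} R} (hX : IsPred H X) (hZ : IsInd Z)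
    (h : Precedes Z X) : IsPred H Z := by
  obtain ⟨hX, a, ha⟩ := hX
  exact ⟨hZ, a, h.trans ha⟩

theorem IsPred.of_iso {X Z : ModuleCat.{u} R} (hX : IsPred H X) (e : X ≅ Z) : IsPred H Z :=
  hX.of_precedes (hX.1.of_iso e) (precedes_of_iso (hX.1.of_iso e) e.symm)

theorem IsPred.of_arArrow {X Z : ModuleCat.{u} R} (hX : IsPred H X) (h : ARArrow Z X) :
    IsPred H Z :=
  hX.of_precedes h.1 h.precedes

theorem IsSlice.isPred (hH : IsSlice H) (a : V) : IsPred H (H a) :=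
  ⟨hH.ind a, a, Relation.ReflTransGen.refl⟩

theorem IsSlice.exists_iso (hH : IsSlice H) {X : ModuleCat.{u} R} (hX : IsPred H X) {a : V}
    (h : Precedes (H a) X) : ∃ c, Nonempty (X ≅ H c) := by
  obtain ⟨hX, b, hb⟩ := hX
  exact hH.pathClosed a b X hX h hb

/-- `X 0, …, X (N - 1)` is a complete list of the predecessors of the `H a`, without repetition, and
in an order compatible with the non-zero maps. -/
structure IsPredList (H : V → ModuleCat.{u} R) {N : ℕ} (X : Fin N → ModuleCat.{u} R) : Prop where
  mem : ∀ i, IsPred H (X i)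
  injective : ∀ i j, Nonempty (X i ≅ X j) → i = j
  complete : ∀ Y, IsPred H Y → ∃ i, Nonempty (Y ≅ X i)
  ordered : ∀ i j, (∃ f : X i ⟶ X j, f ≠ 0) → i ≤ j

theorem IsPredList.le_of_precedes {N : ℕ} {X : Fin N → ModuleCat.{u} R} (hX : IsPredList H X)
    {i j : Fin N}
    (h : Precedes (X i) (X j)) : i ≤ j := by
  have key : ∀ Y, Precedes Y (X j) → ∀ i, Nonempty (Y ≅ X i) → i ≤ j := by
    intro Y hY
    induction hY using Relation.ReflTransGen.head_induction_on with
    | refl => exact fun i ⟨e⟩ => (hX.injective _ _ ⟨e.symm⟩).le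
    | head h h' ih =>
      rintro i ⟨e⟩
      obtain ⟨hY, hW, f, hf⟩ := h
      obtain ⟨l, ⟨e'⟩⟩ := hX.complete _ ((hX.mem j).of_precedes hW h')
      refine le_trans (hX.ordered i l ⟨e.inv ≫ f ≫ e'.hom, fun h0 => hf ?_⟩) (ih l ⟨e'⟩)
      rw [← cancel_mono e'.hom, ← cancel_epi e.inv, h0, zero_comp, comp_zero]
  exact key _ h i ⟨Iso.refl _⟩

variable [IsArtinianRing R]

theorem IsPred.of_isTau {X Z : ModuleCat.{u} R} (hX : IsPred H X) (h : IsTau Z X) : IsPred H Z :=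
  hX.of_precedes h.ind_left (precedes_of_transGen h.transGen)

theorem IsPred.isPostprojective (hH : IsPostprojectiveSlice H) {X : ModuleCat.{u} R}
    (hX : IsPred H X) : IsPostprojective X := by
  obtain ⟨-, a, ha⟩ := hX
  exact ((hH.2 a).iso_or_transGen_of_precedes ha).1

/-- There is no non-zero map from the slice to the translate of a predecessor of the slice. -/
theorem IsSlice.hom_eq_zero (hH : IsSlice H) {X W : ModuleCat.{u} R} (hX : IsPred H X)
    (h : IsTau W X) {a : V} (f : H a ⟶ W) : f = 0 := by
  by_contra hf
  -- Since `W` precedes `X`, both lie between members of the slice, hence belong to it; this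
  -- contradicts the axiom `tau`.
  have h₁ : Precedes (H a) W := Relation.ReflTransGen.single ⟨hH.ind a, h.ind_left, f, hf⟩
  obtain ⟨c, ⟨e⟩⟩ := hH.exists_iso (hX.of_isTau h) h₁
  obtain ⟨d, ⟨e₁⟩⟩ := hH.exists_iso hX (h₁.trans (precedes_of_transGen h.transGen))
  exact hH.tau c d (h.of_iso e e₁)

/-- Every extension of a predecessor of the slice by a member of the slice splits. -/
theorem IsPred.isSplitEpi (hH : IsPostprojectiveSlice H) {X : ModuleCat.{u} R} (hX : IsPred H X)
    {a : V} {Q : ModuleCat.{u} R} {b : H a ⟶ Q} {q : Q ⟶ X} {w : b ≫ q = 0}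
    (h : (ShortComplex.mk b q w).ShortExact) (hQ : Module.Finite R Q) : IsSplitEpi q := by
  by_contra hq
  have hep := h.epi_g
  have hnp : ¬ Projective X := fun hp =>
    hq (IsSplitEpi.mk' ⟨Projective.factorThru (𝟙 X) q, by simp⟩)
  obtain ⟨W, E, f, g, hfg⟩ := (hX.isPostprojective hH).exists_isTau hnp
  -- A non-split `q` factors through the sink map `g`. The induced map on kernels goes from `H a` to
  -- `τ X` and vanishes, so the factorization descends to `X` and splits `g`.
  obtain ⟨c, hc⟩ := hfg.right_factor Q q hQ hq
  obtain ⟨l, hl⟩ := exists_lift_of_shortExact hfg.shortExact (b ≫ c) (by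
    rw [Category.assoc, hc, w])
  rw [hH.1.hom_eq_zero hX ⟨E, f, g, hfg⟩ l, zero_comp] at hl
  obtain ⟨s, hs⟩ := exists_desc_of_shortExact h c hl.symm
  refine hfg.not_splitEpi (IsSplitEpi.mk' ⟨s, (cancel_epi q).1 ?_⟩)
  rw [← Category.assoc, hs, Category.comp_id, hc]

theorem IsPred.inM [Fintype V] (hH : IsPostprojectiveSlice H) {X : ModuleCat.{u} R}
    (hX : IsPred H X) : InM H X := by
  refine ⟨hX.1.1, ?_⟩
  obtain ⟨K, P, i, p, w, h, hP, hPf, hKf⟩ := exists_presentation X hX.1.1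
  rw [subsingleton_ext_iff h hP]
  intro t
  have key : ∀ a, ∃ t' : P ⟶ H a, i ≫ t' = t ≫ biproduct.π H a := by
    intro a
    obtain ⟨Q, x, y, q, w', hQ, h', hxy, hxq⟩ :=
      exists_pushout h (t ≫ biproduct.π H a) hPf (hH.1.ind a).1
    have := hX.isSplitEpi hH h' hQ
    obtain ⟨r, hr⟩ := exists_retraction_of_isSplitEpi h'
    exact ⟨x ≫ r, by rw [← Category.assoc, hxy, Category.assoc, hr, Category.comp_id]⟩
  choose t' ht' using key
  refine ⟨biproduct.lift t', biproduct.hom_ext _ _ fun a => ?_⟩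
  rw [Category.assoc, biproduct.lift_π, ht']

/-- On isomorphism classes of predecessors `Precedes` is antisymmetric, since there are no cycles.
The list is a linear extension of this finite partial order. -/
theorem IsPostprojectiveSlice.exists_isPredList [Finite V] (hH : IsPostprojectiveSlice H) :
    ∃ (N : ℕ) (X : Fin N → ModuleCat.{u} R), IsPredList H X := by
  choose s hs hs' using fun a => (hH.2 a).exists_finite
  let T₀ : Type (u + 1) := {Z : ModuleCat.{u} R // Z ∈ (⋃ a, s a) ∧ IsPred H Z}
  have hT₀ : Finite T₀ :=
    ((Set.finite_iUnion hs).subset (Set.sep_subset _ (IsPred H))).to_subtype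
  let S : Setoid T₀ :=
    { r := fun a b => Nonempty (a.1 ≅ b.1)
      iseqv := ⟨fun a => ⟨Iso.refl _⟩, fun ⟨e⟩ => ⟨e.symm⟩, fun ⟨e⟩ ⟨e'⟩ => ⟨e ≪≫ e'⟩⟩ }
  let T := Quotient S
  have hT : Finite T := inferInstance
  let rep : T → ModuleCat.{u} R := fun a => a.out.1
  have hrep : ∀ a, IsPred H (rep a) := fun a => a.out.2.2
  have hinj : ∀ a b, Nonempty (rep a ≅ rep b) → a = b := fun a b h => Quotient.out_equiv_out.1 h
  have hcomp : ∀ Y, IsPred H Y → ∃ a, Nonempty (Y ≅ rep a) := by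
    intro Y hY
    obtain ⟨hYi, a, ha⟩ := hY
    obtain ⟨Z, hZ, ⟨e⟩⟩ := hs' a Y ha
    let z : T₀ := ⟨Z, Set.mem_iUnion.2 ⟨a, hZ⟩, IsPred.of_iso ⟨hYi, a, ha⟩ e⟩
    obtain ⟨e'⟩ : Nonempty ((Quotient.mk S z).out.1 ≅ z.1) := Quotient.mk_out z
    exact ⟨Quotient.mk S z, ⟨e ≪≫ e'.symm⟩⟩
  let po : PartialOrder T :=
    { le := fun a b => Precedes (rep a) (rep b)
      le_refl := fun a => Relation.ReflTransGen.refl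
      le_trans := fun a b c h h' => Relation.ReflTransGen.trans h h'
      le_antisymm := fun a b h h' =>
        hinj a b (((hrep b).isPostprojective hH).iso_of_precedes h h') }
  have hF : Fintype (LinearExtension T) := @Fintype.ofFinite _ hT
  let o := monoEquivOfFin (LinearExtension T) rfl
  refine ⟨_, fun i => rep (o i), fun i => hrep _, fun i j h => o.injective (hinj _ _ h),
    fun Y hY => ?_, fun i j h => ?_⟩
  · obtain ⟨a, ⟨e⟩⟩ := hcomp Y hY
    refine ⟨o.symm (toLinearExtension a), ?_⟩
    rw [OrderIso.apply_symm_apply]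
    exact ⟨e⟩
  · obtain ⟨f, hf⟩ := h
    have h' : Precedes (rep (o i)) (rep (o j)) :=
      Relation.ReflTransGen.single ⟨(hrep _).1, (hrep _).1, f, hf⟩
    exact o.le_iff_le.1 ((toLinearExtension (α := T)).monotone
      (show @LE.le T _ (o i) (o j) from h'))

theorem IsPredList.lt_of_transGen (hH : IsPostprojectiveSlice H) {N : ℕ}
    {X : Fin N → ModuleCat.{u} R} (hX : IsPredList H X) {i j : Fin N}
    (h : Relation.TransGen ARArrow (X i) (X j)) : i < j := by
  refine lt_of_le_of_ne (hX.le_of_precedes (precedes_of_transGen h)) ?_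
  rintro rfl
  exact ((hX.mem i).isPostprojective hH).self.1 h

/-- A predecessor of the slice which is injective belongs to the slice. -/
theorem IsSlice.exists_iso_of_injective (hH : IsSlice H) {X : ModuleCat.{u} R} (hX : IsPred H X)
    (hinj : Injective X) : ∃ c, Nonempty (X ≅ H c) := by
  have := hX.1.1
  have hnt : Nontrivial X := by
    by_contra h
    rw [not_nontrivial_iff_subsingleton] at h
    exact hX.1.not_isZero (ModuleCat.isZero_of_subsingleton X)
  -- Take a simple submodule `S` of `X` and an indecomposable projective mapping onto it. Sincerity
  -- gives a non-zero map `f` from this projective to some `H a`, whose kernel lies in the maximal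
  -- submodule. So the range of `f` maps onto `S`, and injectivity of `X` extends this to a non-zero
  -- map `H a ⟶ X`.
  obtain ⟨S, hS⟩ : ∃ S : Submodule R X, IsAtom S := IsAtomic.exists_atom _
  have hS' : IsSimpleModule R S := isSimpleModule_iff_isAtom.2 hS
  obtain ⟨x, hxS, hx⟩ := S.exists_mem_ne_zero_of_ne_bot hS.1
  obtain ⟨d, -⟩ := exists_finite_projectives R
  have hRp : Projective (ModuleCat.of R R) := inferInstance
  let t₀ : ModuleCat.of R R ⟶ ModuleCat.of R S :=
    ModuleCat.ofHom (LinearMap.toSpanSingleton R S ⟨x, hxS⟩)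
  have ht₀ : t₀ ≠ 0 := by
    intro h
    have h' : (1 : R) • (⟨x, hxS⟩ : S) = 0 := congr($h (1 : R))
    rw [one_smul] at h'
    exact hx congr(Subtype.val $h')
  obtain ⟨i, hi⟩ := d.exists_ne_zero_from ht₀
  have hp : Projective (d.Y i) := Retract.projective ⟨d.s i, d.r i, d.s_r i⟩
  let t : d.Y i →ₗ[R] S := (d.s i ≫ t₀).hom
  have ht : t ≠ 0 := fun h => hi (ModuleCat.hom_ext h)
  obtain ⟨a, f, hf⟩ := hH.sincere (d.Y i) (d.ind i) hp
  have hker : LinearMap.ker f.hom ≤ LinearMap.ker t := by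
    refine (d.ind i).le_of_isCoatom hp (LinearMap.isCoatom_ker_of_surjective
      (LinearMap.surjective_of_ne_zero ht)) ?_
    rw [Ne, LinearMap.ker_eq_top]
    exact fun h => hf (ModuleCat.hom_ext h)
  let l : LinearMap.range f.hom →ₗ[R] X := S.subtype ∘ₗ
    (LinearMap.ker f.hom).liftQ t hker ∘ₗ f.hom.quotKerEquivRange.symm.toLinearMap
  have hl : ∀ y, l ⟨f.hom y, y, rfl⟩ = S.subtype (t y) := by
    intro y
    have : f.hom.quotKerEquivRange.symm ⟨f.hom y, y, rfl⟩ = (LinearMap.ker f.hom).mkQ y := by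
      rw [LinearEquiv.symm_apply_eq]
      rfl
    change S.subtype ((LinearMap.ker f.hom).liftQ t hker (f.hom.quotKerEquivRange.symm _)) = _
    rw [this]
    rfl
  let m : ModuleCat.of R (LinearMap.range f.hom) ⟶ H a :=
    ModuleCat.ofHom (LinearMap.range f.hom).subtype
  have hm : Mono m := (ModuleCat.mono_iff_injective m).2 (LinearMap.range f.hom).injective_subtype
  let b : H a ⟶ X := Injective.factorThru (ModuleCat.ofHom l) m
  have hb : m ≫ b = ModuleCat.ofHom l := Injective.comp_factorThru _ _
  have hb0 : b ≠ 0 := by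
    intro h0
    refine ht (LinearMap.ext fun y => S.injective_subtype ?_)
    rw [← hl, LinearMap.zero_apply, map_zero]
    have h₁ : b (f y) = l ⟨f.hom y, y, rfl⟩ := congr($hb ⟨f.hom y, y, rfl⟩)
    rw [← h₁, h0]
    rfl
  exact hH.exists_iso hX (Relation.ReflTransGen.single ⟨hH.ind a, hX.1, b, hb0⟩)

/-- A predecessor of the slice outside of the slice has an inverse Auslander-Reiten translate, which
is again a predecessor of the slice. -/
theorem IsPred.exists_isTau (k : Type u) [Field k] [Algebra k R] [Module.Finite k R]
    (hH : IsPostprojectiveSlice H) {X : ModuleCat.{u} R} (hX : IsPred H X)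
    (hne : ∀ a, IsEmpty (X ≅ H a)) : ∃ Z, IsTau X Z ∧ IsPred H Z := by
  obtain ⟨hXi, a, ha⟩ := hX
  have hpath : Relation.ReflTransGen ARArrow X (H a) := by
    rcases ((hH.2 a).iso_or_transGen_of_precedes ha).2 with ⟨⟨e⟩⟩ | h
    · exact (hne a).elim e
    · exact h.to_reflTransGen
  clear ha
  induction hpath using Relation.ReflTransGen.head_induction_on with
  | refl => exact (hne a).elim (Iso.refl _)
  | @head X W h h' ih =>
    have hWpath : Precedes W (H a) := by
      rcases Relation.reflTransGen_iff_eq_or_transGen.1 h' with h₁ | h₁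
      · rw [h₁]
        exact Relation.ReflTransGen.refl
      · exact precedes_of_transGen h₁
    have hW : IsPred H W := ⟨h.2.1, a, hWpath⟩
    by_cases hWH : ∃ b, Nonempty (W ≅ H b)
    · obtain ⟨b, ⟨e⟩⟩ := hWH
      obtain ⟨c, ⟨⟨e'⟩⟩ | hc⟩ := hH.1.predecessor b X (h.of_iso (Iso.refl _) e)
      · exact (hne c).elim e'
      · exact ⟨H c, hc, hH.1.isPred c⟩
    · obtain ⟨Z₁, hZ₁, hZ₁'⟩ := ih (fun b => not_nonempty_iff.1 fun hb => hWH ⟨b, hb⟩) h.2.1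
      have hninj : ¬ Injective X := fun hinj => by
        obtain ⟨c, ⟨e⟩⟩ := hH.1.exists_iso_of_injective (hW.of_arArrow h) hinj
        exact (hne c).elim e
      obtain ⟨Z, hZ⟩ := exists_isTau_of_not_injective k hXi hninj
      -- The arrow `X → W` continues to arrows `W → Z` and `Z → Z₁`, where `Z` and `Z₁` are the
      -- inverse translates of `X` and `W`; since `Z₁` is a predecessor of the slice, so is `Z`.
      exact ⟨Z, hZ, hZ₁'.of_arArrow ((h.arrow_of_isTau hZ).arrow_of_isTau hZ₁)⟩

/-- Downwards induction over the predecessors of the slice along almost split sequences. -/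
theorem IsPred.induction (k : Type u) [Field k] [Algebra k R] [Module.Finite k R]
    [Finite V] (hH : IsPostprojectiveSlice H) {p : ModuleCat.{u} R → Prop}
    (hiso : ∀ X Y, Nonempty (X ≅ Y) → p X → p Y) (hslice : ∀ a, p (H a))
    (hstep : ∀ X Z, IsPred H X → IsPred H Z → IsTau X Z →
      (∀ Y, IsPred H Y → Relation.TransGen ARArrow X Y → p Y) → p X)
    {X : ModuleCat.{u} R} (hX : IsPred H X) : p X := by
  obtain ⟨N, L, hL⟩ := hH.exists_isPredList
  have key : ∀ n : ℕ, ∀ i : Fin N, N - i ≤ n → p (L i) := by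
    intro n
    induction n with
    | zero => intro i hi; lia
    | succ n ih =>
      intro i hi
      by_cases hne : ∃ a, Nonempty (L i ≅ H a)
      · obtain ⟨a, ⟨e⟩⟩ := hne
        exact hiso _ _ ⟨e.symm⟩ (hslice a)
      · obtain ⟨Z, hZ, hZ'⟩ := (hL.mem i).exists_isTau k hH
          fun a => not_nonempty_iff.1 fun h => hne ⟨a, h⟩
        refine hstep (L i) Z (hL.mem i) hZ' hZ fun Y hY hiY => ?_
        obtain ⟨j, ⟨e⟩⟩ := hL.complete Y hY
        have := hL.lt_of_transGen hH (transGen_of_iso_right hiY e)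
        exact hiso _ _ ⟨e.symm⟩ (ih j (by lia))
  obtain ⟨i, ⟨e⟩⟩ := hL.complete X hX
  exact hiso _ _ ⟨e.symm⟩ (key _ i le_rfl)

theorem IsPred.exists_isTauInvPow (k : Type u) [Field k] [Algebra k R] [Module.Finite k R]
    [Finite V] (hH : IsPostprojectiveSlice H) {X : ModuleCat.{u} R}
    (hX : IsPred H X) : ∃ (q : ℕ) (a : V), IsTauInvPow q X (H a) := by
  refine IsPred.induction k hH (p := fun X => ∃ (q : ℕ) (a : V), IsTauInvPow q X (H a))
    ?_ (fun a => ⟨0, a, ⟨Iso.refl _⟩⟩) ?_ hX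
  · rintro X Y ⟨e⟩ ⟨q, a, h⟩
    exact ⟨q, a, h.of_iso_left e⟩
  · intro X Z hX hZ h ih
    obtain ⟨q, a, h'⟩ := ih Z hZ h.transGen
    exact ⟨q + 1, a, Z, h, h'⟩

/-- Downward induction from the slice: in an almost split sequence the property passes from the
middle and right terms to the left one. -/
theorem IsPred.extendsUniquely (k : Type u) [Field k] [Algebra k R] [Module.Finite k R]
    [Finite V] (hH : IsPostprojectiveSlice H) {K P : ModuleCat.{u} R}
    {i : K ⟶ P} (hi : ∀ a, ExtendsUniquely i (H a)) {X : ModuleCat.{u} R} (hX : IsPred H X) :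
    ExtendsUniquely i X := by
  refine IsPred.induction k hH (p := ExtendsUniquely i) (fun X Y ⟨e⟩ h => h.of_iso e) hi ?_ hX
  rintro X Z hX hZ ⟨E, f, g, h⟩ ih
  obtain ⟨d⟩ := nonempty_indDecomp E h.finite
  refine ExtendsUniquely.of_shortExact h.shortExact (ExtendsUniquely.of_indDecomp d fun j => ?_)
    (ih Z hZ (IsTau.transGen ⟨E, f, g, h⟩))
  exact ih _ (hZ.of_arArrow (h.isSink.arArrow d j)) (Relation.TransGen.single (h.arArrow_left d j))

/-- An indecomposable module in `M` is a predecessor of the slice. -/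
theorem isPred_of_inM (k : Type u) [Field k] [Algebra k R] [Module.Finite k R]
    [Fintype V] (hH : IsPostprojectiveSlice H) {X : ModuleCat.{u} R}
    (hX : Indecomposable X) (h : InM H X) : IsPred H X := by
  have hXi : IsInd X := ⟨h.1, hX⟩
  by_contra hnp
  have hzero : ∀ a (f : X ⟶ H a), f = 0 := fun a f => by
    by_contra hf
    exact hnp ((hH.1.isPred a).of_hom hXi f hf)
  obtain ⟨K, P, i, p, w, hs, hP, hPf, hKf⟩ := exists_presentation X h.1
  have hext := (subsingleton_ext_iff hs hP).1 h.2
  have hmono := hs.mono_f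
  have hepi := hs.epi_g
  -- Uniqueness is `Hom(X, H a) = 0`, existence is `Ext¹(X, H) = 0`.
  have hi : ∀ a, ExtendsUniquely i (H a) := by
    refine fun a => ⟨fun s t hst => ?_, fun t => ?_⟩
    · obtain ⟨l, hl⟩ := exists_desc_of_shortExact hs (s - t) (by
        rw [Preadditive.comp_sub, sub_eq_zero]
        exact hst)
      rw [hzero a l, comp_zero] at hl
      exact sub_eq_zero.1 hl.symm
    · obtain ⟨t', ht'⟩ := hext (t ≫ biproduct.ι H a)
      refine ⟨t' ≫ biproduct.π H a, ?_⟩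
      change i ≫ t' ≫ biproduct.π H a = t
      rw [← Category.assoc, ht', Category.assoc, biproduct.ι_π_self, Category.comp_id]
  obtain ⟨dP⟩ := nonempty_indDecomp P hPf
  obtain ⟨dK⟩ := nonempty_indDecomp K hKf
  -- Sincerity makes the projective summands predecessors; the summands of `K` embed into `P` and so
  -- are predecessors too.
  have hPred : ∀ j, IsPred H (dP.Y j) := by
    intro j
    obtain ⟨a, f, hf⟩ := hH.1.sincere (dP.Y j) (dP.ind j)
      (Retract.projective ⟨dP.s j, dP.r j, dP.s_r j⟩)
    exact (hH.1.isPred a).of_hom (dP.ind j) f hf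
  have hKred : ∀ j, IsPred H (dK.Y j) := by
    intro j
    have hne : dK.s j ≫ i ≠ 0 := fun h0 => by
      have : dK.s j = 0 := (cancel_mono i).1 (h0.trans zero_comp.symm)
      refine (dK.ind j).id_ne_zero ?_
      rw [← dK.s_r j, this, zero_comp]
    obtain ⟨l, hl⟩ := dP.exists_ne_zero_to hne
    exact (hPred l).of_hom (dK.ind j) _ hl
  have hiso : IsIso i := ExtendsUniquely.isIso
    (ExtendsUniquely.of_indDecomp dK fun j => (hKred j).extendsUniquely k hH hi)
    (ExtendsUniquely.of_indDecomp dP fun j => (hPred j).extendsUniquely k hH hi)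
  have hp : p = 0 := by rw [← cancel_epi i, w, comp_zero]
  refine hXi.id_ne_zero ?_
  rw [← cancel_epi p, hp, zero_comp, zero_comp]

end Slice

/-! ### Reduced words in Coxeter groups -/

section Reduced

variable {B W : Type*} [Group W] {M : CoxeterMatrix B} (cs : CoxeterSystem M W)

open Classical in
/-- The generator `s i` acts on pairs consisting of an element of `W` and a sign, by conjugation on
the first component, changing the sign of the pairs with first component `s i`. -/
def signedConj (i : B) : Function.End (W × ZMod 2) := fun x =>
  (cs.simple i * x.1 * cs.simple i, x.2 + if x.1 = cs.simple i then 1 else 0)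

open Classical in
-- The sign records the parity with which a reflection occurs among the first `2n` reflections of
-- the dihedral group of `i` and `j`.
theorem signedConj_mul_pow (i j : B) (n : ℕ) (x : W × ZMod 2) :
    ((signedConj cs i * signedConj cs j) ^ n) x =
      ((cs.simple i * cs.simple j) ^ n * x.1 * ((cs.simple i * cs.simple j) ^ n)⁻¹,
        x.2 + ∑ c ∈ Finset.range (2 * n),
          if x.1 = ((cs.simple i * cs.simple j) ^ c)⁻¹ * cs.simple j then 1 else 0) := by
  have hi : (cs.simple i)⁻¹ = cs.simple i := cs.inv_simple i
  have hj : (cs.simple j)⁻¹ = cs.simple j := cs.inv_simple j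
  have hconj : ∀ c : ℕ, cs.simple j * (cs.simple i * cs.simple j) ^ c =
      ((cs.simple i * cs.simple j) ^ c)⁻¹ * cs.simple j := by
    intro c
    induction c with
    | zero => simp
    | succ c ih =>
      rw [pow_succ, ← mul_assoc, ih, ← pow_succ, pow_succ', mul_inv_rev, mul_inv_rev, hi, hj]
      simp only [mul_assoc]
  induction n with
  | zero =>
    simp
    rfl
  | succ n ih =>
    rw [pow_succ']
    change signedConj cs i (signedConj cs j (((signedConj cs i * signedConj cs j) ^ n) x)) = _
    rw [ih]
    set y := cs.simple i * cs.simple j with hy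
    refine Prod.ext ?_ ?_
    · change cs.simple i * (cs.simple j * (y ^ n * x.1 * (y ^ n)⁻¹) * cs.simple j) * cs.simple i = _
      rw [pow_succ', mul_inv_rev, hy, mul_inv_rev, hi, hj]
      simp only [mul_assoc]
    · change x.2 + _ + _ + _ = x.2 + _
      rw [show 2 * (n + 1) = 2 * n + 1 + 1 by ring, Finset.sum_range_succ, Finset.sum_range_succ]
      simp only [add_assoc]
      congr 3
      · refine if_congr ?_ rfl rfl
        rw [mul_inv_eq_iff_eq_mul, hconj, two_mul, pow_add, mul_inv_rev, mul_assoc,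
          ← eq_inv_mul_iff_mul_eq]
      · refine if_congr ?_ rfl rfl
        change cs.simple j * (y ^ n * x.1 * (y ^ n)⁻¹) * cs.simple j = cs.simple i ↔ _
        rw [← eq_mul_inv_iff_mul_eq, hj, ← eq_inv_mul_iff_mul_eq, hj, mul_inv_eq_iff_eq_mul,
          ← eq_inv_mul_iff_mul_eq, ← hy, mul_assoc, ← pow_succ', hconj, ← mul_assoc,
          ← mul_inv_rev, ← pow_add, show n + 1 + n = 2 * n + 1 by ring]

/-- For `n = M i j` the list of reflections has period `M i j` and is run through twice, so all
signs cancel. -/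
theorem isLiftable_signedConj : M.IsLiftable (signedConj cs) := by
  classical
  intro i j
  funext x
  have h1 : (cs.simple i * cs.simple j) ^ M i j = 1 := cs.simple_mul_simple_pow i j
  rw [signedConj_mul_pow, h1, two_mul, Finset.sum_range_add]
  have h2 : ∀ c, (cs.simple i * cs.simple j) ^ (M i j + c) = (cs.simple i * cs.simple j) ^ c := by
    intro c
    rw [pow_add, h1, one_mul]
  simp only [h2]
  rw [CharTwo.add_self_eq_zero]
  simp
  rfl

open Classical in
-- Since the action factors through `W`, the parity of the multiplicity of a reflection in the
-- inversion sequence depends only on the element of `W`, not on the word.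
theorem signedConj_wordProd (ω : List B) (x : W × ZMod 2) :
    (ω.map (signedConj cs)).prod x =
      (cs.wordProd ω * x.1 * (cs.wordProd ω)⁻¹, x.2 + (cs.rightInvSeq ω).count x.1) := by
  induction ω with
  | nil =>
    simp
    rfl
  | cons i ω ih =>
    rw [List.map_cons, List.prod_cons]
    change signedConj cs i ((ω.map (signedConj cs)).prod x) = _
    rw [ih]
    refine Prod.ext ?_ ?_
    · change cs.simple i * (cs.wordProd ω * x.1 * (cs.wordProd ω)⁻¹) * cs.simple i = _
      rw [cs.wordProd_cons, mul_inv_rev, cs.inv_simple]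
      simp only [mul_assoc]
    · change x.2 + _ + _ = x.2 + _
      rw [CoxeterSystem.rightInvSeq, List.count_cons, Nat.cast_add, add_assoc]
      congr 2
      rw [Nat.cast_ite, Nat.cast_one, Nat.cast_zero]
      refine if_congr ?_ rfl rfl
      change cs.wordProd ω * x.1 * (cs.wordProd ω)⁻¹ = _ ↔ _
      rw [beq_iff_eq, mul_inv_eq_iff_eq_mul, ← eq_inv_mul_iff_mul_eq, eq_comm, mul_assoc]

/-- A word is reduced if the reflections of its inversion sequence are distinct. -/
theorem CoxeterSystem.isReduced_of_nodup_rightInvSeq {ω : List B} (h : (cs.rightInvSeq ω).Nodup) :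
    cs.IsReduced ω := by
  classical
  let F : W →* Function.End (W × ZMod 2) := cs.lift ⟨signedConj cs, isLiftable_signedConj cs⟩
  have hF : ∀ ω : List B, F (cs.wordProd ω) = (ω.map (signedConj cs)).prod := by
    intro ω
    rw [CoxeterSystem.wordProd, map_list_prod, List.map_map]
    congr 1
    refine List.map_congr_left fun i _ => ?_
    exact cs.lift_apply_simple (isLiftable_signedConj cs) i
  obtain ⟨ω', hω', hprod⟩ := cs.exists_isReduced (cs.wordProd ω)
  -- A reflection occurring once in the sequence of `ω` occurs an odd number of times in that of the
  -- reduced word `ω'`, so `ω` is no longer than `ω'`.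
  have hsub : cs.rightInvSeq ω ⊆ cs.rightInvSeq ω' := by
    intro t ht
    have h₁ : (F (cs.wordProd ω) (t, 0)).2 = (F (cs.wordProd ω') (t, 0)).2 := by rw [hprod]
    rw [hF, hF, signedConj_wordProd, signedConj_wordProd] at h₁
    simp only [zero_add] at h₁
    rw [List.count_eq_one_of_mem h ht] at h₁
    by_contra ht'
    rw [List.count_eq_zero_of_not_mem ht'] at h₁
    simp at h₁
  have hlen := (h.subperm hsub).length_le
  rw [cs.length_rightInvSeq, cs.length_rightInvSeq, ← hω'.eq, ← hprod] at hlen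
  exact le_antisymm (cs.length_wordProd_le ω) hlen

end Reduced

/-! ### The reflection representation of a graph -/

section Reflection

variable {V : Type*} [Fintype V] [DecidableEq V]

/-- The Cartan matrix of the graph with `a u v` edges between `u` and `v`. -/
def cartanEntry (a : V → V → ℤ) (x y : V) : ℤ := if x = y then 2 else -a x y

/-- The simple reflection attached to the vertex `y`. -/
def simpleReflection (a : V → V → ℤ) (y : V) : Module.End ℤ (V → ℤ) :=
  LinearMap.id - (∑ x, cartanEntry a x y • LinearMap.proj x).smulRight (Pi.single y 1)

theorem simpleReflection_apply (a : V → V → ℤ) (y : V) (z : V → ℤ) :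
    simpleReflection a y z = z - (∑ x, cartanEntry a x y * z x) • Pi.single y 1 := by
  simp [simpleReflection]

theorem simpleReflection_single (a : V → V → ℤ) (x y : V) :
    simpleReflection a y (Pi.single x 1) =
      Pi.single x 1 - cartanEntry a x y • Pi.single y 1 := by
  rw [simpleReflection_apply]
  simp [Pi.single_apply]

theorem simpleReflection_mul_pow_two (a : V → V → ℤ) {x y : V} (hxy : x ≠ y) (h : a x y = 0)
    (h' : a y x = 0) : (simpleReflection a x * simpleReflection a y) ^ 2 = 1 := by
  refine LinearMap.pi_ext' fun z => LinearMap.ext_ring ?_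
  change (simpleReflection a x) ((simpleReflection a y) ((simpleReflection a x)
    ((simpleReflection a y) (Pi.single z 1)))) = Pi.single z 1
  simp only [simpleReflection_single, map_sub, map_smul]
  simp only [cartanEntry, hxy, hxy.symm, if_true, if_false, h, h']
  module

theorem simpleReflection_mul_pow_three (a : V → V → ℤ) {x y : V} (hxy : x ≠ y) (h : a x y = 1)
    (h' : a y x = 1) : (simpleReflection a x * simpleReflection a y) ^ 3 = 1 := by
  refine LinearMap.pi_ext' fun z => LinearMap.ext_ring ?_
  change (simpleReflection a x) ((simpleReflection a y) ((simpleReflection a x)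
    ((simpleReflection a y) ((simpleReflection a x)
    ((simpleReflection a y) (Pi.single z 1)))))) = Pi.single z 1
  simp only [simpleReflection_single, map_sub, map_smul]
  simp only [cartanEntry, hxy, hxy.symm, if_true, if_false, h, h']
  module

theorem simpleReflection_mul_self (a : V → V → ℤ) (x : V) :
    simpleReflection a x * simpleReflection a x = 1 := by
  refine LinearMap.pi_ext' fun z => LinearMap.ext_ring ?_
  change (simpleReflection a x) ((simpleReflection a x) (Pi.single z 1)) = Pi.single z 1
  simp only [simpleReflection_single, map_sub, map_smul]
  simp only [cartanEntry, if_true]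
  module

end Reflection

/-! ### Roots of a word -/

section Roots

/-- Equal reflections have proportional roots. The forms `e`, `e'` with value `1` make the roots
primitive, so the factor is `1` or `-1`, and positivity excludes `-1`. -/
theorem eq_of_reflection_eq {I : Type*} {γ γ' : I → ℤ} (h0 : 0 ≤ γ) (h0' : 0 ≤ γ')
    {e f e' f' : (I → ℤ) →ₗ[ℤ] ℤ} (he : e γ = 1) (hf : f γ = 2) (he' : e' γ' = 1) (hf' : f' γ' = 2)
    (h : ∀ z, z - f z • γ = z - f' z • γ') : γ = γ' := by
  have h₀ : ∀ z, f z • γ = f' z • γ' := fun z => sub_right_injective (h z)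
  have h₁ : γ = e' γ • γ' := by
    have h₂ := h₀ γ
    have h₃ := congrArg e' h₂
    rw [map_smul, map_smul, he', hf, smul_eq_mul, smul_eq_mul, mul_one] at h₃
    rw [hf, ← h₃, mul_smul] at h₂
    exact smul_right_injective _ two_ne_zero h₂
  have h₂ : γ' = e γ' • γ := by
    have h₂ := h₀ γ'
    have h₃ := congrArg e h₂
    rw [map_smul, map_smul, he, hf', smul_eq_mul, smul_eq_mul, mul_one] at h₃
    rw [hf', h₃, mul_smul] at h₂
    exact (smul_right_injective _ two_ne_zero h₂).symm
  have h₃ : e' γ * e γ' = 1 := by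
    have := congrArg e h₁
    rw [map_smul, he, smul_eq_mul] at this
    exact this.symm
  rcases Int.eq_one_or_neg_one_of_mul_eq_one h₃ with h₄ | h₄
  · rw [h₁, h₄, one_smul]
  · rw [h₄, neg_one_smul] at h₁
    have : γ = 0 := by
      refine le_antisymm ?_ h0
      rw [h₁]
      simpa using h0'
    rw [this, map_zero] at he
    exact absurd he zero_ne_one

variable {V : Type*} [Fintype V] [DecidableEq V]

/-- The action of the inverse of the word `ω` in the reflection representation. -/
def inverseAction (a : V → V → ℤ) : List V → Module.End ℤ (V → ℤ)
  | [] => 1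
  | x :: ω => inverseAction a ω * simpleReflection a x

/-- The roots corresponding to the reflections of the right inversion sequence. -/
def wordRoots (a : V → V → ℤ) : List V → List (V → ℤ)
  | [] => []
  | x :: ω => inverseAction a ω (Pi.single x 1) :: wordRoots a ω

theorem wordRoots_ofFn (a : V → V → ℤ) {N : ℕ} (φ : Fin N → V) :
    wordRoots a (List.ofFn φ) = List.ofFn fun i : Fin N =>
      inverseAction a ((List.ofFn φ).drop (i + 1)) (Pi.single (φ i) 1) := by
  induction N with
  | zero => simp [wordRoots]
  | succ N ih =>
    rw [List.ofFn_succ, wordRoots, ih, List.ofFn_succ]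
    simp

variable {M : CoxeterMatrix V} {W : Type*} [Group W] (cs : CoxeterSystem M W)

/-- The entry `0` encodes infinite order and imposes no relation, so only the orders `1`, `2`, `3`
have to be checked. -/
theorem isLiftable_simpleReflection (a : V → V → ℤ)
    (ha : ∀ x y, x ≠ y → (a x y = 0 ∧ a y x = 0 ∧ M x y = 2) ∨
      (a x y = 1 ∧ a y x = 1 ∧ M x y = 3) ∨ M x y = 0) :
    M.IsLiftable (simpleReflection a) := by
  intro x y
  by_cases hxy : x = y
  · subst hxy
    rw [M.diagonal, pow_one, simpleReflection_mul_self]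
  · rcases ha x y hxy with ⟨h, h', hM⟩ | ⟨h, h', hM⟩ | hM
    · rw [hM, simpleReflection_mul_pow_two a hxy h h']
    · rw [hM, simpleReflection_mul_pow_three a hxy h h']
    · rw [hM, pow_zero]

theorem lift_wordProd_inv (a : V → V → ℤ) (ha : M.IsLiftable (simpleReflection a)) (ω : List V) :
    cs.lift ⟨_, ha⟩ (cs.wordProd ω)⁻¹ = inverseAction a ω := by
  induction ω with
  | nil => simp [inverseAction]
  | cons x ω ih =>
    rw [cs.wordProd_cons, mul_inv_rev, cs.inv_simple, map_mul, ih, cs.lift_apply_simple,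
      inverseAction]

/-- The reflection is conjugate to a simple one; `e` is the transported coordinate form, witnessing
primitivity, and `f` the transported coroot. -/
theorem exists_root (a : V → V → ℤ) (ha : M.IsLiftable (simpleReflection a)) (x : V)
    (ω : List V) : ∃ e f : (V → ℤ) →ₗ[ℤ] ℤ, e (inverseAction a ω (Pi.single x 1)) = 1 ∧
      f (inverseAction a ω (Pi.single x 1)) = 2 ∧
      ∀ z, cs.lift ⟨_, ha⟩ ((cs.wordProd ω)⁻¹ * cs.simple x * cs.wordProd ω) z =
        z - f z • inverseAction a ω (Pi.single x 1) := by
  set ρ := cs.lift ⟨_, ha⟩ with hρ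
  have h₁ : ∀ z, ρ (cs.wordProd ω) (inverseAction a ω z) = z := by
    intro z
    rw [← lift_wordProd_inv cs a ha, ← hρ, ← Module.End.mul_apply, ← map_mul, mul_inv_cancel,
      map_one, Module.End.one_apply]
  have h₂ : ∀ z, inverseAction a ω (ρ (cs.wordProd ω) z) = z := by
    intro z
    rw [← lift_wordProd_inv cs a ha, ← hρ, ← Module.End.mul_apply, ← map_mul, inv_mul_cancel,
      map_one, Module.End.one_apply]
  refine ⟨LinearMap.proj x ∘ₗ ρ (cs.wordProd ω),
    (∑ y, cartanEntry a y x • LinearMap.proj y) ∘ₗ ρ (cs.wordProd ω), ?_, ?_, ?_⟩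
  · simp [h₁]
  · rw [LinearMap.comp_apply, h₁]
    simp only [LinearMap.sum_apply, LinearMap.smul_apply, LinearMap.proj_apply, Pi.single_apply]
    simp [cartanEntry]
  · intro z
    rw [map_mul, map_mul, lift_wordProd_inv, cs.lift_apply_simple, Module.End.mul_apply,
      Module.End.mul_apply, simpleReflection_apply, map_sub, map_smul, h₂]
    simp

theorem exists_root_of_mem (a : V → V → ℤ) (ha : M.IsLiftable (simpleReflection a)) (ω : List V)
    (t : W) (ht : t ∈ cs.rightInvSeq ω) : ∃ γ ∈ wordRoots a ω, ∃ e f : (V → ℤ) →ₗ[ℤ] ℤ, e γ = 1 ∧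
      f γ = 2 ∧ ∀ z, cs.lift ⟨_, ha⟩ t z = z - f z • γ := by
  induction ω with
  | nil => simp at ht
  | cons x ω ih =>
    rw [CoxeterSystem.rightInvSeq, List.mem_cons] at ht
    rcases ht with rfl | ht
    · exact ⟨_, List.mem_cons_self, exists_root cs a ha x ω⟩
    · obtain ⟨γ, hγ, h⟩ := ih ht
      exact ⟨γ, List.mem_cons_of_mem _ hγ, h⟩

/-- A word is reduced if its roots are distinct and positive. -/
theorem CoxeterSystem.isReduced_of_nodup_wordRoots (a : V → V → ℤ)
    (ha : M.IsLiftable (simpleReflection a)) {ω : List V} (h : (wordRoots a ω).Nodup)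
    (h0 : ∀ γ ∈ wordRoots a ω, 0 ≤ γ) : cs.IsReduced ω := by
  refine cs.isReduced_of_nodup_rightInvSeq ?_
  induction ω with
  | nil => simp
  | cons x ω ih =>
    rw [wordRoots, List.nodup_cons] at h
    rw [CoxeterSystem.rightInvSeq, List.nodup_cons]
    refine ⟨fun hmem => ?_, ih h.2 fun γ hγ => h0 γ (List.mem_cons_of_mem _ hγ)⟩
    obtain ⟨γ, hγ, e', f', he', hf', h'⟩ := exists_root_of_mem cs a ha ω _ hmem
    obtain ⟨e, f, he, hf, h''⟩ := exists_root cs a ha x ω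
    refine h.1 ?_
    rw [eq_of_reflection_eq (h0 _ List.mem_cons_self) (h0 _ (List.mem_cons_of_mem _ hγ)) he hf
      he' hf' fun z => (h'' z).symm.trans (h' z)]
    exact hγ

theorem inverseAction_drop (a : V → V → ℤ) {N : ℕ} (φ : Fin N → V) (j : Fin N) :
    inverseAction a ((List.ofFn φ).drop j) =
      inverseAction a ((List.ofFn φ).drop (j + 1)) * simpleReflection a (φ j) := by
  rw [List.drop_eq_getElem_cons (by simp), inverseAction]
  simp

/-- Moving a simple root past a part of the word not containing its vertex. -/
theorem inverseAction_drop_single (a : V → V → ℤ) {N : ℕ} (φ : Fin N → V) (x : V) (j l : ℕ)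
    (hjl : j ≤ l) (hl : l ≤ N) (hx : ∀ t : Fin N, j ≤ t → (t : ℕ) < l → φ t ≠ x) :
    inverseAction a ((List.ofFn φ).drop j) (Pi.single x 1) =
      inverseAction a ((List.ofFn φ).drop l) (Pi.single x 1) +
        ∑ t : Fin N with j ≤ t.1 ∧ t.1 < l, a x (φ t) •
          inverseAction a ((List.ofFn φ).drop (t + 1)) (Pi.single (φ t) 1) := by
  induction hjl using Nat.decreasingInduction with
  | self =>
    rw [Finset.sum_eq_zero, add_zero]
    intro t ht
    simp only [Finset.mem_filter] at ht
    omega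
  | of_succ j hj ih =>
    have ih' := ih fun t h h' => hx t (by omega) h'
    have hjx := hx ⟨j, by omega⟩ le_rfl hj
    have hd := inverseAction_drop a φ ⟨j, by omega⟩
    simp only at hd
    rw [hd, Module.End.mul_apply, simpleReflection_single, map_sub, map_smul, ih']
    have : Finset.filter (fun t : Fin N => j ≤ t.1 ∧ t.1 < l) Finset.univ =
        insert ⟨j, by omega⟩ (Finset.filter (fun t : Fin N => j + 1 ≤ t.1 ∧ t.1 < l)
          Finset.univ) := by
      ext t
      simp only [Finset.mem_filter, Finset.mem_univ, true_and, Finset.mem_insert, Fin.ext_iff]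
      omega
    rw [this, Finset.sum_insert (by simp), cartanEntry, if_neg hjx.symm, neg_smul, sub_neg_eq_add]
    simp only
    abel

end Roots

/-! ### The numerical data of a slice -/

/-- The numerical data attached to the predecessors of a slice, listed in a suitable order:
the `i`-th of them is the `q i`-th translate of the `φ i`-th member of the slice, `h` is the matrix
of dimensions of homomorphism spaces, `m` the matrix of multiplicities of the summands of the
middle terms of the almost split sequences, and `n` the matrix of the arrows of the quiver. -/
structure SliceMesh (V : Type*) [Fintype V] [DecidableEq V] (N : ℕ) where
  φ : Fin N → V
  q : Fin N → ℕ
  hv : V → Fin N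
  h : Fin N → Fin N → ℤ
  m : Fin N → Fin N → ℤ
  n : V → V → ℤ
  q_hv : ∀ v, q (hv v) = 0
  φ_hv : ∀ v, φ (hv v) = v
  inj : ∀ i j, q i = q j → φ i = φ j → i = j
  next : ∀ i, q i ≠ 0 → ∃ j, q i = q j + 1 ∧ φ i = φ j
  h_nonneg : ∀ i j, 0 ≤ h i j
  h_order : ∀ i j, h i j ≠ 0 → i ≤ j
  m_order : ∀ i j, m i j ≠ 0 → i < j
  m_tau : ∀ i j k, q i = q j + 1 → φ i = φ j → m k j ≠ 0 → i < k
  tau_lt : ∀ i j, q i = q j + 1 → φ i = φ j → i < j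
  mesh_projective : ∀ j, (∀ i, q i = q j + 1 → φ i = φ j → False) → ∀ l, l ≠ j →
    h l j = ∑ k, m k j * h l k
  mesh_left : ∀ i j, q i = q j + 1 → φ i = φ j → ∀ l, l ≠ j →
    h l i + h l j = ∑ k, m k j * h l k
  mesh_right : ∀ i j, q i = q j + 1 → φ i = φ j → ∀ l, l ≠ i →
    h i l + h j l = ∑ k, m k j * h k l
  m_slice_right : ∀ v k, m k (hv v) ≠ 0 → q k ≤ 1
  m_slice_left : ∀ v k, m (hv v) k ≠ 0 → q k = 0
  h_slice : ∀ v i, q i ≠ 0 → h (hv v) i = 0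
  n_nonneg : ∀ v w, 0 ≤ n v w
  paths : ∀ v w, h (hv v) (hv w) = (if v = w then 1 else 0) + ∑ u, h (hv v) (hv u) * n u w

namespace SliceMesh

variable {V : Type*} [Fintype V] [DecidableEq V] {N : ℕ} (D : SliceMesh V N)

theorem eq_hv {i : Fin N} (hi : D.q i = 0) : i = D.hv (D.φ i) :=
  D.inj _ _ (hi.trans (D.q_hv _).symm) (D.φ_hv _).symm

theorem h_eq_zero {i j : Fin N} (hij : j < i) : D.h i j = 0 := by
  by_contra h
  exact absurd (D.h_order _ _ h) (not_le.mpr hij)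

theorem h_hv_pos (v : V) : 1 ≤ D.h (D.hv v) (D.hv v) := by
  rw [D.paths v v, if_pos rfl]
  have : 0 ≤ ∑ u, D.h (D.hv v) (D.hv u) * D.n u v :=
    Finset.sum_nonneg fun u _ => mul_nonneg (D.h_nonneg _ _) (D.n_nonneg _ _)
  omega

theorem n_le (u v w : V) : D.h (D.hv v) (D.hv u) * D.n u w ≤
    ∑ u, D.h (D.hv v) (D.hv u) * D.n u w :=
  Finset.single_le_sum (f := fun u => D.h (D.hv v) (D.hv u) * D.n u w)
    (fun _ _ => mul_nonneg (D.h_nonneg _ _) (D.n_nonneg _ _)) (Finset.mem_univ u)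

/-- Closed paths at `v` prolonged by a loop, together with the trivial path, would outnumber all
closed paths at `v`. -/
theorem n_self (v : V) : D.n v v = 0 := by
  by_contra h
  have h₁ := D.n_le v v v
  have h₂ := D.paths v v
  rw [if_pos rfl] at h₂
  have h₃ := D.h_hv_pos v
  have h₄ := D.n_nonneg v v
  have h₅ : 1 ≤ D.n v v := by omega
  nlinarith

theorem hv_lt_of_n {u v : V} (h : D.n u v ≠ 0) : D.hv u < D.hv v := by
  have h₁ := D.n_le u u v
  have h₂ := D.paths u v
  have h₃ := D.h_hv_pos u
  have h₅ : 1 ≤ D.n u v := by have := D.n_nonneg u v; omega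
  have h₆ : D.h (D.hv u) (D.hv v) ≠ 0 := by
    split_ifs at h₂ <;> nlinarith
  refine lt_of_le_of_ne (D.h_order _ _ h₆) fun he => h ?_
  have : u = v := by rw [← D.φ_hv u, he, D.φ_hv]
  rw [this, D.n_self]

theorem h_hv_self (v : V) : D.h (D.hv v) (D.hv v) = 1 := by
  rw [D.paths v v, if_pos rfl, Finset.sum_eq_zero, add_zero]
  intro u _
  by_contra h
  exact absurd (D.h_order _ _ (left_ne_zero_of_mul h))
    (not_le.mpr (D.hv_lt_of_n (right_ne_zero_of_mul h)))

/-- Expanding both sides by the mesh relations leads to the same double sum of `h` over pairs of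
summands of the middle term. -/
theorem h_self_tau {i j : Fin N} (hq : D.q i = D.q j + 1) (hφ : D.φ i = D.φ j) :
    D.h i i = D.h j j := by
  have hij := D.tau_lt i j hq hφ
  have h₁ := D.mesh_left i j hq hφ i hij.ne
  have h₂ := D.mesh_right i j hq hφ j hij.ne'
  have h₃ : ∑ k, D.m k j * D.h i k = ∑ k, ∑ s, D.m k j * (D.m s j * D.h s k) := by
    refine Finset.sum_congr rfl fun k _ => ?_
    rw [← Finset.mul_sum]
    by_cases hk : D.m k j = 0
    · simp [hk]
    · rw [← D.mesh_right i j hq hφ k (D.m_tau i j k hq hφ hk).ne', D.h_eq_zero (D.m_order k j hk),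
        add_zero]
  have h₄ : ∑ k, D.m k j * D.h k j = ∑ k, ∑ s, D.m k j * (D.m s j * D.h k s) := by
    refine Finset.sum_congr rfl fun k _ => ?_
    rw [← Finset.mul_sum]
    by_cases hk : D.m k j = 0
    · simp [hk]
    · rw [← D.mesh_left i j hq hφ k (D.m_order k j hk).ne,
        D.h_eq_zero (D.m_tau i j k hq hφ hk), zero_add]
  rw [Finset.sum_comm] at h₃
  have h₅ : ∑ k, D.m k j * D.h i k = ∑ k, D.m k j * D.h k j := by
    rw [h₃, h₄]
    refine Finset.sum_congr rfl fun k _ => Finset.sum_congr rfl fun s _ => ?_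
    ring
  rw [h₅] at h₁
  linarith

theorem h_self (i : Fin N) : D.h i i = 1 := by
  induction hq : D.q i generalizing i with
  | zero => rw [D.eq_hv hq, D.h_hv_self]
  | succ c ih =>
    obtain ⟨j, h₁, h₂⟩ := D.next i (by omega)
    rw [D.h_self_tau h₁ h₂, ih j (by omega)]

theorem mesh_projective_add (j : Fin N) (hj : ∀ i, D.q i = D.q j + 1 → D.φ i = D.φ j → False)
    (l : Fin N) : D.h l j = (if l = j then 1 else 0) + ∑ k, D.m k j * D.h l k := by
  split_ifs with hl
  · rw [hl, D.h_self, Finset.sum_eq_zero, add_zero]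
    intro k _
    by_contra h
    exact absurd (D.m_order _ _ (left_ne_zero_of_mul h))
      (not_lt.mpr (D.h_order _ _ (right_ne_zero_of_mul h)))
  · rw [D.mesh_projective j hj l hl, zero_add]

theorem mesh_left_add {i j : Fin N} (hq : D.q i = D.q j + 1) (hφ : D.φ i = D.φ j)
    (l : Fin N) : D.h l i + D.h l j = (if l = j then 1 else 0) + ∑ k, D.m k j * D.h l k := by
  split_ifs with hl
  · rw [hl, D.h_self, D.h_eq_zero (D.tau_lt _ _ hq hφ), zero_add, Finset.sum_eq_zero, add_zero]
    intro k _
    by_contra h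
    exact absurd (D.m_order _ _ (left_ne_zero_of_mul h))
      (not_lt.mpr (D.h_order _ _ (right_ne_zero_of_mul h)))
  · rw [D.mesh_left i j hq hφ l hl, zero_add]

theorem mesh_right_add {i j : Fin N} (hq : D.q i = D.q j + 1) (hφ : D.φ i = D.φ j)
    (l : Fin N) : D.h i l + D.h j l = (if i = l then 1 else 0) + ∑ k, D.m k j * D.h k l := by
  split_ifs with hl
  · rw [← hl, D.h_self, D.h_eq_zero (D.tau_lt _ _ hq hφ), add_zero, Finset.sum_eq_zero, add_zero]
    intro k _
    by_contra h
    exact absurd (D.m_tau i j k hq hφ (left_ne_zero_of_mul h))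
      (not_lt.mpr (D.h_order _ _ (right_ne_zero_of_mul h)))
  · rw [D.mesh_right i j hq hφ l (Ne.symm hl), zero_add]

open Matrix

/-- The inverse of the matrix of dimensions of homomorphism spaces. -/
def invMatrix : Matrix (Fin N) (Fin N) ℤ := Matrix.of fun k j =>
  (if k = j then 1 else 0) - D.m k j + if D.q k = D.q j + 1 ∧ D.φ k = D.φ j then 1 else 0

/-- The mesh relations in the second variable, with the correction terms on the diagonal, read as
one matrix identity. -/
theorem h_mul_invMatrix : Matrix.of D.h * D.invMatrix = 1 := by
  ext l j
  rw [Matrix.mul_apply, Matrix.one_apply]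
  simp only [invMatrix, Matrix.of_apply, mul_add, mul_sub, Finset.sum_add_distrib,
    Finset.sum_sub_distrib, mul_ite, mul_one, mul_zero, Finset.sum_ite_eq', Finset.mem_univ,
    if_true]
  simp only [mul_comm (D.h l _)]
  by_cases hj : ∀ i, D.q i = D.q j + 1 → D.φ i = D.φ j → False
  · rw [D.mesh_projective_add j hj l, Finset.sum_eq_zero
      (f := fun x => if D.q x = D.q j + 1 ∧ D.φ x = D.φ j then D.h l x else 0)
      fun k _ => if_neg fun h => hj k h.1 h.2]
    ring
  · push Not at hj
    obtain ⟨i, hq, hφ, -⟩ := hj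
    have h₁ := D.mesh_left_add hq hφ l
    rw [Finset.sum_eq_single (f := fun x => if D.q x = D.q j + 1 ∧ D.φ x = D.φ j then D.h l x
      else 0) i (fun k _ hk => if_neg fun h => hk (D.inj _ _ (h.1.trans hq.symm)
        (h.2.trans hφ.symm))) (by simp), if_pos ⟨hq, hφ⟩]
    linarith

theorem invMatrix_mul_h : D.invMatrix * Matrix.of D.h = 1 :=
  mul_eq_one_comm.mp D.h_mul_invMatrix

/-- The arrows ending in a module correspond to those starting in its translate. -/
theorem m_translate {i j : Fin N} (hq : D.q i = D.q j + 1) (hφ : D.φ i = D.φ j) (k : Fin N) :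
    D.m i k = D.m k j := by
  -- A one-sided inverse of a square matrix is two-sided. Row `i` of the other product is a mesh
  -- relation with coefficients `m i k`; the mesh relation in the first variable has coefficients `m
  -- k j` and the same value, and `h` is invertible.
  have h₁ : ∀ l, ∑ k, D.m i k * D.h k l = ∑ k, D.m k j * D.h k l := by
    intro l
    have h₂ := congrFun (congrFun D.invMatrix_mul_h i) l
    rw [Matrix.mul_apply, Matrix.one_apply] at h₂
    simp only [invMatrix, Matrix.of_apply, add_mul, sub_mul, Finset.sum_add_distrib,
      Finset.sum_sub_distrib, ite_mul, one_mul, zero_mul, Finset.sum_ite_eq, Finset.mem_univ,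
      if_true] at h₂
    rw [Finset.sum_eq_single (f := fun x => if D.q i = D.q x + 1 ∧ D.φ i = D.φ x then D.h x l
      else 0) j (fun k _ hk => if_neg fun h => hk (D.inj _ _ (by omega)
        (h.2.symm.trans hφ))) (by simp), if_pos ⟨hq, hφ⟩] at h₂
    have h₃ := D.mesh_right_add hq hφ l
    linarith
  have h₂ : (fun k => D.m i k) ᵥ* Matrix.of D.h = (fun k => D.m k j) ᵥ* Matrix.of D.h := by
    funext l
    simpa [Matrix.vecMul, dotProduct] using h₁ l
  have h₃ := congrArg (· ᵥ* D.invMatrix) h₂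
  simp only [Matrix.vecMul_vecMul, D.h_mul_invMatrix, Matrix.vecMul_one] at h₃
  exact congrFun h₃ k

/-- The matrix of dimensions of homomorphism spaces between members of the slice. -/
def sliceMatrix : Matrix V V ℤ := Matrix.of fun v w => D.h (D.hv v) (D.hv w)

theorem sliceMatrix_eq : D.sliceMatrix = 1 + D.sliceMatrix * Matrix.of D.n := by
  ext v w
  rw [Matrix.add_apply, Matrix.mul_apply, Matrix.one_apply]
  exact D.paths v w

theorem sliceMatrix_mul : D.sliceMatrix * (1 - Matrix.of D.n) = 1 := by
  rw [mul_sub, mul_one]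
  exact sub_eq_of_eq_add D.sliceMatrix_eq

theorem mul_sliceMatrix : (1 - Matrix.of D.n) * D.sliceMatrix = 1 :=
  mul_eq_one_comm.mp D.sliceMatrix_mul

theorem hv_injective : Function.Injective D.hv := fun v w h => by
  rw [← D.φ_hv v, h, D.φ_hv]

/-- With `S` the matrix of `h` on the slice, both `n` and the restriction of `m` solve `S = 1 + S
A`, and `S` is invertible. By `h_slice`, terms outside the slice do not contribute. -/
theorem m_hv_hv (v w : V) : D.m (D.hv v) (D.hv w) = D.n v w := by
  have h₁ : D.sliceMatrix * Matrix.of (fun v w => D.m (D.hv v) (D.hv w)) =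
      D.sliceMatrix * Matrix.of D.n := by
    refine add_left_cancel (a := (1 : Matrix V V ℤ)) ?_
    rw [← D.sliceMatrix_eq]
    ext v w
    rw [Matrix.add_apply, Matrix.mul_apply, Matrix.one_apply]
    simp only [sliceMatrix, Matrix.of_apply]
    have h₂ : D.h (D.hv v) (D.hv w) = (if D.hv v = D.hv w then 1 else 0) +
        ∑ k, D.m k (D.hv w) * D.h (D.hv v) k := by
      by_cases hj : ∀ i, D.q i = D.q (D.hv w) + 1 → D.φ i = D.φ (D.hv w) → False
      · exact D.mesh_projective_add _ hj _
      · push Not at hj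
        obtain ⟨i, hq, hφ, -⟩ := hj
        have h₃ := D.mesh_left_add hq hφ (D.hv v)
        rwa [D.h_slice v i (by omega), zero_add] at h₃
    rw [h₂]
    congr 1
    · exact if_congr D.hv_injective.eq_iff.symm rfl rfl
    · refine Fintype.sum_of_injective D.hv D.hv_injective _ _ ?_ ?_
      · intro k hk
        rw [D.h_slice v k, mul_zero]
        exact fun h => hk ⟨_, (D.eq_hv h).symm⟩
      · intro u
        rw [mul_comm]
  have h₂ := congrArg (fun A => (1 - Matrix.of D.n) * A) h₁
  simp only [← Matrix.mul_assoc, D.mul_sliceMatrix, Matrix.one_mul] at h₂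
  exact congrFun (congrFun h₂ v) w

/-- Two applications of `m_translate` give invariance of `m` under simultaneous translation, which
reduces the claim to the slice. Together with the next two lemmas this determines `m` from `Q`. -/
theorem m_of_q_eq {i k : Fin N} (h : D.q i = D.q k) : D.m i k = D.n (D.φ i) (D.φ k) := by
  induction hq : D.q i generalizing i k with
  | zero => rw [← D.m_hv_hv, ← D.eq_hv hq, ← D.eq_hv (h.symm.trans hq)]
  | succ c ih =>
    obtain ⟨i', h₁, h₂⟩ := D.next i (by omega)
    obtain ⟨k', h₃, h₄⟩ := D.next k (by omega)
    rw [D.m_translate h₁ h₂, D.m_translate h₃ h₄, ih (by omega) (by omega), h₂, h₄]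

theorem m_of_q_eq_succ {i k : Fin N} (h : D.q i = D.q k + 1) : D.m i k = D.n (D.φ k) (D.φ i) := by
  obtain ⟨i', h₁, h₂⟩ := D.next i (by omega)
  rw [D.m_translate h₁ h₂, D.m_of_q_eq (by omega), h₂]

theorem m_eq_zero {i k : Fin N} (h : D.q i ≠ D.q k) (h' : D.q i ≠ D.q k + 1) : D.m i k = 0 := by
  induction hq : min (D.q i) (D.q k) generalizing i k with
  | zero =>
    by_contra hm
    by_cases hi : D.q i = 0
    · rw [D.eq_hv hi] at hm
      have := D.m_slice_left _ _ hm
      omega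
    · have hk : D.q k = 0 := by omega
      rw [D.eq_hv hk] at hm
      have := D.m_slice_right _ _ hm
      omega
  | succ c ih =>
    obtain ⟨i', h₁, h₂⟩ := D.next i (by omega)
    obtain ⟨k', h₃, h₄⟩ := D.next k (by omega)
    rw [D.m_translate h₁ h₂, D.m_translate h₃ h₄]
    exact ih (by omega) (by omega) (by omega)

theorem exists_of_le (i : Fin N) (c : ℕ) (hc : c ≤ D.q i) :
    ∃ j, D.q j = c ∧ D.φ j = D.φ i ∧ i ≤ j := by
  induction hd : D.q i - c generalizing i with
  | zero => exact ⟨i, by omega, rfl, le_rfl⟩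
  | succ d ih =>
    obtain ⟨i', h₁, h₂⟩ := D.next i (by omega)
    obtain ⟨j, h₃, h₄, h₅⟩ := ih i' (by omega) (by omega)
    exact ⟨j, h₃, h₄.trans h₂.symm, (D.tau_lt _ _ h₁ h₂).le.trans h₅⟩

theorem le_of_q_le {i j : Fin N} (hφ : D.φ i = D.φ j) (hq : D.q j ≤ D.q i) : i ≤ j := by
  obtain ⟨j', h₁, h₂, h₃⟩ := D.exists_of_le i (D.q j) hq
  rwa [D.inj j j' h₁.symm (hφ.symm.trans h₂.symm)]

/-- The vector of dimensions of the spaces of homomorphisms into the members of the slice. -/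
def dimVec (i : Fin N) : V → ℤ := fun v => D.h i (D.hv v)

theorem dimVec_nonneg (i : Fin N) : 0 ≤ D.dimVec i := fun _ => D.h_nonneg _ _

theorem dimVec_hv (v : V) : D.dimVec (D.hv v) =
    Pi.single v 1 + ∑ u, D.n v u • D.dimVec (D.hv u) := by
  funext w
  have h := congrFun (congrFun D.mul_sliceMatrix v) w
  rw [sub_mul, one_mul, Matrix.sub_apply, Matrix.mul_apply, Matrix.one_apply] at h
  simp only [sliceMatrix, Matrix.of_apply] at h
  simp only [dimVec, Pi.add_apply, Finset.sum_apply, Pi.smul_apply, smul_eq_mul, Pi.single_apply]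
  rw [sub_eq_iff_eq_add] at h
  rw [h]
  simp only [eq_comm]

theorem dimVec_add {i j : Fin N} (hq : D.q i = D.q j + 1) (hφ : D.φ i = D.φ j) :
    D.dimVec i + D.dimVec j = ∑ k, D.m i k • D.dimVec k := by
  funext v
  simp only [dimVec, Pi.add_apply, Finset.sum_apply, Pi.smul_apply, smul_eq_mul,
    D.m_translate hq hφ]
  refine D.mesh_right i j hq hφ _ fun h => ?_
  rw [← h, D.q_hv] at hq
  omega

/-- Equality on the slice propagates down through the mesh relations to `h i l = h j l` for all `l ≥
i`. At `l = i` this reads `1 = 0`. -/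
theorem dimVec_ne {i j : Fin N} (hij : i < j) : D.dimVec i ≠ D.dimVec j := by
  intro hd
  have key : ∀ l, i ≤ l → D.h i l = D.h j l := by
    intro l
    induction l using WellFoundedGT.induction with
    | _ l ih =>
    intro hl
    by_cases hq : D.q l = 0
    · rw [D.eq_hv hq]
      exact congrFun hd _
    obtain ⟨l', h₁, h₂⟩ := D.next l hq
    have hll := D.tau_lt _ _ h₁ h₂
    have h₃ := D.mesh_left_add h₁ h₂ i
    have h₄ := D.mesh_left_add h₁ h₂ j
    have h₅ : ∑ k, D.m k l' * D.h i k = ∑ k, D.m k l' * D.h j k := by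
      refine Finset.sum_congr rfl fun k _ => ?_
      by_cases hk : D.m k l' = 0
      · rw [hk, zero_mul, zero_mul]
      · have := D.m_tau l l' k h₁ h₂ hk
        rw [ih k this (hl.trans this.le)]
    rw [if_neg (hl.trans_lt hll).ne, h₅, ih l' hll (hl.trans hll.le)] at h₃
    -- When `j = l'` the mesh relation for `j` has an extra `1` and `h j l = 0`; comparison would
    -- give `h i l = -1`.
    by_cases hj : j = l'
    · rw [if_pos hj, D.h_eq_zero (hj ▸ hll)] at h₄
      have := D.h_nonneg i l
      linarith
    · rw [if_neg hj] at h₄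
      linarith
  have h₁ := key i le_rfl
  rw [D.h_self, D.h_eq_zero hij] at h₁
  exact one_ne_zero h₁

theorem dimVec_injective : Function.Injective D.dimVec := fun i j h => by
  rcases lt_trichotomy i j with hij | hij | hij
  · exact absurd h (D.dimVec_ne hij)
  · exact hij
  · exact absurd h.symm (D.dimVec_ne hij)

/-- The number of arrows between two vertices. -/
def edges (v w : V) : ℤ := D.n v w + D.n w v

theorem n_eq_zero {v w : V} (h : D.n v w ≠ 0) : D.n w v = 0 := by
  by_contra h'
  exact lt_asymm (D.hv_lt_of_n h) (D.hv_lt_of_n h')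

theorem lt_of_n {i k : Fin N} (hq : D.q i = D.q k) (hn : D.n (D.φ i) (D.φ k) ≠ 0) : i < k :=
  D.m_order _ _ (by rwa [D.m_of_q_eq hq])

theorem lt_of_n_succ {i k : Fin N} (hq : D.q i = D.q k + 1) (hn : D.n (D.φ k) (D.φ i) ≠ 0) :
    i < k :=
  D.m_order _ _ (by rwa [D.m_of_q_eq_succ hq])

/-- If `φ k` is joined to `φ i`, arrows of the translation quiver interleave the two orbits, so a
position strictly between `i` and `i'` leaves one value for `q k`. There `m` counts all edges, since
there are no 2-cycles. -/
theorem edges_of_lt {i i' k : Fin N} (hq : D.q i = D.q i' + 1) (hφ : D.φ i = D.φ i')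
    (h₁ : i < k) (h₂ : k < i') : D.edges (D.φ i) (D.φ k) = D.m i k := by
  by_cases hn : D.n (D.φ i) (D.φ k) = 0
  · by_cases hn' : D.n (D.φ k) (D.φ i) = 0
    · rw [edges, hn, hn']
      by_cases h : D.q i = D.q k
      · rw [D.m_of_q_eq h, hn, add_zero]
      · by_cases h' : D.q i = D.q k + 1
        · rw [D.m_of_q_eq_succ h', hn', add_zero]
        · rw [D.m_eq_zero h h', add_zero]
    · rcases lt_trichotomy (D.q k + 1) (D.q i) with h | h | h
      · obtain ⟨j, h₃, h₄, -⟩ := D.exists_of_le i (D.q k + 1) h.le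
        have h₅ : i' ≤ j := D.le_of_q_le (hφ.symm.trans h₄.symm) (by omega)
        have h₆ := D.lt_of_n_succ h₃ (by rwa [h₄])
        exact absurd (h₂.trans_le h₅) (not_lt.mpr h₆.le)
      · rw [D.m_of_q_eq_succ h.symm, edges, hn, zero_add]
      · obtain ⟨j, h₃, h₄, h₅⟩ := D.exists_of_le k (D.q i) (by omega)
        have h₆ := D.lt_of_n h₃ (by rwa [h₄])
        exact absurd (h₅.trans_lt h₆) (not_lt.mpr h₁.le)
  · have hn' := D.n_eq_zero hn
    rcases lt_trichotomy (D.q k) (D.q i) with h | h | h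
    · obtain ⟨j, h₃, h₄, -⟩ := D.exists_of_le i (D.q k) h.le
      have h₅ : i' ≤ j := D.le_of_q_le (hφ.symm.trans h₄.symm) (by omega)
      have h₆ := D.lt_of_n h₃ (by rwa [h₄])
      exact absurd (h₂.trans_le h₅) (not_lt.mpr h₆.le)
    · rw [D.m_of_q_eq h.symm, edges, hn', add_zero]
    · obtain ⟨j, h₃, h₄, h₅⟩ := D.exists_of_le k (D.q i + 1) (by omega)
      have h₆ := D.lt_of_n_succ h₃ (by rwa [h₄])
      exact absurd (h₅.trans_lt h₆) (not_lt.mpr h₁.le)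

/-- The counterpart of `edges_of_lt` after the last letter `v`, where only members of the slice can
contribute. -/
theorem edges_of_hv_lt {v : V} {k : Fin N} (hk : D.hv v < k) :
    D.edges v (D.φ k) = if D.q k = 0 then D.n v (D.φ k) else 0 := by
  have h₁ : D.n (D.φ k) v = 0 := by
    by_contra hn
    have h₂ := D.hv_lt_of_n hn
    have h₃ : k ≤ D.hv (D.φ k) := D.le_of_q_le (D.φ_hv _).symm (by rw [D.q_hv]; omega)
    exact lt_asymm hk (h₃.trans_lt h₂)
  rw [edges, h₁, add_zero]
  split_ifs with hq
  · rfl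
  · by_contra hn
    obtain ⟨j, h₃, h₄, h₅⟩ := D.exists_of_le k 1 (by omega)
    have h₆ : j < D.hv v := D.lt_of_n_succ (by rw [D.q_hv, h₃]) (by rwa [h₄, D.φ_hv])
    exact lt_asymm hk (h₅.trans_lt h₆)

/-- The roots of the word of the slice are the dimension vectors. -/
theorem root_eq (i : Fin N) :
    inverseAction D.edges ((List.ofFn D.φ).drop (i + 1)) (Pi.single (D.φ i) 1) = D.dimVec i := by
  induction i using WellFoundedGT.induction with
  | _ i ih =>
  -- On the slice the letter `φ i` does not recur, so the simple root is moved to the end of the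
  -- word, and the sum is the one in `dimVec_hv`.
  by_cases hq : D.q i = 0
  · have hi := D.eq_hv hq
    rw [inverseAction_drop_single D.edges D.φ (D.φ i) (i + 1) N (by omega) le_rfl]
    · rw [List.drop_of_length_le (by simp), inverseAction, Module.End.one_apply]
      conv_rhs => rw [hi, D.dimVec_hv]
      congr 1
      symm
      rw [Finset.sum_filter]
      refine Fintype.sum_of_injective D.hv D.hv_injective _ _ ?_ ?_
      · intro k hk
        split_ifs with h
        · have h₁ := D.edges_of_hv_lt (v := D.φ i) (k := k) (by rw [← hi]; exact h.1)
          rw [if_neg fun h => hk ⟨_, (D.eq_hv h).symm⟩] at h₁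
          rw [h₁, zero_smul]
        · rfl
      · intro u
        rw [D.φ_hv]
        split_ifs with h
        · have h₁ := D.edges_of_hv_lt (v := D.φ i) (k := D.hv u) (by rw [← hi]; exact h.1)
          rw [if_pos (D.q_hv u), D.φ_hv] at h₁
          have h₂ := ih (D.hv u) h.1
          rw [D.φ_hv] at h₂
          rw [h₁, h₂]
        · have : D.n (D.φ i) u = 0 := by
            by_contra hn
            have h₁ := D.hv_lt_of_n hn
            rw [← hi] at h₁
            exact h ⟨h₁, (D.hv u).2⟩
          rw [this, zero_smul]
    · intro t h₁ _ h₂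
      have := D.le_of_q_le h₂ (by omega)
      omega
  -- Off the slice the letter recurs first at the inverse translate `i'`, where the simple root
  -- changes sign; what remains is the mesh relation `dimVec_add`.
  · obtain ⟨i', h₁, h₂⟩ := D.next i hq
    have hlt := D.tau_lt _ _ h₁ h₂
    have h₃ : ∀ t : Fin N, i < t → t < i' → D.φ t ≠ D.φ i := by
      intro t h h' he
      rcases Nat.lt_or_ge (D.q t) (D.q i) with hqt | hqt
      · exact absurd (D.le_of_q_le (h₂.symm.trans he.symm) (by omega)) (not_le.mpr h')
      · exact absurd (D.le_of_q_le he hqt) (not_le.mpr h)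
    rw [inverseAction_drop_single D.edges D.φ (D.φ i) (i + 1) i' hlt i'.2.le
      fun t h h' => h₃ t h h', inverseAction_drop, Module.End.mul_apply, h₂,
      simpleReflection_single, cartanEntry, if_pos rfl, map_sub, map_smul, ih i' hlt]
    have h₄ := D.dimVec_add h₁ h₂
    have h₅ : ∑ t : Fin N with i.1 + 1 ≤ t.1 ∧ t.1 < i'.1, D.edges (D.φ i') (D.φ t) •
        inverseAction D.edges ((List.ofFn D.φ).drop (t + 1)) (Pi.single (D.φ t) 1) =
        ∑ k, D.m i k • D.dimVec k := by
      rw [Finset.sum_filter]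
      refine Finset.sum_congr rfl fun t _ => ?_
      split_ifs with h
      · rw [ih t h.1, ← h₂, D.edges_of_lt h₁ h₂ h.1 h.2]
      · have : D.m i t = 0 := by
          by_contra hm
          refine h ⟨D.m_order _ _ hm, ?_⟩
          rw [D.m_translate h₁ h₂] at hm
          exact D.m_order _ _ hm
        rw [this, zero_smul]
    rw [h₅, ← h₄]
    module

/-- The word of the slice is reduced. -/
theorem isReduced {M : CoxeterMatrix V} {W : Type*} [Group W] (cs : CoxeterSystem M W)
    (hM : ∀ x y, x ≠ y → (D.edges x y = 0 ∧ M x y = 2) ∨ (D.edges x y = 1 ∧ M x y = 3) ∨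
      M x y = 0) : cs.IsReduced (List.ofFn D.φ) := by
  have hsymm : ∀ x y, D.edges y x = D.edges x y := fun x y => add_comm _ _
  have hroots : wordRoots D.edges (List.ofFn D.φ) = List.ofFn D.dimVec := by
    rw [wordRoots_ofFn]
    exact congrArg List.ofFn (funext D.root_eq)
  refine cs.isReduced_of_nodup_wordRoots D.edges (isLiftable_simpleReflection D.edges ?_) ?_ ?_
  · intro x y hxy
    rcases hM x y hxy with h | h | h
    · exact Or.inl ⟨h.1, (hsymm x y).trans h.1, h.2⟩
    · exact Or.inr (Or.inl ⟨h.1, (hsymm x y).trans h.1, h.2⟩)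
    · exact Or.inr (Or.inr h)
  · rw [hroots, List.nodup_ofFn]
    exact D.dimVec_injective
  · rw [hroots]
    intro γ hγ
    obtain ⟨i, rfl⟩ := List.mem_ofFn.mp hγ
    exact D.dimVec_nonneg i

end SliceMesh

/-! ### Dimensions of spaces of homomorphisms -/

section HomDim

variable (k : Type u) {R : Type u} [Field k] [Ring R] [Algebra k R]

/-- The dimension of the space of homomorphisms between two modules. -/
def homDim (X Y : ModuleCat.{u} R) : ℕ := Module.finrank k (X ⟶ Y)

open scoped ModuleCat in
theorem finite_hom [Module.Finite k R] {X Y : ModuleCat.{u} R} (hX : Module.Finite R X)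
    (hY : Module.Finite R Y) : Module.Finite k (X ⟶ Y) := by
  have := moduleFinite_of_moduleFinite k X
  have := moduleFinite_of_moduleFinite k Y
  let l : (X ⟶ Y) →ₗ[k] (X →ₗ[k] Y) :=
    { toFun := fun f => f.hom.restrictScalars k
      map_add' := fun f g => rfl
      map_smul' := fun c f => rfl }
  refine Module.Finite.of_injective l fun f g h => ?_
  ext x
  exact congrArg (fun t : X →ₗ[k] Y => t x) h

theorem homDim_congr {X X' Y Y' : ModuleCat.{u} R} (e : X ≅ X') (e' : Y ≅ Y') :
    homDim k X Y = homDim k X' Y' :=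
  (Linear.homCongr k e e').finrank_eq

theorem homDim_eq_zero {X Y : ModuleCat.{u} R} (h : ∀ f : X ⟶ Y, f = 0) : homDim k X Y = 0 := by
  have : Subsingleton (X ⟶ Y) := ⟨fun f g => (h f).trans (h g).symm⟩
  exact Module.finrank_zero_of_subsingleton

theorem homDim_of_mono {Z F Y : ModuleCat.{u} R} {g : F ⟶ Y} (hg : Mono g)
    (h : ∀ t : Z ⟶ Y, ∃ t', t' ≫ g = t) : homDim k Z F = homDim k Z Y := by
  refine (LinearEquiv.ofBijective (Linear.rightComp k Z g) ⟨fun s t hst => ?_, h⟩).finrank_eq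
  exact (cancel_mono g).1 hst

variable [Module.Finite k R]

theorem homDim_indDecomp_right {Z F : ModuleCat.{u} R} (hZ : Module.Finite R Z)
    (d : IndDecomp F) : homDim k Z F = ∑ i, homDim k Z (d.Y i) := by
  have := fun i => finite_hom k hZ (d.finite i)
  let l : (Z ⟶ F) →ₗ[k] ∀ i, (Z ⟶ d.Y i) := LinearMap.pi fun i => Linear.rightComp k Z (d.r i)
  have hl : Function.Bijective l :=
    ⟨fun f g h => d.ext_to fun i => congrFun h i,
      fun f => ⟨∑ i, f i ≫ d.s i, funext fun j => d.sum_comp_section f j⟩⟩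
  rw [homDim, (LinearEquiv.ofBijective l hl).finrank_eq, Module.finrank_pi_fintype]
  rfl

theorem homDim_indDecomp_left {Z F : ModuleCat.{u} R} (hZ : Module.Finite R Z)
    (d : IndDecomp F) : homDim k F Z = ∑ i, homDim k (d.Y i) Z := by
  have := fun i => finite_hom k (d.finite i) hZ
  let l : (F ⟶ Z) →ₗ[k] ∀ i, (d.Y i ⟶ Z) := LinearMap.pi fun i => Linear.leftComp k Z (d.s i)
  have hl : Function.Bijective l :=
    ⟨fun f g h => d.ext_from fun i => congrFun h i,
      fun f => ⟨∑ i, d.r i ≫ f i, funext fun j => d.section_comp_sum f j⟩⟩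
  rw [homDim, (LinearEquiv.ofBijective l hl).finrank_eq, Module.finrank_pi_fintype]
  rfl

theorem homDim_add_right {Z X E Y : ModuleCat.{u} R} {f : X ⟶ E} {g : E ⟶ Y} {w : f ≫ g = 0}
    (hs : (ShortComplex.mk f g w).ShortExact) (hZ : Module.Finite R Z) (hE : Module.Finite R E)
    (h : ∀ t : Z ⟶ Y, ∃ t', t' ≫ g = t) :
    homDim k Z X + homDim k Z Y = homDim k Z E := by
  have := finite_hom k hZ hE
  have := hs.mono_f
  have h₁ := LinearMap.finrank_range_add_finrank_ker (Linear.rightComp k Z g)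
  have h₂ : LinearMap.ker (Linear.rightComp k Z g) = LinearMap.range (Linear.rightComp k Z f) := by
    ext t
    rw [LinearMap.mem_ker, LinearMap.mem_range]
    constructor
    · intro ht
      obtain ⟨l, hl⟩ := exists_lift_of_shortExact hs t ht
      exact ⟨l, hl⟩
    · rintro ⟨l, rfl⟩
      change (l ≫ f) ≫ g = 0
      rw [Category.assoc, w, comp_zero]
  have h₃ : LinearMap.range (Linear.rightComp k Z g) = ⊤ := LinearMap.range_eq_top.2 h
  have h₄ : Function.Injective (Linear.rightComp k Z f) := fun s t hst => (cancel_mono f).1 hst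
  rw [h₃, finrank_top, h₂, LinearMap.finrank_range_of_inj h₄] at h₁
  exact (add_comm _ _).trans h₁

theorem homDim_add_left {Z X E Y : ModuleCat.{u} R} {f : X ⟶ E} {g : E ⟶ Y} {w : f ≫ g = 0}
    (hs : (ShortComplex.mk f g w).ShortExact) (hZ : Module.Finite R Z) (hE : Module.Finite R E)
    (h : ∀ t : X ⟶ Z, ∃ t', f ≫ t' = t) :
    homDim k X Z + homDim k Y Z = homDim k E Z := by
  have := finite_hom k hE hZ
  have := hs.epi_g
  have h₁ := LinearMap.finrank_range_add_finrank_ker (Linear.leftComp k Z f)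
  have h₂ : LinearMap.ker (Linear.leftComp k Z f) = LinearMap.range (Linear.leftComp k Z g) := by
    ext t
    rw [LinearMap.mem_ker, LinearMap.mem_range]
    constructor
    · intro ht
      obtain ⟨l, hl⟩ := exists_desc_of_shortExact hs t ht
      exact ⟨l, hl⟩
    · rintro ⟨l, rfl⟩
      change f ≫ g ≫ l = 0
      rw [← Category.assoc, w, zero_comp]
  have h₃ : LinearMap.range (Linear.leftComp k Z f) = ⊤ := LinearMap.range_eq_top.2 h
  have h₄ : Function.Injective (Linear.leftComp k Z g) := fun s t hst => (cancel_epi g).1 hst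
  rw [h₃, finrank_top, h₂, LinearMap.finrank_range_of_inj h₄] at h₁
  exact h₁

end HomDim

/-! ### Counting paths -/

section Paths

/-- A path is trivial or ends with an arrow. -/
def pathEquiv {V : Type v} [Quiver.{w} V] (a b : V) :
    Quiver.Path a b ≃ PLift (a = b) ⊕ (Σ c, Quiver.Path a c × (c ⟶ b)) where
  toFun
    | .nil => Sum.inl ⟨rfl⟩
    | .cons p f => Sum.inr ⟨_, p, f⟩
  invFun
    | .inl ⟨h⟩ => h ▸ .nil
    | .inr ⟨_, p, f⟩ => .cons p f
  left_inv p := by cases p <;> rfl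
  right_inv x := by
    rcases x with ⟨⟨h⟩⟩ | ⟨c, p, f⟩
    · subst h; rfl
    · rfl

theorem card_path {V : Type v} [Fintype V] [DecidableEq V] [Quiver.{w} V]
    [∀ a b : V, Fintype (a ⟶ b)]
    (hfin : ∀ a b : V, Finite (Quiver.Path a b)) (a b : V) :
    Nat.card (Quiver.Path a b) =
      (if a = b then 1 else 0) + ∑ c, Nat.card (Quiver.Path a c) * Fintype.card (c ⟶ b) := by
  rw [Nat.card_congr (pathEquiv a b), Nat.card_sum, Nat.card_sigma]
  congr 1
  · split_ifs with h
    · have : Unique (PLift (a = b)) := ⟨⟨⟨h⟩⟩, fun ⟨_⟩ => rfl⟩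
      exact Nat.card_unique
    · have : IsEmpty (PLift (a = b)) := ⟨fun x => h x.down⟩
      exact Nat.card_of_isEmpty
  · refine Finset.sum_congr rfl fun c _ => ?_
    rw [Nat.card_prod, Nat.card_eq_fintype_card (α := (c ⟶ b))]

variable (k : Type u) {R : Type u} [Field k] [Ring R] [Algebra k R]
variable {V : Type v} [Fintype V] [Quiver.{w} V] {H : V → ModuleCat.{u} R}

/-- The inclusion of the space spanned by the paths from `a` to `b`. -/
def pathIncl (a b : V) : (Quiver.Path a b →₀ k) →ₗ[k] PathAlgebra k V :=
  Finsupp.lmapDomain k k (fun p => (⟨a, b, p⟩ : AllPaths V))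

theorem pathIncl_single {a b : V} (p : Quiver.Path a b) :
    pathIncl k a b (Finsupp.single p 1) = PathAlgebra.ofPath k p :=
  Finsupp.mapDomain_single

theorem pathIncl_injective (a b : V) : Function.Injective (pathIncl k a b) :=
  Finsupp.mapDomain_injective fun p q h => by simpa using h

theorem sandwich_mem (a b : V) (x : PathAlgebra k V) :
    PathAlgebra.ofPath k (Quiver.Path.nil : Quiver.Path b b) *
      (x * PathAlgebra.ofPath k (Quiver.Path.nil : Quiver.Path a a)) ∈
      LinearMap.range (pathIncl k a b) := by
  induction x using PathAlgebra.induction with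
  | h0 => rw [PathAlgebra.zero_mul', PathAlgebra.mul_zero']; exact zero_mem _
  | ha x y hx hy =>
    rw [PathAlgebra.add_mul', PathAlgebra.mul_add']
    exact add_mem hx hy
  | hs c p =>
    rename_i a' b'
    rw [PathAlgebra.smul_mul', PathAlgebra.mul_smul']
    refine Submodule.smul_mem _ _ ?_
    by_cases h : a = a'
    · subst h
      rw [PathAlgebra.ofPath_mul_ofPath_same, Quiver.Path.nil_comp]
      by_cases h' : b' = b
      · subst h'
        rw [PathAlgebra.ofPath_mul_ofPath_same, Quiver.Path.comp_nil]
        exact ⟨_, pathIncl_single k p⟩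
      · rw [PathAlgebra.ofPath_mul_ofPath_ne _ _ h']
        exact zero_mem _
    · rw [PathAlgebra.ofPath_mul_ofPath_ne _ _ h, PathAlgebra.mul_zero']
      exact zero_mem _

/-- The space of homomorphisms between two members of the slice has the paths as a basis. -/
theorem IsQuiverOfEnd.nonempty_equiv (hQ : IsQuiverOfEnd k H) (a b : V) :
    Nonempty ((H a ⟶ H b) ≃ₗ[k] (Quiver.Path a b →₀ k)) := by
  obtain ⟨e, he⟩ := hQ
  let j : (H a ⟶ H b) →ₗ[k] End (⨁ H) :=
    { toFun := fun f => End.of (biproduct.π H a ≫ f ≫ biproduct.ι H b)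
      map_add' := fun f g => by
        rw [Preadditive.add_comp, Preadditive.comp_add]
      map_smul' := fun c f => by
        rw [Linear.smul_comp, Linear.comp_smul]; rfl }
  have hj : Function.Injective j := by
    intro f g h
    have h₁ : biproduct.π H a ≫ f ≫ biproduct.ι H b = biproduct.π H a ≫ g ≫ biproduct.ι H b := h
    exact (cancel_mono (biproduct.ι H b)).1 ((cancel_epi (biproduct.π H a)).1 h₁)
  let l : (H a ⟶ H b) →ₗ[k] PathAlgebra k V := e.toLinearMap ∘ₗ j
  have hl : Function.Injective l := e.injective.comp hj
  have hrange : LinearMap.range l = LinearMap.range (pathIncl k a b) := by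
    apply le_antisymm
    · rintro _ ⟨f, rfl⟩
      have h₁ : j f = End.of (biproduct.π H b ≫ biproduct.ι H b) *
          (j f * End.of (biproduct.π H a ≫ biproduct.ι H a)) := by
        change biproduct.π H a ≫ f ≫ biproduct.ι H b = ((biproduct.π H a ≫ biproduct.ι H a) ≫
          biproduct.π H a ≫ f ≫ biproduct.ι H b) ≫ biproduct.π H b ≫ biproduct.ι H b
        simp
      have h₂ : l f = e (j f) := rfl
      rw [h₂, h₁, map_mul, map_mul, he, he]
      exact sandwich_mem k a b _
    · rintro _ ⟨x, rfl⟩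
      induction x using Finsupp.induction_linear with
      | zero => rw [map_zero]; exact zero_mem _
      | add x y hx hy => rw [map_add]; exact add_mem hx hy
      | single p c =>
        have h₀ : (Finsupp.single p c : Quiver.Path a b →₀ k) = c • Finsupp.single p 1 := by simp
        rw [h₀, map_smul, pathIncl_single]
        refine Submodule.smul_mem _ _ ?_
        let y : (⨁ H) ⟶ (⨁ H) := (e.symm (PathAlgebra.ofPath k p)).asHom
        refine ⟨biproduct.ι H a ≫ y ≫ biproduct.π H b, ?_⟩
        have h₁ : j (biproduct.ι H a ≫ y ≫ biproduct.π H b) =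
            End.of (biproduct.π H b ≫ biproduct.ι H b) *
              (End.of y * End.of (biproduct.π H a ≫ biproduct.ι H a)) := by
          change biproduct.π H a ≫ (biproduct.ι H a ≫ y ≫ biproduct.π H b) ≫ biproduct.ι H b =
            ((biproduct.π H a ≫ biproduct.ι H a) ≫ y) ≫ biproduct.π H b ≫ biproduct.ι H b
          simp
        change e (j _) = _
        rw [h₁, map_mul, map_mul, he, he]
        change _ * (e (e.symm _) * _) = _
        rw [AlgEquiv.apply_symm_apply, PathAlgebra.ofPath_mul_ofPath_same,
          PathAlgebra.ofPath_mul_ofPath_same, Quiver.Path.nil_comp, Quiver.Path.comp_nil]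
  exact ⟨(LinearEquiv.ofInjective l hl).trans ((LinearEquiv.ofEq _ _ hrange).trans
    (LinearEquiv.ofInjective _ (pathIncl_injective k a b)).symm)⟩

variable [Module.Finite k R]

/-- Paths are a basis of a finite-dimensional Hom space, hence finite in number, and they are
counted by their last arrow. -/
theorem IsQuiverOfEnd.homDim_eq [DecidableEq V] [∀ a b : V, Fintype (a ⟶ b)]
    (hQ : IsQuiverOfEnd k H) (hH : ∀ a, IsInd (H a)) (a b : V) :
    homDim k (H a) (H b) = (if a = b then 1 else 0) +
      ∑ c, homDim k (H a) (H c) * Fintype.card (c ⟶ b) := by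
  have hb : ∀ a b, Finite (Quiver.Path a b) ∧
      homDim k (H a) (H b) = Nat.card (Quiver.Path a b) := by
    intro a b
    obtain ⟨l⟩ := hQ.nonempty_equiv k a b
    have := finite_hom k (hH a).1 (hH b).1
    exact ⟨Module.Finite.finite_basis (Module.Basis.ofRepr l),
      Module.finrank_eq_nat_card_basis (Module.Basis.ofRepr l)⟩
  simp only [fun a b => (hb a b).2]
  exact card_path (fun a b => (hb a b).1) a b

/-- For isomorphic `H a` and `H b` the path recursions from `a` and from `b` to `b` would have equal
terms, apart from the trivial path, which occurs in only one. -/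
theorem IsQuiverOfEnd.eq_of_iso [∀ a b : V, Fintype (a ⟶ b)] (hQ : IsQuiverOfEnd k H)
    (hH : ∀ a, IsInd (H a)) {a b : V} (h : Nonempty (H a ≅ H b)) : a = b := by
  classical
  by_contra hab
  obtain ⟨e⟩ := h
  have h₁ := hQ.homDim_eq k hH a b
  have h₂ := hQ.homDim_eq k hH b b
  simp only [homDim_congr k e (Iso.refl _)] at h₁
  rw [if_neg hab] at h₁
  rw [if_pos rfl] at h₂
  omega

end Paths

/-! ### The word of a postprojective slice -/

section Sink

variable {R : Type u} [Ring R]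

theorem IsSink.not_isTau_of_mono {F W Y : ModuleCat.{u} R} {g : F ⟶ Y} (h : IsSink g)
    (hg : Mono g) : ¬ IsTau W Y := by
  rintro ⟨E, f', g', h'⟩
  have := h'.shortExact.epi_g
  obtain ⟨t, ht⟩ := h.factor E g' h'.finite h'.not_splitEpi
  have : Epi (t ≫ g) := by rw [ht]; assumption
  have : Epi g := epi_of_epi t g
  have : IsIso g := isIso_of_mono_of_epi g
  exact h.not_splitEpi inferInstance

variable [IsArtinianRing R]

theorem IsTauInvPow.left_unique {q : ℕ} {X X' Y : ModuleCat.{u} R} (h : IsTauInvPow q X Y)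
    (h' : IsTauInvPow q X' Y) : Nonempty (X ≅ X') := by
  induction q generalizing X X' with
  | zero => exact ⟨h.some ≪≫ h'.some.symm⟩
  | succ q ih =>
    obtain ⟨Z, hZ, h⟩ := h
    obtain ⟨W, hW, h'⟩ := h'
    obtain ⟨e⟩ := ih h h'
    exact (hZ.of_iso (Iso.refl _) e).left_unique hW

/-- An indecomposable module in a postprojective component has a sink map which is either a
monomorphism or part of an almost split sequence. -/
theorem IsPostprojective.exists_isSink_mono_or {Y : ModuleCat.{u} R} (hY : IsPostprojective Y) :
    ∃ (F : ModuleCat.{u} R) (g : F ⟶ Y), IsSink g ∧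
      (Mono g ∨ ∃ (W : ModuleCat.{u} R) (f : W ⟶ F), IsAlmostSplit f g) := by
  by_cases hp : Projective Y
  · obtain ⟨F, g, hg, hm⟩ := exists_isSink_of_projective hY.1 hp
    exact ⟨F, g, hg, Or.inl hm⟩
  · obtain ⟨X, E, f, g, h⟩ := hY.exists_isTau hp
    exact ⟨E, g, h.isSink, Or.inr ⟨X, f, h⟩⟩

end Sink

/-! ### From the slice to its numerical data -/

section Word

variable {k R : Type u} [Field k] [Ring R] [Algebra k R] [Module.Finite k R] [IsArtinianRing R]
variable {V : Type v} {H : V → ModuleCat.{u} R}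

theorem isPred_of_isTauInvPow (hH : IsPostprojectiveSlice H) {q : ℕ} {Z : ModuleCat.{u} R} {a : V}
    (hZ : IsInd Z) (h : IsTauInvPow q Z (H a)) : IsPred H Z := by
  cases q with
  | zero => exact (hH.1.isPred a).of_iso h.some.symm
  | succ q => exact (hH.1.isPred a).of_precedes hZ (precedes_of_transGen h.transGen)

variable [Fintype V] [Quiver.{w} V] [∀ a b : V, Fintype (a ⟶ b)]

/-- If the exponents differed, a member of the slice would be the translate of a predecessor, and
its identity would be a forbidden non-zero map. -/
theorem isTauInvPow_slice_unique (hH : IsPostprojectiveSlice H) (hQ : IsQuiverOfEnd k H)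
    {X : ModuleCat.{u} R} {q q' : ℕ} {a a' : V} (h : IsTauInvPow q X (H a))
    (h' : IsTauInvPow q' X (H a')) : q = q' ∧ a = a' := by
  wlog hqq : q ≤ q' generalizing q q' a a'
  · have := this h' h (by omega)
    exact ⟨this.1.symm, this.2.symm⟩
  obtain ⟨r, rfl⟩ := Nat.exists_eq_add_of_le hqq
  have h₁ := h.cancel h'
  cases r with
  | zero => exact ⟨rfl, hQ.eq_of_iso k hH.1.ind h₁⟩
  | succ r =>
    obtain ⟨Z, hZ, h₂⟩ := h₁
    exact absurd (hH.1.hom_eq_zero (isPred_of_isTauInvPow hH hZ.ind_right h₂) hZ (𝟙 (H a)))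
      (hH.1.ind a).id_ne_zero

open Classical in
/-- The numerical data of a postprojective slice. -/
theorem exists_sliceMesh (hH : IsPostprojectiveSlice H) (hQ : IsQuiverOfEnd k H) {N : ℕ}
    {X : Fin N → ModuleCat.{u} R} (hX : IsPredList H X) (φ : Fin N → V)
    (hφ : ∀ i, ∃ q : ℕ, IsTauInvPow q (X i) (H (φ i))) :
    ∃ D : SliceMesh V N, D.φ = φ ∧ ∀ a b : V, D.n a b = (Fintype.card (a ⟶ b) : ℤ) := by
  choose q hq using hφ
  have uniq : ∀ {i r a}, IsTauInvPow r (X i) (H a) → q i = r ∧ φ i = a := fun h =>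
    isTauInvPow_slice_unique hH hQ (hq _) h
  choose hv hhv using fun a => hX.complete (H a) (hH.1.isPred a)
  have hvq : ∀ a, q (hv a) = 0 ∧ φ (hv a) = a := fun a =>
    uniq (r := 0) ⟨(hhv a).some.symm⟩
  have tau_iff : ∀ i j, IsTau (X i) (X j) ↔ q i = q j + 1 ∧ φ i = φ j := by
    intro i j
    constructor
    · intro h
      exact uniq (r := q j + 1) ⟨X j, h, hq j⟩
    · rintro ⟨h₁, h₂⟩
      have h₃ := hq i
      rw [h₁, h₂] at h₃
      obtain ⟨Z, hZ, h₄⟩ := h₃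
      exact hZ.of_iso (Iso.refl _) (h₄.left_unique (hq j)).some
  have hnext : ∀ i, q i ≠ 0 → ∃ j, IsTau (X i) (X j) := by
    intro i hi
    obtain ⟨c, hc⟩ := Nat.exists_eq_succ_of_ne_zero hi
    have h₃ := hq i
    rw [hc] at h₃
    obtain ⟨Z, hZ, h₄⟩ := h₃
    obtain ⟨j, ⟨e⟩⟩ := hX.complete Z (isPred_of_isTauInvPow hH hZ.ind_right h₄)
    exact ⟨j, hZ.of_iso (Iso.refl _) e⟩
  have hfin : ∀ i, Module.Finite R (X i) := fun i => (hX.mem i).1.1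
  choose F g hg hg' using fun j =>
    ((hX.mem j).isPostprojective hH).exists_isSink_mono_or
  have d : ∀ j, IndDecomp (F j) := fun j => (nonempty_indDecomp (F j) (hg j).finite).some
  choose κ hκ using fun j s =>
    hX.complete ((d j).Y s) ((hX.mem j).of_arArrow ((hg j).arArrow (d j) s))
  -- The entry `m i j` counts the summands isomorphic to `X i` in the source of the chosen sink map
  -- of `X j`; this covers projective `X j` as well.
  let m : Fin N → Fin N → ℤ := fun i j => ∑ s : (d j).ι, if κ j s = i then 1 else 0
  have hm : ∀ {i j}, m i j ≠ 0 → ∃ s, κ j s = i := by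
    intro i j h
    by_contra! h'
    exact h (Finset.sum_eq_zero fun s _ => if_neg (h' s))
  have harr : ∀ {i j}, m i j ≠ 0 → ARArrow (X i) (X j) := by
    intro i j h
    obtain ⟨s, rfl⟩ := hm h
    exact ((hg j).arArrow (d j) s).of_iso (hκ j s).some (Iso.refl _)
  have hsum : ∀ (j : Fin N) (c : Fin N → ℤ), ∑ i, m i j * c i = ∑ s : (d j).ι, c (κ j s) := by
    intro j c
    simp only [m, Finset.sum_mul, ite_mul, one_mul, zero_mul]
    rw [Finset.sum_comm]
    simp
  have hright : ∀ l j, (homDim k (X l) (F j) : ℤ) = ∑ i, m i j * (homDim k (X l) (X i) : ℤ) := by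
    intro l j
    rw [hsum, homDim_indDecomp_right k (hfin l) (d j), Nat.cast_sum]
    exact Finset.sum_congr rfl fun s _ => by
      rw [homDim_congr k (Iso.refl (X l)) (hκ j s).some]
  have hleft : ∀ l j, (homDim k (F j) (X l) : ℤ) = ∑ i, m i j * (homDim k (X i) (X l) : ℤ) := by
    intro l j
    rw [hsum, homDim_indDecomp_left k (hfin l) (d j), Nat.cast_sum]
    exact Finset.sum_congr rfl fun s _ => by
      rw [homDim_congr k (hκ j s).some (Iso.refl (X l))]
  -- Between distinct members of the list no map is a split epi, so the sink map is surjective on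
  -- Hom spaces and dimensions add up without correction.
  have hfac : ∀ l j, l ≠ j → ∀ t : X l ⟶ X j, ∃ t', t' ≫ g j = t := by
    intro l j hlj t
    refine (hg j).factor (X l) t (hfin l) fun ht => hlj ?_
    have := (hX.mem l).1.isIso_of_isSplitEpi (hX.mem j).1 t
    exact hX.injective l j ⟨asIso t⟩
  have hAS : ∀ {i j}, IsTau (X i) (X j) → ∃ f : X i ⟶ F j, IsAlmostSplit f (g j) := by
    intro i j h
    rcases hg' j with hmono | ⟨W, f, hf⟩
    · exact absurd h ((hg j).not_isTau_of_mono hmono)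
    · obtain ⟨e⟩ := IsTau.left_unique ⟨_, f, g j, hf⟩ h
      exact ⟨_, hf.iso_comp e.symm⟩
  have hzero : ∀ a i, q i ≠ 0 → ∀ f : H a ⟶ X i, f = 0 := by
    intro a i hi f
    obtain ⟨j, hj⟩ := hnext i hi
    exact hH.1.hom_eq_zero (hX.mem j) hj f
  refine ⟨{
    φ := φ
    q := q
    hv := hv
    h := fun i j => homDim k (X i) (X j)
    m := m
    n := fun a b => Fintype.card (a ⟶ b)
    q_hv := fun a => (hvq a).1
    φ_hv := fun a => (hvq a).2
    inj := ?_
    next := ?_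
    h_nonneg := fun i j => Int.natCast_nonneg _
    h_order := ?_
    m_order := ?_
    m_tau := ?_
    tau_lt := ?_
    mesh_projective := ?_
    mesh_left := ?_
    mesh_right := ?_
    m_slice_right := ?_
    m_slice_left := ?_
    h_slice := ?_
    n_nonneg := fun a b => Int.natCast_nonneg _
    paths := ?_ }, rfl, fun a b => rfl⟩
  · intro i j h₁ h₂
    have h₃ := hq i
    rw [h₁, h₂] at h₃
    exact hX.injective i j (h₃.left_unique (hq j))
  · intro i hi
    obtain ⟨j, hj⟩ := hnext i hi
    exact ⟨j, (tau_iff i j).1 hj⟩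
  · intro i j h
    refine hX.ordered i j ?_
    by_contra! h'
    exact h (by rw [homDim_eq_zero k h', Nat.cast_zero])
  · intro i j h
    exact hX.lt_of_transGen hH (Relation.TransGen.single (harr h))
  · intro i j l h₁ h₂ h
    obtain ⟨f, hf⟩ := hAS ((tau_iff i j).2 ⟨h₁, h₂⟩)
    obtain ⟨s, rfl⟩ := hm h
    exact hX.lt_of_transGen hH (Relation.TransGen.single
      ((hf.arArrow_left (d j) s).of_iso (Iso.refl _) (hκ j s).some))
  · intro i j h₁ h₂
    exact hX.lt_of_transGen hH ((tau_iff i j).2 ⟨h₁, h₂⟩).transGen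
  · intro j hj l hl
    rcases hg' j with hmono | ⟨W, f, hf⟩
    · rw [← hright, homDim_of_mono k hmono (hfac l j hl)]
    · have hW : IsTau W (X j) := ⟨_, f, g j, hf⟩
      obtain ⟨i, ⟨e⟩⟩ := hX.complete W ((hX.mem j).of_isTau hW)
      have h₁ := (tau_iff i j).1 (hW.of_iso e (Iso.refl _))
      exact (hj i h₁.1 h₁.2).elim
  · intro i j h₁ h₂ l hl
    obtain ⟨f, hf⟩ := hAS ((tau_iff i j).2 ⟨h₁, h₂⟩)
    rw [← hright, ← homDim_add_right k hf.shortExact (hfin l) hf.finite (hfac l j hl),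
      Nat.cast_add]
  · intro i j h₁ h₂ l hl
    obtain ⟨f, hf⟩ := hAS ((tau_iff i j).2 ⟨h₁, h₂⟩)
    rw [← hleft, ← homDim_add_left k hf.shortExact (hfin l) hf.finite, Nat.cast_add]
    intro t
    refine hf.left_factor (X l) t (hfin l) fun ht => hl ?_
    have := (hX.mem i).1.isIso_of_isSplitMono (hX.mem l).1 t
    exact (hX.injective i l ⟨asIso t⟩).symm
  -- The slice axiom on direct predecessors leaves only members of the slice and their translates.
  · intro a i h
    obtain ⟨b, e | h₁⟩ := hH.1.predecessor a (X i)
      ((harr h).of_iso (Iso.refl _) (hhv a).some.symm)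
    · rw [(uniq (r := 0) e).1]
      exact zero_le_one
    · rw [(uniq (r := 1) ⟨H b, h₁, ⟨Iso.refl _⟩⟩).1]
  -- A direct successor of the slice that is itself a predecessor of it lies in the slice, by
  -- path-closedness.
  · intro a i h
    obtain ⟨c, ⟨e⟩⟩ := hH.1.exists_iso (hX.mem i)
      ((harr h).of_iso (hhv a).some.symm (Iso.refl _)).precedes
    exact (uniq (r := 0) ⟨e⟩).1
  · intro a i hi
    rw [homDim_congr k (hhv a).some.symm (Iso.refl _), homDim_eq_zero k (hzero a i hi),
      Nat.cast_zero]
  · intro a b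
    simp only [fun a b => homDim_congr k (hhv a).some.symm (hhv b).some.symm]
    rw [hQ.homDim_eq k hH.1.ind a b]
    push_cast
    rfl

/-- The word attached to a list of the predecessors of a postprojective slice is reduced. -/
theorem IsPredList.isReduced (hH : IsPostprojectiveSlice H) (hQ : IsQuiverOfEnd k H) {N : ℕ}
    {X : Fin N → ModuleCat.{u} R} (hX : IsPredList H X) (φ : Fin N → V)
    (hφ : ∀ i, ∃ q : ℕ, IsTauInvPow q (X i) (H (φ i))) :
    (quiverCoxeterMatrix V).toCoxeterSystem.IsReduced (List.ofFn φ) := by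
  classical
  obtain ⟨D, rfl, hn⟩ := exists_sliceMesh hH hQ hX φ hφ
  refine D.isReduced _ fun x y hxy => ?_
  have hM : quiverCoxeterMatrix V x y =
      if Fintype.card (x ⟶ y) + Fintype.card (y ⟶ x) = 0 then 2
      else if Fintype.card (x ⟶ y) + Fintype.card (y ⟶ x) = 1 then 3 else 0 := by
    change (if x = y then 1 else _) = _
    rw [if_neg hxy]
  rw [hM, SliceMesh.edges, hn, hn]
  split_ifs with h₁ h₂
  · exact Or.inl ⟨by exact_mod_cast h₁, rfl⟩
  · exact Or.inr (Or.inl ⟨by exact_mod_cast h₂, rfl⟩)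
  · exact Or.inr (Or.inr rfl)

end Word

/-- A concealed algebra is finite-dimensional. -/
theorem IsConcealed.finite {k B : Type u} [Field k] [Ring B] [Algebra k B]
    (hB : IsConcealed k B) : Module.Finite k B := by
  obtain ⟨A, _, _, T, hA, -, hT, -, ⟨e⟩⟩ := hB
  have : Module.Finite k Aᵐᵒᵖ := Module.Finite.equiv (MulOpposite.opLinearEquiv k)
  have : Module.Finite k (End T) := finite_hom k hT.finite hT.finite
  exact Module.Finite.equiv e.symm.toLinearEquiv

end

theorem mainTheorem12 {k B : Type u} [Field k] [Ring B] [Algebra k B] (hB : IsConcealed k B)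
    {V : Type v} [Fintype V] [Quiver.{w} V] [∀ a b : V, Fintype (a ⟶ b)]
    (H : V → ModuleCat.{u} Bᵐᵒᵖ) (hH : IsPostprojectiveSlice H) (hQ : IsQuiverOfEnd k H) :
    (∃ (N : ℕ) (X : Fin N → ModuleCat.{u} Bᵐᵒᵖ), IsOrdering H X) ∧
    ∀ (N : ℕ) (X : Fin N → ModuleCat.{u} Bᵐᵒᵖ), IsOrdering H X →
      (∀ i, ∃! q : ℕ × V, IsTauInvPow q.1 (X i) (H q.2)) ∧
      ∀ φ : Fin N → V, (∀ i, ∃ q : ℕ, IsTauInvPow q (X i) (H (φ i))) →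
        (quiverCoxeterMatrix V).toCoxeterSystem.IsReduced (List.ofFn φ) := by
  have hfB : Module.Finite k B := hB.finite
  have hf : Module.Finite k Bᵐᵒᵖ := Module.Finite.equiv (MulOpposite.opLinearEquiv k)
  have hart : IsArtinianRing Bᵐᵒᵖ := isArtinianRing_of_finite k
  refine ⟨?_, fun N X hX => ?_⟩
  · obtain ⟨N, X, hX⟩ := hH.exists_isPredList
    exact ⟨N, X, fun i => (hX.mem i).1.2, fun i => (hX.mem i).inM hH, hX.injective,
      fun Y hY hY' => hX.complete Y (isPred_of_inM k hH hY hY'), hX.ordered⟩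
  -- Since `M` and the predecessors of the slice have the same indecomposables, an ordering of `M`
  -- is a list of predecessors.
  · have hX' : IsPredList H X :=
      ⟨fun i => isPred_of_inM k hH (hX.ind i) (hX.mem i), hX.injective,
        fun Y hY => hX.complete Y hY.1.2 (hY.inM hH), hX.ordered⟩
    refine ⟨fun i => ?_, fun φ hφ => hX'.isReduced hH hQ φ hφ⟩
    obtain ⟨q, a, h⟩ := (hX'.mem i).exists_isTauInvPow k hH
    refine ⟨(q, a), h, ?_⟩
    rintro ⟨q', a'⟩ h'
    obtain ⟨rfl, rfl⟩ := isTauInvPow_slice_unique hH hQ h h'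
    rfl
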